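/- **Model.** Fix SINR parameters: path loss $\alpha>2$, threshold $\beta\ge 1$, ambient noise $\mathcal N>0$, sensitivity $\varepsilon>0$ and a uniform transmission power $P>0$. A network consists of $n\ge1$ stations at distinct points of the Euclidean plane, with distinct labels in $[N]=\{1,\dots,N\}$, where $N$ is bounded by a fixed polynomial in $n$. Stations work in synchronous rounds with a global clock. If exactly the stations in $\mathcal T$ transmit, then $u$ receives the message of $v$ iff $v\in\mathcal T$, $u\notin\mathcal T$, $P\,\mathrm{dist}(v,u)^{-\alpha}\ge(1+\varepsilon)\beta\mathcal N$ and $P\,\mathrm{dist}(v,u)^{-\alpha}\ge\beta\big(\mathcal N+\sum_{w\in\mathcal T\setminus\{v\}}P\,\mathrm{dist}(w,u)^{-\alpha}\big)$. In the communication graph $G$, assumed connected, $v$ and $u$ are adjacent iff $u$ receives the message of $v$ when $v$ alone transmits. Initially each station knows $n$, $N$, its own label, the labels of its neighbours in $G$ and whether it belongs to the nonempty set $K$ of rumour holders. An $(N,x)$-SSF is a sequence of subsets of $[N]$ such that for each nonempty $Z\subseteq[N]$ with $|Z|\le x$ and each $z\in Z$ some member meets $Z$ exactly in $\{z\}$.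 An $(N,x,y)$-selector is a sequence of subsets of $[N]$ such that for each $A\subseteq[N]$ with $|A|=x$ at least $y$ elements $a\in A$ satisfy $S\cap A=\{a\}$ for some member $S$. A station follows such a sequence by transmitting in its $j$-th round iff its label is in the $j$-th set. A *BTD tree* of $G$ rooted at $s$ is a rooted spanning tree produced by a breadth-then-depth search: start with the tree $\{s\}$; when a node is visited, all its neighbours outside of the current tree become its children; then these children are visited in some order, each followed recursively by its descendants, before any other waiting node. **Algorithm BTD_Traversals.** *Stage 1.* The stations in $K$ follow $(N,\lceil(2/3)^in\rceil,\lceil(2/3)^in/2\rceil)$-selectors, one after another, for $i=1,\dots,\lceil\log_{3/2}n\rceil$, transmitting their labels; a station that hears a smaller label becomes idle. Each survivor issues a token whose id is its own label. *Stage 2.* Each survivor starts the following distributed search BTD_Construct for its token $\tau$. Every node keeps a list $L$ of neighbours believed to be unmarked (initially all its neighbours except the root of $\tau$). When a node $w$ gets the token for the first time (from its parent, or as the root), it removes the nodes $z$ from $L$ one by one, sends a message check to $z$, and makes $z$ its child when the message reply arrives from $z$; then it sends the token to its children, one by one, each time waiting for its return; finally it returns the token to its parent. An unvisited node that overhears a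 check addressed to $z$, and any node that overhears a reply sent by $z$ to another node, removes $z$ from $L$. Each round of this search is simulated by the procedure Smallest_Token with a fixed SSF $F$: in the first $|F|$ rounds the token holders (the nodes that want to send a message) transmit their messages following $F$; in the next $|F|$ rounds each node to which a message was addressed transmits the smallest token addressed to it, following $F$; a node becomes the holder of that token iff it knows no smaller token, and everyone else is no longer a token holder. Messages of tokens larger than the smallest token known to the node are skipped; when a smaller token is received, the node abandons its current search and joins, from scratch, the search for the smaller token. *Stage 3.* When the search of a root is completed, the root performs an Eulerian walk along its tree in order to count the nodes, and then a second one that propagates this number together with the number of rounds of the walk, so that each node can compute the round in which the walk ends; all nodes terminate in that round. **Lemma.** For all SINR parameters there is a constant $c\ge1$ such that the following holds for every fixed polynomial bound on $N$. There are $(N,c)$-SSFs of length $O(\lg n)$; and for any bound $O(\lg n)$ on the length of the SSF there are, for all $n$ and $N$, selectors for Stage 1 of lengths $O((2/3)^in\lg n)$, such that, with these selectors and with every $(N,c)$-SSF $F$ of that length, on every network with connected communication graph and for every nonempty set $K$ of initial rumour holders, algorithm BTD_Traversals spans a BTD tree of the communication graph rooted at some node of $K$ (at termination every node stores its parent and its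 children in this tree), all nodes terminate at the same round, and the number of rounds is $O(n\lg n)$. The constants depend only on the SINR parameters, the polynomial bound on $N$ and the bound on the length of $F$. (For $n=1$ read $\lg(n+1)$ for $\lg n$.) -/

import Mathlib

open Finset

/-! ### The SINR model in the plane -/

/-- The parameters of the SINR model with uniform power: path loss `α`, threshold `β`,
ambient noise, signal sensitivity `ε`, transmission power. -/
structure SINRParams where
  α : ℝ
  β : ℝ
  noise : ℝ
  ε : ℝ
  power : ℝ
  two_lt_α : 2 < α
  one_le_β : 1 ≤ β
  noise_pos : 0 < noise
  ε_pos : 0 < ε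
  power_pos : 0 < power

/-- A network of `n` stations, at distinct points of the Euclidean plane, with distinct labels
from `{1, …, N}`. -/
structure Network (n N : ℕ) where
  label : Fin n → ℕ
  pos : Fin n → EuclideanSpace ℝ (Fin 2)
  label_injective : Function.Injective label
  label_mem : ∀ v, label v ∈ Icc 1 N
  pos_injective : Function.Injective pos

namespace Network

variable {n N : ℕ} (net : Network n N) (p : SINRParams)

/-- Strength at `u` of the signal sent by `w`. -/
noncomputable def signal (w u : Fin n) : ℝ :=
  p.power * dist (net.pos w) (net.pos u) ^ (-p.α)

/-- `SINR(v, u, T)`. -/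
noncomputable def sinr (T : Finset (Fin n)) (v u : Fin n) : ℝ :=
  net.signal p v u / (p.noise + ∑ w ∈ T.erase v, net.signal p w u)

/-- When exactly the stations in `T` transmit, `u` successfully receives the message of `v`. -/
def Receives (T : Finset (Fin n)) (v u : Fin n) : Prop :=
  v ∈ T ∧ u ∉ T ∧ (1 + p.ε) * p.β * p.noise ≤ net.signal p v u ∧ p.β ≤ net.sinr p T v u

theorem signal_comm (v u : Fin n) : net.signal p v u = net.signal p u v := by
  simp only [signal, dist_comm]

/-- The communication graph: `u` and `v` are adjacent iff `v` receives the message of `u` when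
nobody else transmits. -/
def commGraph : SimpleGraph (Fin n) where
  Adj u v := net.Receives p {u} u v
  symm := ⟨by
    intro u v h
    obtain ⟨-, h2, h3, h4⟩ := h
    refine ⟨by simp, fun h => h2 (by simpa [eq_comm] using h), ?_, ?_⟩
    · rw [signal_comm]; exact h3
    · simp only [sinr, erase_singleton, sum_empty, add_zero] at h4 ⊢
      rw [signal_comm]; exact h4⟩
  loopless := ⟨fun u h => h.2.1 (by simp)⟩

end Network

/-! ### Synchronous distributed protocols -/

/-- What a station knows initially: its own label, the labels of its neighbours (in increasing
order), and whether it holds a rumour. -/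
structure LocalInfo where
  label : ℕ
  nbrs : List ℕ
  source : Bool

/-- A deterministic protocol. In round `t` a station transmits `send t s` (nothing if this is
`none`), `s` being its local state, and then moves to `next t s r`, where `r` is the message it
has heard in this round, if any. The round number is available, as there is a global clock. -/
structure Protocol (Msg State : Type) where
  start : LocalInfo → State
  send : ℕ → State → Option Msg
  next : ℕ → State → Option Msg → State

namespace Network

variable {n N : ℕ} (net : Network n N) (p : SINRParams)

open scoped Classical in
/-- The initial knowledge of station `v`, where `K` is the set of rumour holders. -/
noncomputable def info (K : Finset (Fin n)) (v : Fin n) : LocalInfo where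
  label := net.label v
  nbrs := (({u | (net.commGraph p).Adj v u} : Finset (Fin n)).image net.label).sort (· ≤ ·)
  source := decide (v ∈ K)

open scoped Classical in
/-- The message heard by `u` when each station `v` with `m v ≠ none` transmits `m v`. As
`1 ≤ β` and the noise is positive, at most one message can be received in a round. -/
noncomputable def heard {Msg : Type} (m : Fin n → Option Msg) (u : Fin n) : Option Msg :=
  if h : ∃ v, net.Receives p {w | (m w).isSome} v u then m h.choose else none

/-- The local states of all stations just before round `t` (rounds are `0, 1, 2, …`). -/
noncomputable def run {Msg State : Type} (A : Protocol Msg State) (K : Finset (Fin n)) :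
    ℕ → Fin n → State
  | 0 => fun v => A.start (net.info p K v)
  | t + 1 => fun v =>
      A.next t (run A K t v) (net.heard p (fun w => A.send t (run A K t w)) v)

end Network

/-! ### Selectors and strongly selective families -/

/-- `S` is an `(N, x, y)`-selector. -/
def IsSelector (N x y : ℕ) (S : List (Finset ℕ)) : Prop :=
  (∀ s ∈ S, s ⊆ Icc 1 N) ∧
    ∀ A ⊆ Icc 1 N, #A = x → y ≤ #{a ∈ A | ∃ s ∈ S, s ∩ A = {a}}

/-- `F` is an `(N, x)`-SSF (strongly selective family). -/
def IsSSF (N x : ℕ) (F : List (Finset ℕ)) : Prop :=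
  (∀ s ∈ F, s ⊆ Icc 1 N) ∧
    ∀ Z ⊆ Icc 1 N, Z.Nonempty → #Z ≤ x → ∀ z ∈ Z, ∃ s ∈ F, s ∩ Z = {z}

/-! ### Algorithm BTD_Traversals -/

namespace BTD

/-- The number of selectors used in the first stage: `lg_{3/2} n`, rounded up. -/
noncomputable def numSelectors (n : ℕ) : ℕ := ⌈Real.logb (3 / 2) n⌉₊

/-- The schedule of the first stage: the selectors `S 1, S 2, …` one after another. -/
noncomputable def electionSchedule (n : ℕ) (S : ℕ → List (Finset ℕ)) : List (Finset ℕ) :=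
  (List.range' 1 (numSelectors n)).flatMap S

inductive Kind
  | token
  | check
  | reply

/-- The control message `⟨kind, τ, v, w⟩` of BTD_Construct: it is associated with the token `tok`,
sent by `src` and addressed to `dst`. -/
structure Ctl where
  kind : Kind
  tok : ℕ
  src : ℕ
  dst : ℕ

/-- Messages. Each one consists of a constant number of labels and counters.
* `elect i`: sent by the station `i` in the first stage;
* `ctl c`: a control message of BTD_Construct (part one of Smallest_Token);
* `ack τ`: a destination of the token `τ` announces it (part two of Smallest_Token);
* `count c v w`: the first Eulerian walk goes from `v` to `w`, having met `c` nodes so far;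
* `sync m k v w`: the `k`-th round of the second Eulerian walk, going from `v` to `w`, where
  `m` is the number of nodes. -/
inductive Msg
  | elect (i : ℕ)
  | ctl (c : Ctl)
  | ack (τ : ℕ)
  | count (c v w : ℕ)
  | sync (m k v w : ℕ)

/-- The local state of a station.
* `active`: it still participates in the first stage;
* `tok`: the smallest token known to the station, i.e. the token to whose execution of
  BTD_Construct the following six variables belong;
* `visited`, `marked`, `parent`: status, sub-status and parent;
* `todo`: the list `L` of neighbours believed to be unmarked;
* `pending`: the list `Child` of children to whom the token has not been sent yet;
* `children`: the archive of all children;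
* `out`: the message that the station, being a token holder, sends in the current simulated round;
* `inbox`, `acks`: what has been heard in parts one and two of the current simulated round;
* `wout`: the message of an Eulerian walk to be sent in the coming round;
* `rem`: the children not yet visited by the current Eulerian walk;
* `deadline`: the last round of the algorithm, once it is known;
* `halted`: the station has terminated. -/
structure State where
  label : ℕ
  nbrs : List ℕ
  active : Bool
  tok : Option ℕ
  visited : Bool
  marked : Bool
  parent : Option ℕ
  todo : List ℕ
  pending : List ℕ
  children : List ℕ
  out : Option Ctl
  inbox : List Ctl
  acks : List ℕ
  wout : Option Msg
  rem : List ℕ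
  deadline : Option ℕ
  halted : Bool

/-- The initial state. Only rumour holders are active. -/
def start (i : LocalInfo) : State where
  label := i.label
  nbrs := i.nbrs
  active := i.source
  tok := none
  visited := false
  marked := false
  parent := none
  todo := []
  pending := []
  children := []
  out := none
  inbox := []
  acks := []
  wout := none
  rem := []
  deadline := none
  halted := false

/-! Third stage: the Eulerian walks. -/

/-- The station holds the token of the second walk after `k` rounds of this walk: it passes the
token to the next child, or back to its parent; at the root the walk ends. -/
def continueSync (m k : ℕ) (s : State) : State :=
  match s.rem, s.parent with
  | z :: rest, _ => { s with rem := rest, wout := some (.sync m (k + 1) s.label z) }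
  | [], some q => { s with wout := some (.sync m (k + 1) s.label q) }
  | [], none => s

/-- The root has counted `m` nodes by the end of round `t`; it starts the second walk, which takes
`2 * m - 2` rounds. -/
def startSync (t m : ℕ) (s : State) : State :=
  continueSync m 0 { s with rem := s.children, deadline := some (t + (2 * m - 2)) }

/-- The station holds the token of the first walk, with `c` nodes counted. -/
def continueCount (t c : ℕ) (s : State) : State :=
  match s.rem, s.parent with
  | z :: rest, _ => { s with rem := rest, wout := some (.count c s.label z) }
  | [], some q => { s with wout := some (.count c s.label q) }
  | [], none => startSync t c s

/-- The root starts the first walk after round `t`. -/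
def startCount (t : ℕ) (s : State) : State :=
  continueCount t 1 { s with rem := s.children }

/-- A walk message is received in round `t`. A station meets a walk for the first time when it is
addressed by its parent. -/
def receiveWalk (t : ℕ) (μ : Msg) (s : State) : State :=
  match μ with
  | .count c v w =>
      if w = s.label then
        if s.parent = some v then continueCount t (c + 1) { s with rem := s.children }
        else continueCount t c s
      else s
  | .sync m k v w =>
      if w = s.label then
        if s.parent = some v then
          continueSync m k
            { s with rem := s.children, deadline := some (t + (2 * m - 2 - k)) }
        else continueSync m k s
      else s
  | _ => s

/-! Second stage: BTD_Construct, each round being simulated by Smallest_Token. -/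

/-- The holder of the token `τ` decides what to do next: check the next node on `L`; if there is
none, send the token to the next child; if there is none, return it to the parent; the root
has then completed BTD_Construct, and starts the third stage. -/
def proceed (t τ : ℕ) (s : State) : State :=
  match s.todo, s.pending, s.parent with
  | z :: rest, _, _ => { s with todo := rest, out := some ⟨.check, τ, s.label, z⟩ }
  | [], z :: rest, _ => { s with pending := rest, out := some ⟨.token, τ, s.label, z⟩ }
  | [], [], some q => { s with out := some ⟨.token, τ, s.label, q⟩ }
  | [], [], none => startCount t s

/-- Join the execution of BTD_Construct for the token `τ`, whose root is the node `τ`. -/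
def join (τ : ℕ) (s : State) : State :=
  { s with
    tok := some τ
    visited := false
    marked := false
    parent := none
    todo := s.nbrs.erase τ
    pending := []
    children := [] }

/-- The station issues its own token, and becomes the root of its execution of BTD_Construct. -/
def issue (t : ℕ) (s : State) : State :=
  proceed t s.label { join s.label s with visited := true }

/-- The reaction of BTD_Construct to a message (of the current token), heard in the simulated
round that ends with round `t`. -/
def handle (t : ℕ) (c : Ctl) (s : State) : State :=
  match c.kind with
  | .token =>
      if c.dst = s.label then
        if s.visited then proceed t c.tok s
        else proceed t c.tok { s with visited := true, parent := some c.src }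
      else s
  | .check =>
      if c.dst = s.label then
        { s with marked := true, out := some ⟨.reply, c.tok, s.label, c.src⟩ }
      else if s.visited then s
      else { s with todo := s.todo.erase c.dst }
  | .reply =>
      if c.dst = s.label then
        proceed t c.tok
          { s with children := s.children ++ [c.src], pending := s.pending ++ [c.src] }
      else { s with todo := s.todo.erase c.src }

/-- The smallest token that was addressed to the station in part one of the current execution of
Smallest_Token. -/
def addressed (s : State) : Option ℕ :=
  ((s.inbox.filter fun c => c.dst = s.label).map Ctl.tok).min?

/-- The end (with round `t`) of an execution of Smallest_Token. The station gives up its status of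
a token holder, unless the smallest token that it knows was just delivered to it. All messages
of larger tokens are skipped. If a smaller token than before was received, then the station joins
the execution of BTD_Construct for that token. (There is at most one holder of each token, so that
at most one message of it was sent, possibly several times.) -/
def finish (t : ℕ) (s : State) : State :=
  let s₀ : State := { s with out := none, inbox := [], acks := [] }
  match (s.tok.toList ++ s.inbox.map Ctl.tok ++ s.acks).min? with
  | none => s₀
  | some τ =>
      let s₁ : State := if s.tok = some τ then s₀ else join τ s₀
      match s.inbox.find? fun c => c.tok = τ with
      | none => s₁
      | some c => handle t c s₁

/-- Storing, or reacting to, a message heard in round `t` of the second or third stage. -/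
def receive (t : ℕ) (r : Option Msg) (s : State) : State :=
  match r with
  | some (.ctl c) => { s with inbox := s.inbox ++ [c] }
  | some (.ack τ) => { s with acks := s.acks ++ [τ] }
  | some μ => receiveWalk t μ s
  | none => s

/-- Terminate at the end of the round `deadline`. -/
def terminate (t : ℕ) (s : State) : State :=
  match s.deadline with
  | some d => if d ≤ t then { s with halted := true } else s
  | none => s

/-- Algorithm BTD_Traversals, where `E` is the schedule of the first stage (a concatenation of
selectors) and `F` is the strongly selective family used in Smallest_Token.

The rounds `t < E.length` form the first stage. In the round `t = E.length` nobody transmits, and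
the surviving stations issue their tokens. Then the executions of Smallest_Token follow one another;
each one takes `2 * F.length` rounds, with `F.length` rounds for each of its two parts. The messages
of the third stage are sent in consecutive rounds. -/
def traversals (E F : List (Finset ℕ)) : Protocol Msg State where
  start := start
  send t s :=
    if s.halted then none
    else if t < E.length then
      if s.active ∧ s.label ∈ E.getD t ∅ then some (.elect s.label) else none
    else if t = E.length then none
    else match s.wout with
      | some μ => some μ
      | none =>
          let j := (t - (E.length + 1)) % (2 * F.length)
          if j < F.length then
            if s.label ∈ F.getD j ∅ then s.out.map .ctl else none
          else
            if s.label ∈ F.getD (j - F.length) ∅ then (addressed s).map .ack else none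
  next t s r :=
    if s.halted then s
    else if t < E.length then
      match r with
      | some (.elect i) => if i < s.label then { s with active := false } else s
      | _ => s
    else if t = E.length then
      terminate t (if s.active then issue t s else s)
    else
      let s₁ := receive t r { s with wout := none }
      terminate t
        (if (t - (E.length + 1)) % (2 * F.length) = 2 * F.length - 1 then finish t s₁ else s₁)

end BTD

/-! ### BTD trees -/

/-- A stage of a breadth-then-depth search: the nodes to be visited (the next one first), the nodes
of the current tree, and the parents of the latter. -/
structure BTDSearch (V : Type*) where
  stack : List V
  tree : Set V
  parent : V → Option V

/-- One step of a breadth-then-depth search: the next node `w` is visited, and *all* neighbours of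
`w` outside of the current tree, in some order `l`, become children of `w`. They are visited
(with their descendants) before all other nodes that wait to be visited. -/
inductive BTDStep {V : Type*} [DecidableEq V] (G : SimpleGraph V) :
    BTDSearch V → BTDSearch V → Prop
  | visit (w : V) (rest l : List V) (tree : Set V) (parent : V → Option V)
      (nodup : l.Nodup) (mem_iff : ∀ z, z ∈ l ↔ G.Adj w z ∧ z ∉ tree) :
      BTDStep G ⟨w :: rest, tree, parent⟩
        ⟨l ++ rest, tree ∪ {z | z ∈ l}, fun z => if z ∈ l then some w else parent z⟩

/-- The graph whose edges join the nodes with their parents. -/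
def parentGraph {V : Type*} (parent : V → Option V) : SimpleGraph V :=
  SimpleGraph.fromRel fun u v => parent u = some v

/-- `parent` is a BTD tree of the graph `G`, rooted at `root`: a spanning tree of `G` that results
from a complete breadth-then-depth search started at `root`. -/
structure IsBTDTree {V : Type*} [DecidableEq V] (G : SimpleGraph V) (root : V)
    (parent : V → Option V) : Prop where
  root_parent : parent root = none
  le : parentGraph parent ≤ G
  isTree : (parentGraph parent).IsTree
  search : Relation.ReflTransGen (BTDStep G) ⟨[root], {root}, fun _ => none⟩
    ⟨[], Set.univ, parent⟩

/-! Geometry. Cut the plane into boxes of side half the transmission range. Stations of one box are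
mutually adjacent, and adjacent stations lie in boxes at most two apart in each coordinate. As α >
2, the signal bounds `tail` are summable over the lattice of boxes. Hence there is a finite set
`offsets` of relative box positions such that stations outside of them, at most m per box, cause
interference at most (m/75)·ε·noise. Interference up to ε·noise does no harm, since a neighbour's
signal is at least (1+ε)·β·noise. So if at most 75 stations per box want to transmit, an SSF for
sets of size c = 75·#`offsets` lets all neighbours of each of them hear it
(`exists_receives_of_isSSF`).

Election. What the proof uses of the selectors is a stronger property, `IsBalanced`, and this is
legitimate because only the existence of suitable selectors is claimed. The families consist of the
level sets of k hash functions, with k the rounded-up logarithm of N + 1, and a counting argument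
with exponential moments provides them (`exists_hash`). Each label occurs at most k times, so the
total far interference of a phase is bounded and, by Markov's inequality, few rounds are loud. Few
labels are isolated only in loud rounds. Of two stations of a box whose labels are isolated in quiet
rounds, the larger one hears the smaller one and gives up. Thus a phase multiplies the density bound
by 2/3 until it is 3 (`IsElection.card_box_le`, `IsElection.density_le`).

Search for one token. Without other tokens, the distributed search follows an abstract
breadth-then-depth search (`Holding`): by overhearing replies, an unvisited node keeps as its list
exactly its neighbours outside of the tree built so far, and these are the children that an abstract
step would give it. A potential function bounds the number of rounds by 4n + 1 (`InFlight.next`,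
`InFlight.le`).

Many tokens. Each surviving message is accompanied by an ideal execution of its own token, with
which all stations that know no smaller token agree (`Ghost`). A station that knows a smaller token
is lost to the larger one for ever, so the disagreement there never matters. The smallest token,
that of the rumour holder r with the smallest label, never dies. Any other token cannot complete its
search, because it would have to visit r. Two new holders in one box would hear each other's
announcements and so hold the same token, hence each box contains at most one holder after each
simulated round (`SearchInv.next`); this keeps the density low enough for the SSF. When the search
of r is completed, every node has joined it and no other message exists (`SearchInv.completed`).

Termination. An Eulerian walk of an n-node tree takes 2n - 2 rounds, and two of them follow the
search (`Completed.halted`). The selectors have lengths forming a geometric series with sum O(n lg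
n), and the second stage takes O(n) executions of 2|F| = O(lg n) rounds each. -/

/-! ### Families of hash functions with few collisions -/

section Hash

variable {α β : Type*} [DecidableEq α]

/-- The elements of `A` that share their hash value with another element of `A`. -/
def collisions [DecidableEq β] (h : α → β) (A : Finset α) : Finset α :=
  {a ∈ A | ∃ b ∈ A, b ≠ a ∧ h b = h a}

/-- Every value taken on the colliding set is taken there at least twice, so the image loses at
least half of the colliding elements. The number of repeated values, unlike that of collisions, is
easy to follow when the elements are added one by one. -/
theorem card_collisions_le [DecidableEq β] (h : α → β) (A : Finset α) :
    #(collisions h A) ≤ 2 * (#A - #(A.image h)) := by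
  set C := collisions h A with hC
  have hCA : C ⊆ A := filter_subset _ _
  have h1 : 2 * #(C.image h) ≤ #C := by
    apply mul_card_image_le_card
    intro y hy
    obtain ⟨a, ha, rfl⟩ := mem_image.1 hy
    obtain ⟨haA, b, hb, hba, hab⟩ := by simpa [hC, collisions] using ha
    have hbC : b ∈ C := by
      simp only [hC, collisions, mem_filter]
      exact ⟨hb, a, haA, Ne.symm hba, hab.symm⟩
    refine one_lt_card.2 ⟨a, by simp [ha], b, by simp [hbC, hab], Ne.symm hba⟩
  have h2 : #(A.image h) ≤ #(A \ C) + #(C.image h) := by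
    calc #(A.image h) = #((A \ C).image h ∪ C.image h) := by
          rw [← image_union, sdiff_union_of_subset hCA]
      _ ≤ #((A \ C).image h) + #(C.image h) := card_union_le _ _
      _ ≤ _ := by gcongr; exact card_image_le
  have h3 := card_sdiff_add_card_eq_card hCA
  have h4 : #(A.image h) ≤ #A := card_image_le
  omega

/-- Resampling the value at `a` leaves the uniform distribution unchanged: exchanging `h a` with the
fresh value `y` is an involution of the pairs. -/
theorem sum_update_eq [Fintype α] [Fintype β] (a : α) (f : (α → β) → ℕ) :
    ∑ h : α → β, ∑ y : β, f (Function.update h a y) = Fintype.card β * ∑ h, f h := by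
  let e : (α → β) × β ≃ (α → β) × β :=
    { toFun := fun z => (Function.update z.1 a z.2, z.1 a)
      invFun := fun z => (Function.update z.1 a z.2, z.1 a)
      left_inv := fun z => by simp
      right_inv := fun z => by simp }
  have h1 : ∑ z : (α → β) × β, f (Function.update z.1 a z.2) = ∑ z : (α → β) × β, f z.1 :=
    Fintype.sum_equiv e _ _ fun _ => rfl
  rw [Fintype.sum_prod_type, Fintype.sum_prod_type] at h1
  rw [h1]
  simp [mul_sum]

/-- This is an exponential moment for the number of repeated values. Given the other values, the
value of a new element hits the image with probability at most #A / card β, and only then costs a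
factor q. As #A · q ≤ card β, each element contributes a factor at most 2. -/
theorem sum_pow_repetitions_le [DecidableEq β] [Fintype α] [Fintype β] [Nonempty β] (q : ℕ)
    (A : Finset α)
    (hA : #A * q ≤ Fintype.card β) :
    ∑ h : α → β, q ^ (#A - #(A.image h)) ≤ 2 ^ #A * Fintype.card (α → β) := by
  induction A using Finset.induction_on with
  | empty => simp
  | insert a A ha ih =>
    rw [card_insert_of_notMem ha] at hA ⊢
    have hA' : #A * q ≤ Fintype.card β := le_trans (by gcongr; omega) hA
    have hβ : 0 < Fintype.card β := Fintype.card_pos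
    refine le_of_mul_le_mul_left ?_ hβ
    rw [← sum_update_eq a fun h => q ^ (#A + 1 - #((insert a A).image h))]
    have key : ∀ h : α → β,
        ∑ y : β, q ^ (#A + 1 - #((insert a A).image (Function.update h a y))) ≤
          q ^ (#A - #(A.image h)) * (2 * Fintype.card β) := by
      intro h
      have him : #(A.image h) ≤ #A := card_image_le
      have e1 : ∀ y : β, q ^ (#A + 1 - #((insert a A).image (Function.update h a y))) ≤
          q ^ (#A - #(A.image h)) * (if y ∈ A.image h then q else 0) +
            q ^ (#A - #(A.image h)) := by
        intro y
        have : (insert a A).image (Function.update h a y) = insert y (A.image h) := by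
          rw [image_insert, Function.update_self]
          congr 1
          refine image_congr fun b hb => Function.update_of_ne ?_ _ _
          rintro rfl
          exact ha hb
        rw [this]
        split_ifs with hy
        · rw [insert_eq_of_mem hy, Nat.succ_sub him, pow_succ]
          omega
        · rw [card_insert_of_notMem hy, Nat.add_sub_add_right]
          omega
      calc _ ≤ ∑ y : β, (q ^ (#A - #(A.image h)) * (if y ∈ A.image h then q else 0) +
            q ^ (#A - #(A.image h))) := sum_le_sum fun y _ => e1 y
        _ = q ^ (#A - #(A.image h)) * (#(A.image h) * q + Fintype.card β) := by
            rw [sum_add_distrib, ← mul_sum, sum_ite_mem, univ_inter]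
            simp
            ring
        _ ≤ _ := by
            gcongr
            have : #(A.image h) * q ≤ #A * q := by gcongr
            omega
    calc _ ≤ ∑ h : α → β, q ^ (#A - #(A.image h)) * (2 * Fintype.card β) :=
          sum_le_sum fun h _ => key h
      _ = (∑ h : α → β, q ^ (#A - #(A.image h))) * (2 * Fintype.card β) := by rw [sum_mul]
      _ ≤ (2 ^ #A * Fintype.card (α → β)) * (2 * Fintype.card β) := by gcongr; exact ih hA'
      _ = _ := by ring

theorem card_filter_card_le_le [Fintype α] (x : ℕ) :
    #{A : Finset α | #A ≤ x} ≤ (Fintype.card α + 1) ^ x := by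
  have h : ({A : Finset α | #A ≤ x} : Finset (Finset α)) ⊆
      (range (x + 1)).biUnion fun i => powersetCard i univ := by
    intro A hA
    simp only [mem_biUnion, mem_range, mem_powersetCard]
    simp only [mem_filter, mem_univ, true_and] at hA
    exact ⟨#A, by omega, subset_univ _, rfl⟩
  calc _ ≤ _ := card_le_card h
    _ ≤ ∑ i ∈ range (x + 1), #(powersetCard i (univ : Finset α)) := card_biUnion_le
    _ ≤ ∑ i ∈ range (x + 1), Fintype.card α ^ i * x.choose i := by
        refine sum_le_sum fun i hi => ?_
        rw [card_powersetCard, card_univ]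
        have h1 : 0 < x.choose i := Nat.choose_pos (by simpa [Nat.lt_succ_iff] using hi)
        exact (Nat.choose_le_pow _ _).trans (Nat.le_mul_of_pos_right _ h1)
    _ = _ := by rw [add_pow]; simp

/-- There are `k` hash functions with a total number of collisions that is small on all small
sets. -/
theorem exists_hash [Fintype α] (G x k : ℕ) (hx : 0 < x) (hk : 0 < k)
    (hN : Fintype.card α + 1 ≤ 2 ^ k) :
    ∃ h : Fin k → α → Fin (2 ^ (6 * G) * x), ∀ A : Finset α, #A ≤ x →
      G * ∑ i, #(collisions (h i) A) ≤ k * x := by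
  by_contra! hcon
  -- The moment bound is applied with q = 2^(6G). It needs x · q ≤ Q, which explains the number of
  -- hash values.
  set Q := 2 ^ (6 * G) * x with hQ
  have hQpos : 0 < Q := by positivity
  have : Nonempty (Fin Q) := ⟨⟨0, hQpos⟩⟩
  set R : (Fin k → α → Fin Q) → Finset α → ℕ := fun h A => ∏ i,
    (2 ^ (6 * G)) ^ (#A - #(A.image (h i))) with hR
  -- A violating set has more than kx/G collisions, hence more than kx/(2G) repetitions, so its
  -- weight exceeds 2^(3kx). The mean weight of a fixed set is at most 2^(kx), and there are at most
  -- (N + 1)^x ≤ 2^(kx) sets, where N is the cardinality of the domain. The union bound thus leaves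
  -- only 2^(2kx).
  have hbad : ∀ h : Fin k → α → Fin Q, 2 ^ (3 * (k * x)) ≤
      ∑ A : Finset α with #A ≤ x, R h A := by
    intro h
    obtain ⟨A, hA, hbad⟩ := hcon h
    refine le_trans ?_ (single_le_sum (f := fun A => R h A) (fun _ _ => Nat.zero_le _)
      (by simpa using hA : A ∈ ({A : Finset α | #A ≤ x} : Finset _)))
    simp only [hR]
    rw [prod_pow_eq_pow_sum, ← pow_mul]
    refine Nat.pow_le_pow_right (by norm_num) ?_
    have : ∑ i, #(collisions (h i) A) ≤ 2 * ∑ i, (#A - #(A.image (h i))) := by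
      rw [mul_sum]; exact sum_le_sum fun i _ => card_collisions_le _ _
    nlinarith [Nat.mul_le_mul_left G this]
  have hsum : ∀ A : Finset α, #A ≤ x →
      ∑ h, R h A ≤ 2 ^ (k * x) * Fintype.card (Fin k → α → Fin Q) := by
    intro A hA
    have h1 := sum_pow_repetitions_le (β := Fin Q) (2 ^ (6 * G)) A (by
      rw [Fintype.card_fin, hQ, mul_comm]; gcongr)
    calc ∑ h, R h A = (∑ h : α → Fin Q, (2 ^ (6 * G)) ^ (#A - #(A.image h))) ^ k := by
          rw [Fintype.sum_pow]
      _ ≤ (2 ^ #A * Fintype.card (α → Fin Q)) ^ k := by gcongr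
      _ = 2 ^ (k * #A) * Fintype.card (Fin k → α → Fin Q) := by
          rw [mul_pow, ← pow_mul, mul_comm k, Fintype.card_fun (α := Fin k), Fintype.card_fin]
      _ ≤ _ := by gcongr; norm_num
  have hcard : 0 < Fintype.card (Fin k → α → Fin Q) := Fintype.card_pos
  have : 2 ^ (3 * (k * x)) * Fintype.card (Fin k → α → Fin Q) ≤
      2 ^ (2 * (k * x)) * Fintype.card (Fin k → α → Fin Q) := by
    calc _ = ∑ _h : Fin k → α → Fin Q, 2 ^ (3 * (k * x)) := by simp [mul_comm]
      _ ≤ ∑ h : Fin k → α → Fin Q, ∑ A : Finset α with #A ≤ x, R h A :=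
          sum_le_sum fun h _ => hbad h
      _ = ∑ A : Finset α with #A ≤ x, ∑ h : Fin k → α → Fin Q, R h A := sum_comm
      _ ≤ ∑ A : Finset α with #A ≤ x, 2 ^ (k * x) * Fintype.card (Fin k → α → Fin Q) :=
          sum_le_sum fun A hA => hsum A (by simpa using hA)
      _ = #{A : Finset α | #A ≤ x} * (2 ^ (k * x) * Fintype.card (Fin k → α → Fin Q)) := by
          rw [sum_const, smul_eq_mul]
      _ ≤ (2 ^ (k * x)) * (2 ^ (k * x) * Fintype.card (Fin k → α → Fin Q)) := by
          gcongr
          calc _ ≤ _ := card_filter_card_le_le x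
            _ ≤ (2 ^ k) ^ x := by gcongr
            _ = _ := by rw [pow_mul]
      _ = _ := by ring
  have h2 := Nat.le_of_mul_le_mul_right this hcard
  have h3 := (Nat.pow_le_pow_iff_right (by norm_num : 1 < 2)).1 h2
  have : 0 < k * x := by positivity
  omega

end Hash

/-! ### Selectors from hash functions -/

/-- A schedule in which each label occurs at most `k` times, and such that, for each set `A` of at
most `x` labels, only few elements of `A` are not isolated outside of a given set `R` of rounds. -/
structure IsBalanced (N x G k : ℕ) (L : List (Finset ℕ)) : Prop where
  subset : ∀ s ∈ L, s ⊆ Icc 1 N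
  count : ∀ a, #{t ∈ range L.length | a ∈ L.getD t ∅} ≤ k
  isolates : ∀ A ⊆ Icc 1 N, #A ≤ x → ∀ R : Finset ℕ,
    G * (k * #{a ∈ A | ∀ t < L.length, L.getD t ∅ ∩ A = {a} → t ∈ R}) ≤ k * x + G * #R

section Schedule

variable {N k Q : ℕ} (h : Fin k → Icc 1 N → Fin Q)

/-- The labels with hash value `z.2` under the hash function number `z.1`. -/
def hashLevel (z : Fin k × Fin Q) : Finset ℕ :=
  ({a : Icc 1 N | h z.1 a = z.2} : Finset (Icc 1 N)).map (Function.Embedding.subtype _)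

/-- The level sets of all hash functions. -/
def hashSchedule : List (Finset ℕ) :=
  List.ofFn fun t : Fin (k * Q) => hashLevel h (finProdFinEquiv.symm t)

theorem mem_hashLevel {z : Fin k × Fin Q} {a : ℕ} :
    a ∈ hashLevel h z ↔ ∃ ha : a ∈ Icc 1 N, h z.1 ⟨a, ha⟩ = z.2 := by
  simp [hashLevel]

theorem length_hashSchedule : (hashSchedule h).length = k * Q := by simp [hashSchedule]

theorem hashSchedule_getD (z : Fin k × Fin Q) :
    (hashSchedule h).getD (finProdFinEquiv z) ∅ = hashLevel h z := by
  rw [List.getD_eq_getElem _ _ (by rw [length_hashSchedule]; exact (finProdFinEquiv z).2)]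
  simp only [hashSchedule, List.getElem_ofFn, Fin.eta, Equiv.symm_apply_apply]

theorem exists_pair_of_lt {t : ℕ} (ht : t < (hashSchedule h).length) :
    ∃ z : Fin k × Fin Q, t = finProdFinEquiv z :=
  ⟨finProdFinEquiv.symm ⟨t, by rwa [length_hashSchedule] at ht⟩, by
    rw [Equiv.apply_symm_apply]⟩

theorem hashLevel_inter {A : Finset ℕ} {a : Icc 1 N} (ha : (a : ℕ) ∈ A)
    {i : Fin k} (hc : a ∉ collisions (h i) (A.subtype (· ∈ Icc 1 N))) :
    hashLevel h (i, h i a) ∩ A = {(a : ℕ)} := by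
  ext b
  simp only [mem_inter, mem_hashLevel, mem_singleton]
  constructor
  · rintro ⟨⟨hb, hab⟩, hbA⟩
    by_contra hne
    refine hc ?_
    simp only [collisions, mem_filter, mem_subtype]
    exact ⟨ha, ⟨b, hb⟩, hbA, fun he => hne (congrArg Subtype.val he), hab⟩
  · rintro rfl
    exact ⟨⟨a.2, rfl⟩, ha⟩

theorem isBalanced_hashSchedule {G x : ℕ} (hh : ∀ A : Finset (Icc 1 N), #A ≤ x →
      G * ∑ i, #(collisions (h i) A) ≤ k * x) :
    IsBalanced N x G k (hashSchedule h) where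
  subset s hs := by
    obtain ⟨t, rfl⟩ := (List.mem_ofFn' _ _).1 hs
    intro a ha
    exact ((mem_hashLevel h).1 ha).1
  count a := by
    calc _ ≤ #(univ : Finset (Fin k)) := ?_
      _ = k := by simp
    refine card_le_card_of_surjOn
      (fun i => if ha : a ∈ Icc 1 N then ((finProdFinEquiv (i, h i ⟨a, ha⟩) : Fin _) : ℕ) else 0) ?_
    intro t ht
    simp only [coe_filter, mem_range, Set.mem_ofPred_eq] at ht
    obtain ⟨z, rfl⟩ := exists_pair_of_lt h ht.1
    rw [hashSchedule_getD, mem_hashLevel] at ht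
    obtain ⟨-, ha, hz⟩ := ht
    exact ⟨z.1, by simp, by simp only [dif_pos ha, hz]⟩
  isolates A hA hAx R := by
    set Fl := {a ∈ A | ∀ t < (hashSchedule h).length,
      (hashSchedule h).getD t ∅ ∩ A = {a} → t ∈ R} with hFl
    set A' : Finset (Icc 1 N) := A.subtype (· ∈ Icc 1 N) with hA'
    set Fl' : Finset (Icc 1 N) := Fl.subtype (· ∈ Icc 1 N) with hFl'
    have hcA : #A' = #A := by
      rw [hA', card_subtype, filter_true_of_mem hA]
    have hcF : #Fl' = #Fl := by
      rw [hFl', card_subtype, filter_true_of_mem fun a ha => hA (filter_subset _ _ ha)]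
    have h1 := hh A' (by omega)
    -- Each pair of a hash function and an element of `Fl` is charged. Either the element collides,
    -- which happens at most kx/G times in all, or its level set isolates it. In the second case the
    -- round belongs to R, and distinct pairs use distinct rounds.
    set D : Finset (Fin k × Icc 1 N) := univ ×ˢ Fl' with hD
    have hDc : #D = k * #Fl := by simp [hD, card_product, hcF]
    have h2 : #{z ∈ D | z.2 ∈ collisions (h z.1) A'} ≤ ∑ i, #(collisions (h i) A') := by
      rw [← card_sigma]
      refine card_le_card_of_injOn (fun z => ⟨z.1, z.2⟩) ?_ ?_
      · intro z hz
        simp only [coe_filter, Set.mem_ofPred_eq] at hz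
        simpa using hz.2
      · rintro ⟨i, a⟩ - ⟨j, b⟩ - hab
        simpa using hab
    have h3 : #{z ∈ D | z.2 ∉ collisions (h z.1) A'} ≤ #R := by
      refine card_le_card_of_injOn (fun z => ((finProdFinEquiv (z.1, h z.1 z.2) : Fin _) : ℕ)) ?_ ?_
      · rintro ⟨i, a⟩ hz
        simp only [coe_filter, Set.mem_ofPred_eq, hD, mem_product, mem_univ, true_and, hFl',
          mem_subtype] at hz
        obtain ⟨haF, hc⟩ := hz
        obtain ⟨haA, haR⟩ := mem_filter.1 haF
        refine haR _ ?_ ?_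
        · rw [length_hashSchedule]; exact Fin.is_lt _
        · rw [hashSchedule_getD]
          exact hashLevel_inter h haA hc
      · rintro ⟨i, a⟩ hz ⟨j, b⟩ hz' hab
        simp only [coe_filter, Set.mem_ofPred_eq, hD, mem_product, mem_univ, true_and, hFl',
          mem_subtype] at hz hz'
        have hab := finProdFinEquiv.injective (Fin.val_injective hab)
        obtain ⟨rfl, hab⟩ := Prod.mk.inj hab
        have hbA : (b : ℕ) ∈ A := (mem_filter.1 hz'.1).1
        have hmem : (b : ℕ) ∈ hashLevel h (i, h i a) ∩ A :=
          mem_inter.2 ⟨(mem_hashLevel h).2 ⟨b.2, hab.symm⟩, hbA⟩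
        rw [hashLevel_inter h (mem_filter.1 hz.1).1 hz.2, mem_singleton] at hmem
        rw [Subtype.ext hmem]
    have h4 := card_filter_add_card_filter_not (s := D) (fun z => z.2 ∈ collisions (h z.1) A')
    rw [← hDc]
    calc G * #D ≤ G * (∑ i, #(collisions (h i) A') + #R) := by gcongr; omega
      _ ≤ _ := by rw [mul_add]; omega

end Schedule

/-! ### Balanced schedules exist, and they yield selectors and strongly selective families -/

theorem exists_isBalanced {N G x k : ℕ} (hx : 0 < x) (hk : 0 < k) (hN : N + 1 ≤ 2 ^ k) :
    ∃ L : List (Finset ℕ), L.length = k * (2 ^ (6 * G) * x) ∧ IsBalanced N x G k L := by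
  obtain ⟨h, hh⟩ := exists_hash (α := Icc 1 N) G x k hx hk (by simpa using hN)
  exact ⟨hashSchedule h, length_hashSchedule h, isBalanced_hashSchedule h hh⟩

/-- With R empty, the number of elements that are never isolated is at most c/(c + 1), hence zero.
-/
theorem IsBalanced.isSSF {N c k : ℕ} {L : List (Finset ℕ)} (hk : 0 < k)
    (hL : IsBalanced N c (c + 1) k L) : IsSSF N c L := by
  refine ⟨hL.subset, fun Z hZ _ hZc z hz => ?_⟩
  have h := hL.isolates Z hZ hZc ∅
  by_contra! hcon
  have : z ∈ {a ∈ Z | ∀ t < L.length, L.getD t ∅ ∩ Z = {a} → t ∈ (∅ : Finset ℕ)} := by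
    refine mem_filter.2 ⟨hz, fun t ht he => absurd he ?_⟩
    rw [List.getD_eq_getElem _ _ ht]
    exact hcon _ (List.getElem_mem _)
  have h1 := card_pos.2 ⟨z, this⟩
  simp only [card_empty, mul_zero, add_zero] at h
  have : k * (c + 1) ≤ k * c := by
    calc k * (c + 1) = (c + 1) * (k * 1) := by ring
      _ ≤ _ := by gcongr; exact h1
      _ ≤ _ := h
  nlinarith

/-- With R empty, at most x/G elements are never isolated; `hy` says that m - x/G > y - 1. -/
theorem IsBalanced.isSelector {N x G k m y : ℕ} {L : List (Finset ℕ)} (hk : 0 < k)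
    (hL : IsBalanced N x G k L) (hmx : m ≤ x) (hy : x + G * y < G * (m + 1)) :
    IsSelector N m y L := by
  refine ⟨hL.subset, fun A hA hAm => ?_⟩
  have h := hL.isolates A hA (by omega) ∅
  have h1 : {a ∈ A | ∀ t < L.length, L.getD t ∅ ∩ A = {a} → t ∈ (∅ : Finset ℕ)} =
      {a ∈ A | ¬ ∃ s ∈ L, s ∩ A = {a}} := by
    refine filter_congr fun a _ => ?_
    simp only [notMem_empty, imp_false, not_exists, not_and]
    constructor
    · intro h s hs
      obtain ⟨t, ht, rfl⟩ := List.getElem_of_mem hs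
      have := h t ht
      rwa [List.getD_eq_getElem _ _ ht] at this
    · intro h t ht
      rw [List.getD_eq_getElem _ _ ht]
      exact h _ (List.getElem_mem _)
  rw [h1] at h
  have h2 := card_filter_add_card_filter_not (s := A) (fun a => ∃ s ∈ L, s ∩ A = {a})
  simp only [card_empty, mul_zero, add_zero] at h
  have h3 : G * #{a ∈ A | ¬ ∃ s ∈ L, s ∩ A = {a}} ≤ x := by
    refine le_of_mul_le_mul_left ?_ hk
    calc _ = _ := by ring
      _ ≤ _ := h
  by_contra! hlt
  have h4 : G * (#{a ∈ A | ∃ s ∈ L, s ∩ A = {a}} + 1) ≤ G * y := Nat.mul_le_mul_left _ hlt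
  have h5 : G * #A = G * #{a ∈ A | ∃ s ∈ L, s ∩ A = {a}} +
      G * #{a ∈ A | ¬ ∃ s ∈ L, s ∩ A = {a}} := by rw [← mul_add, h2]
  rw [hAm] at h5
  rw [mul_add] at h4 hy
  omega

/-! ### Geometry of the SINR model -/

namespace SINRParams

variable (p : SINRParams)

theorem β_pos : 0 < p.β := lt_of_lt_of_le one_pos p.one_le_β

theorem α_pos : 0 < p.α := lt_trans two_pos p.two_lt_α

/-- The transmission range. -/
noncomputable def radius : ℝ := ((1 + p.ε) * p.β * p.noise / p.power) ^ (-p.α)⁻¹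

theorem threshold_pos : 0 < (1 + p.ε) * p.β * p.noise := by
  have := p.ε_pos; have := p.β_pos; have := p.noise_pos
  positivity

theorem radius_pos : 0 < p.radius :=
  Real.rpow_pos_of_pos (div_pos p.threshold_pos p.power_pos) _

theorem radius_rpow : p.radius ^ (-p.α) = (1 + p.ε) * p.β * p.noise / p.power := by
  rw [radius, ← Real.rpow_mul (div_pos p.threshold_pos p.power_pos).le,
    inv_mul_cancel₀ (neg_ne_zero.2 p.α_pos.ne'), Real.rpow_one]

/-- An upper bound for the signal of a station over `z` boxes. -/
noncomputable def tail (z : Fin 2 → ℤ) : ℝ :=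
  p.power * (p.radius / 4) ^ (-p.α) * ‖z‖ ^ (-p.α)

theorem tail_nonneg (z : Fin 2 → ℤ) : 0 ≤ p.tail z := by
  have := p.power_pos; have := p.radius_pos
  unfold tail; positivity

theorem summable_tail : Summable p.tail :=
  (EisensteinSeries.summable_one_div_norm_rpow p.two_lt_α).mul_left _

/-- The tails of a convergent series are small. The factor 75 is the largest density that will
occur: 25 boxes around an announcing station, with at most 3 holders in each. The square of radius 2
is added because it contains all offsets between neighbours. -/
theorem exists_offsets : ∃ s : Finset (Fin 2 → ℤ), (∀ z : Fin 2 → ℤ, (∀ i, |z i| ≤ 2) → z ∈ s) ∧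
    ∀ t : Finset (Fin 2 → ℤ), Disjoint t s → 75 * ∑ z ∈ t, p.tail z ≤ p.ε * p.noise := by
  have hpos : 0 < p.ε * p.noise / 75 := by
    have := p.ε_pos; have := p.noise_pos; positivity
  obtain ⟨s, hs⟩ := summable_iff_vanishing_norm.1 p.summable_tail _ hpos
  refine ⟨s ∪ Icc (fun _ => -2) (fun _ => 2), fun z hz => ?_, fun t ht => ?_⟩
  · refine mem_union_right _ (mem_Icc.2 ⟨fun i => ?_, fun i => ?_⟩)
    · exact (abs_le.1 (hz i)).1
    · exact (abs_le.1 (hz i)).2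
  · have := hs t (ht.mono_right subset_union_left)
    rw [Real.norm_of_nonneg (sum_nonneg fun z _ => p.tail_nonneg z)] at this
    linarith

/-- A finite set of box offsets outside of which the interference is small. -/
noncomputable def offsets : Finset (Fin 2 → ℤ) := p.exists_offsets.choose

theorem mem_offsets {z : Fin 2 → ℤ} (hz : ∀ i, |z i| ≤ 2) : z ∈ p.offsets :=
  p.exists_offsets.choose_spec.1 z hz

theorem sum_tail_le {t : Finset (Fin 2 → ℤ)} (ht : Disjoint t p.offsets) :
    75 * ∑ z ∈ t, p.tail z ≤ p.ε * p.noise :=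
  p.exists_offsets.choose_spec.2 t ht

theorem card_offsets_pos : 0 < #p.offsets := card_pos.2 ⟨0, p.mem_offsets (by simp)⟩

end SINRParams

namespace Network

variable {n N : ℕ} (net : Network n N) (p : SINRParams)

theorem dist_pos {u v : Fin n} (h : u ≠ v) : 0 < dist (net.pos u) (net.pos v) :=
  _root_.dist_pos.2 fun he => h (net.pos_injective he)

theorem signal_nonneg (u v : Fin n) : 0 ≤ net.signal p u v := by
  have := p.power_pos
  unfold signal; positivity

theorem threshold_le_signal_iff {u v : Fin n} (h : u ≠ v) :
    (1 + p.ε) * p.β * p.noise ≤ net.signal p u v ↔ dist (net.pos u) (net.pos v) ≤ p.radius := by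
  rw [signal, mul_comm p.power, ← div_le_iff₀ p.power_pos, ← p.radius_rpow,
    Real.rpow_le_rpow_iff_of_neg p.radius_pos (net.dist_pos h) (neg_lt_zero.2 p.α_pos)]

variable {net p} in
theorem Receives.adj {T : Finset (Fin n)} {v u : Fin n} (h : net.Receives p T v u) :
    (net.commGraph p).Adj v u := by
  obtain ⟨hv, hu, h1, -⟩ := h
  refine ⟨mem_singleton_self v, ?_, h1, ?_⟩
  · simp only [mem_singleton]
    rintro rfl
    exact hu hv
  · simp only [sinr, erase_singleton, sum_empty, add_zero]
    rw [le_div_iff₀ p.noise_pos]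
    nlinarith [mul_pos (mul_pos p.ε_pos p.β_pos) p.noise_pos]

variable {net p} in
-- As β ≥ 1 and the noise is positive, a received signal strictly exceeds each interfering one,
-- which cannot hold both ways.
theorem Receives.unique {T : Finset (Fin n)} {v v' u : Fin n} (h : net.Receives p T v u)
    (h' : net.Receives p T v' u) : v = v' := by
  by_contra hne
  have key : ∀ v v' : Fin n, v ≠ v' → net.Receives p T v u → v' ∈ T →
      net.signal p v' u < net.signal p v u := by
    rintro v v' hne ⟨-, -, -, h⟩ hv'
    have h1 : net.signal p v' u ≤ ∑ w ∈ T.erase v, net.signal p w u :=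
      single_le_sum (f := fun w => net.signal p w u) (fun w _ => net.signal_nonneg p w u)
        (mem_erase.2 ⟨hne.symm, hv'⟩)
    have h0 := net.signal_nonneg p v' u
    rw [sinr, le_div_iff₀ (by linarith [p.noise_pos])] at h
    nlinarith [p.noise_pos, p.one_le_β]
  exact lt_asymm (key v v' hne h h'.1) (key v' v (Ne.symm hne) h' h.1)

theorem adj_iff {u v : Fin n} : (net.commGraph p).Adj u v ↔
    u ≠ v ∧ dist (net.pos u) (net.pos v) ≤ p.radius := by
  constructor
  · intro h
    exact ⟨h.ne, (net.threshold_le_signal_iff p h.ne).1 h.2.2.1⟩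
  · rintro ⟨hne, h⟩
    have h1 := (net.threshold_le_signal_iff p hne).2 h
    refine ⟨mem_singleton_self u, by simpa using hne.symm, h1, ?_⟩
    simp only [sinr, erase_singleton, sum_empty, add_zero]
    rw [le_div_iff₀ p.noise_pos]
    nlinarith [mul_pos (mul_pos p.ε_pos p.β_pos) p.noise_pos]

/-- The box of the grid with side half the transmission range that contains the station. -/
noncomputable def box (u : Fin n) : Fin 2 → ℤ := fun i => ⌊net.pos u i / (p.radius / 2)⌋

theorem abs_coord_le (u v : Fin n) (i : Fin 2) :
    |net.pos u i - net.pos v i| ≤ dist (net.pos u) (net.pos v) := by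
  rw [dist_eq_norm, ← Real.norm_eq_abs]
  exact PiLp.norm_apply_le (net.pos u - net.pos v) i

/-- The diagonal of a box is the transmission range divided by √2. -/
theorem adj_of_box_eq {u v : Fin n} (hne : u ≠ v) (h : net.box p u = net.box p v) :
    (net.commGraph p).Adj u v := by
  refine (net.adj_iff p).2 ⟨hne, ?_⟩
  have hr := p.radius_pos
  have h1 : ∀ i, |net.pos u i - net.pos v i| ≤ p.radius / 2 := by
    intro i
    have h2 : ⌊net.pos u i / (p.radius / 2)⌋ = ⌊net.pos v i / (p.radius / 2)⌋ := congrFun h i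
    have h3 := Int.abs_sub_lt_one_of_floor_eq_floor h2
    rw [← sub_div, abs_div, abs_of_pos (by positivity : 0 < p.radius / 2),
      div_lt_one (by positivity)] at h3
    exact h3.le
  rw [EuclideanSpace.dist_eq, Fin.sum_univ_two, Real.sqrt_le_left hr.le]
  simp only [Real.dist_eq, sq_abs]
  have h4 := sq_le_sq' (by linarith [abs_le.1 (h1 0)]) (abs_le.1 (h1 0)).2
  have h5 := sq_le_sq' (by linarith [abs_le.1 (h1 1)]) (abs_le.1 (h1 1)).2
  nlinarith

theorem abs_box_sub_le {u v : Fin n} (h : (net.commGraph p).Adj u v) (i : Fin 2) :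
    |(net.box p u - net.box p v) i| ≤ 2 := by
  have hr := p.radius_pos
  have h1 := (net.abs_coord_le u v i).trans ((net.adj_iff p).1 h).2
  have h2 : |net.pos u i / (p.radius / 2) - net.pos v i / (p.radius / 2)| ≤ 2 := by
    rw [← sub_div, abs_div, abs_of_pos (by positivity : 0 < p.radius / 2),
      div_le_iff₀ (by positivity)]
    linarith
  simp only [box, Pi.sub_apply]
  obtain ⟨h3, h4⟩ := abs_le.1 h2
  have a1 := Int.floor_le (net.pos u i / (p.radius / 2))
  have a2 := Int.lt_floor_add_one (net.pos u i / (p.radius / 2))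
  have b1 := Int.floor_le (net.pos v i / (p.radius / 2))
  have b2 := Int.lt_floor_add_one (net.pos v i / (p.radius / 2))
  rw [abs_le]
  constructor
  · have : (-3 : ℝ) < ((⌊net.pos u i / (p.radius / 2)⌋ - ⌊net.pos v i / (p.radius / 2)⌋ : ℤ) : ℝ) := by
      push_cast; linarith
    have : -3 < ⌊net.pos u i / (p.radius / 2)⌋ - ⌊net.pos v i / (p.radius / 2)⌋ := by
      exact_mod_cast this
    omega
  · have : ((⌊net.pos u i / (p.radius / 2)⌋ - ⌊net.pos v i / (p.radius / 2)⌋ : ℤ) : ℝ) < 3 := by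
      push_cast; linarith
    have : ⌊net.pos u i / (p.radius / 2)⌋ - ⌊net.pos v i / (p.radius / 2)⌋ < 3 := by
      exact_mod_cast this
    omega

theorem box_sub_mem_offsets {u v : Fin n} (h : (net.commGraph p).Adj u v) :
    net.box p u - net.box p v ∈ p.offsets :=
  p.mem_offsets fun i => net.abs_box_sub_le p h i

/-- The offset z has sup norm at least 3, and the distance is at least (‖z‖ - 1) · radius/2, which
is at least ‖z‖ · radius/4. -/
theorem signal_le_tail {w u : Fin n} (h : net.box p w - net.box p u ∉ p.offsets) :
    net.signal p w u ≤ p.tail (net.box p w - net.box p u) := by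
  have hr := p.radius_pos
  set z := net.box p w - net.box p u with hz
  have hex : ∃ i, 2 < |z i| := by
    by_contra! hcon
    exact h (p.mem_offsets hcon)
  obtain ⟨i, hi⟩ : ∃ i, ‖z‖ = ‖z i‖ := by
    obtain ⟨i, hi⟩ := Finite.exists_max fun i => ‖z i‖
    exact ⟨i, le_antisymm ((pi_norm_le_iff_of_nonneg (norm_nonneg _)).2 hi) (norm_le_pi_norm z i)⟩
  have h3 : (3 : ℝ) ≤ ‖z‖ := by
    obtain ⟨j, hj⟩ := hex
    refine le_trans ?_ (norm_le_pi_norm z j)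
    rw [Int.norm_eq_abs]
    exact_mod_cast hj
  have hd : ‖z‖ * (p.radius / 4) ≤ dist (net.pos w) (net.pos u) := by
    refine le_trans ?_ (net.abs_coord_le w u i)
    have h4 : ‖z‖ - 1 ≤ |net.pos w i / (p.radius / 2) - net.pos u i / (p.radius / 2)| := by
      rw [hi, Int.norm_eq_abs, hz]
      simp only [box, Pi.sub_apply, Int.cast_sub]
      have a1 := Int.floor_le (net.pos u i / (p.radius / 2))
      have a2 := Int.lt_floor_add_one (net.pos u i / (p.radius / 2))
      have b1 := Int.floor_le (net.pos w i / (p.radius / 2))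
      have b2 := Int.lt_floor_add_one (net.pos w i / (p.radius / 2))
      rw [sub_le_iff_le_add, abs_le]
      constructor
      · linarith [neg_abs_le (net.pos w i / (p.radius / 2) - net.pos u i / (p.radius / 2))]
      · linarith [le_abs_self (net.pos w i / (p.radius / 2) - net.pos u i / (p.radius / 2))]
    rw [← sub_div, abs_div, abs_of_pos (by positivity : 0 < p.radius / 2),
      le_div_iff₀ (by positivity)] at h4
    nlinarith
  unfold signal SINRParams.tail
  rw [mul_assoc]
  refine mul_le_mul_of_nonneg_left ?_ p.power_pos.le
  rw [← Real.mul_rpow (by positivity) (by positivity), mul_comm (p.radius / 4)]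
  exact Real.rpow_le_rpow_of_nonpos (by positivity) hd (neg_nonpos.2 p.α_pos.le)

/-- The interference from boxes that are not near the box `z`. -/
noncomputable def farTail (T : Finset (Fin n)) (z : Fin 2 → ℤ) : ℝ :=
  ∑ w ∈ T with net.box p w - z ∉ p.offsets, p.tail (net.box p w - z)

theorem farTail_le {T : Finset (Fin n)} {m : ℝ}
    (hT : ∀ z, (#{w ∈ T | net.box p w = z} : ℝ) ≤ m) (z : Fin 2 → ℤ) :
    75 * net.farTail p T z ≤ m * (p.ε * p.noise) := by
  have hm : 0 ≤ m := le_trans (Nat.cast_nonneg _) (hT 0)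
  unfold farTail
  rw [sum_comp p.tail fun w => net.box p w - z]
  set T' := {w ∈ T | net.box p w - z ∉ p.offsets} with hT'
  have hdisj : Disjoint (T'.image fun w => net.box p w - z) p.offsets := by
    rw [disjoint_left]
    intro y hy
    obtain ⟨w, hw, rfl⟩ := mem_image.1 hy
    exact (mem_filter.1 hw).2
  calc _ ≤ 75 * ∑ y ∈ T'.image fun w => net.box p w - z, m * p.tail y := by
        gcongr with y hy
        rw [nsmul_eq_mul]
        refine mul_le_mul_of_nonneg_right ?_ (p.tail_nonneg y)
        refine le_trans ?_ (hT (y + z))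
        gcongr
        intro w hw
        simp only [mem_filter, hT'] at hw ⊢
        exact ⟨hw.1.1, by rw [← hw.2]; abel⟩
    _ = m * (75 * ∑ y ∈ T'.image fun w => net.box p w - z, p.tail y) := by
        rw [← mul_sum]; ring
    _ ≤ _ := mul_le_mul_of_nonneg_left (p.sum_tail_le hdisj) hm

/-- The sensitivity condition gives a neighbour's signal the slack β·ε·noise over the bare
threshold, and this absorbs interference up to ε·noise. -/
theorem receives_of_farTail_le {T : Finset (Fin n)} {v u : Fin n}
    (hadj : (net.commGraph p).Adj v u) (hv : v ∈ T) (hu : u ∉ T)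
    (hnear : ∀ w ∈ T, net.box p w - net.box p u ∈ p.offsets → w = v)
    (hfar : net.farTail p T (net.box p u) ≤ p.ε * p.noise) : net.Receives p T v u := by
  refine ⟨hv, hu, hadj.2.2.1, ?_⟩
  have h1 : ∑ w ∈ T.erase v, net.signal p w u ≤ p.ε * p.noise := by
    refine le_trans ?_ hfar
    have hsub : T.erase v ⊆ {w ∈ T | net.box p w - net.box p u ∉ p.offsets} := by
      intro w hw
      obtain ⟨hne, hwT⟩ := mem_erase.1 hw
      exact mem_filter.2 ⟨hwT, fun h => hne (hnear w hwT h)⟩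
    calc _ ≤ ∑ w ∈ T with net.box p w - net.box p u ∉ p.offsets, net.signal p w u :=
          sum_le_sum_of_subset_of_nonneg hsub fun w _ _ => net.signal_nonneg p w u
      _ ≤ _ := sum_le_sum fun w hw => net.signal_le_tail p (mem_filter.1 hw).2
  have h0 : 0 ≤ ∑ w ∈ T.erase v, net.signal p w u := sum_nonneg fun w _ => net.signal_nonneg p w u
  rw [sinr, le_div_iff₀ (by linarith [p.noise_pos])]
  nlinarith [hadj.2.2.1, p.β_pos]

/-- If the stations of `T` have bounded density and transmit following a strongly selective family,
then each of them is heard by all of its neighbours. -/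
theorem exists_receives_of_isSSF {T : Finset (Fin n)} {F : List (Finset ℕ)}
    (hT : ∀ z, #{w ∈ T | net.box p w = z} ≤ 75) (hF : IsSSF N (75 * #p.offsets) F)
    {v u : Fin n} (hv : v ∈ T) (hadj : (net.commGraph p).Adj v u) :
    ∃ j < F.length, net.Receives p {w ∈ T | net.label w ∈ F.getD j ∅} v u := by
  set Z := {w ∈ T | net.box p w - net.box p u ∈ p.offsets} with hZ
  have hvZ : v ∈ Z := mem_filter.2 ⟨hv, net.box_sub_mem_offsets p hadj⟩
  have hcard : #Z ≤ 75 * #p.offsets := by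
    refine card_le_mul_card_image_of_maps_to (f := fun w => net.box p w - net.box p u)
      (fun w hw => (mem_filter.1 hw).2) 75 fun z _ => ?_
    refine le_trans (card_le_card ?_) (hT (z + net.box p u))
    intro w hw
    simp only [mem_filter] at hw ⊢
    exact ⟨hw.1.1, by rw [← hw.2]; abel⟩
  obtain ⟨s, hs, hsZ⟩ := hF.2 (Z.image net.label)
    (fun a ha => by obtain ⟨w, -, rfl⟩ := mem_image.1 ha; exact net.label_mem w)
    ⟨_, mem_image_of_mem _ hvZ⟩ (card_image_le.trans hcard) (net.label v) (mem_image_of_mem _ hvZ)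
  obtain ⟨j, hj, rfl⟩ := List.getElem_of_mem hs
  refine ⟨j, hj, ?_⟩
  rw [List.getD_eq_getElem _ _ hj]
  have hiso : ∀ w ∈ Z, net.label w ∈ F[j] → w = v := by
    intro w hw hwF
    have : net.label w ∈ F[j] ∩ Z.image net.label := mem_inter.2 ⟨hwF, mem_image_of_mem _ hw⟩
    rw [hsZ, mem_singleton] at this
    exact net.label_injective this
  have hvF : net.label v ∈ F[j] := by
    have : net.label v ∈ F[j] ∩ Z.image net.label := by rw [hsZ]; exact mem_singleton_self _
    exact (mem_inter.1 this).1
  refine net.receives_of_farTail_le p hadj (mem_filter.2 ⟨hv, hvF⟩) ?_ ?_ ?_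
  · intro hu
    obtain ⟨huT, huF⟩ := mem_filter.1 hu
    exact hadj.ne (hiso u (mem_filter.2 ⟨huT, p.mem_offsets (by simp)⟩) huF).symm
  · intro w hw hbox
    obtain ⟨hwT, hwF⟩ := mem_filter.1 hw
    exact hiso w (mem_filter.2 ⟨hwT, hbox⟩) hwF
  · have := net.farTail_le p (T := {w ∈ T | net.label w ∈ F[j]}) (m := 75) (fun z => by
      refine le_trans ?_ (by exact_mod_cast hT z : (#{w ∈ T | net.box p w = z} : ℝ) ≤ 75)
      gcongr
      exact filter_subset _ _) (net.box p u)
    linarith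

/-- A single transmitting station is heard by all of its neighbours. -/
theorem receives_singleton_iff {v w u : Fin n} :
    net.Receives p {v} w u ↔ w = v ∧ (net.commGraph p).Adj v u := by
  constructor
  · intro h
    have : w = v := mem_singleton.1 h.1
    subst this
    exact ⟨rfl, h⟩
  · rintro ⟨rfl, h⟩
    exact h

theorem heard_eq_some_iff {Msg : Type} {m : Fin n → Option Msg} {u : Fin n} {x : Msg} :
    net.heard p m u = some x ↔ ∃ v, net.Receives p {w | (m w).isSome} v u ∧ m v = some x := by
  classical
  unfold heard
  split_ifs with h
  · constructor
    · intro hx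
      exact ⟨_, h.choose_spec, hx⟩
    · rintro ⟨v, hv, hx⟩
      rwa [h.choose_spec.unique hv]
  · simp only [false_iff]
    rintro ⟨v, hv, -⟩
    exact h ⟨v, hv⟩

end Network

/-! ### The first stage -/

/-- The state with a new activity status. -/
def BTD.State.setActive (s : BTD.State) (b : Bool) : BTD.State := { s with active := b }

namespace Network

variable {n N : ℕ} (net : Network n N) (p : SINRParams)

theorem farTail_mono {T T' : Finset (Fin n)} (h : T ⊆ T') (z : Fin 2 → ℤ) :
    net.farTail p T z ≤ net.farTail p T' z :=
  sum_le_sum_of_subset_of_nonneg (filter_subset_filter _ h) fun _ _ _ => p.tail_nonneg _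

/-- The sets `act t` of active stations evolve according to the schedule `E`: a station remains
active unless it hears a smaller label. -/
def IsElection (E : List (Finset ℕ)) (act : ℕ → Finset (Fin n)) : Prop :=
  ∀ t < E.length, ∀ u, u ∈ act (t + 1) ↔ u ∈ act t ∧
    ∀ v, net.Receives p {w ∈ act t | net.label w ∈ E.getD t ∅} v u → ¬ net.label v < net.label u

variable {net p} {E : List (Finset ℕ)} {act : ℕ → Finset (Fin n)}

theorem IsElection.anti (h : net.IsElection p E act) {s t : ℕ} (hst : s ≤ t) (ht : t ≤ E.length) :
    act t ⊆ act s := by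
  induction t, hst using Nat.le_induction with
  | base => exact Subset.rfl
  | succ t _ ih => exact fun u hu => ih (by omega) ((h t (by omega) u).1 hu).1

theorem IsElection.min_mem (h : net.IsElection p E act) {r : Fin n} (hr : r ∈ act 0)
    (hmin : ∀ v ∈ act 0, net.label r ≤ net.label v) {t : ℕ} (ht : t ≤ E.length) : r ∈ act t := by
  induction t with
  | zero => exact hr
  | succ t ih =>
    refine (h t (by omega) r).2 ⟨ih (by omega), fun v hv => not_lt.2 (hmin v ?_)⟩
    exact h.anti (Nat.zero_le t) (by omega) (mem_filter.1 hv.1).1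

/-- Markov's inequality over the rounds of a phase: each station transmits at most k times, so the
far interference summed over all rounds is at most k times that of all active stations together. The
bound is uniform in the box, with no union bound over boxes. -/
theorem IsElection.card_loud_le (o : ℕ) {x G k : ℕ} {L : List (Finset ℕ)}
    (hL : IsBalanced N x G k L) {m : ℝ}
    (hdens : ∀ z, (#{w ∈ act o | net.box p w = z} : ℝ) ≤ m) (z : Fin 2 → ℤ) :
    75 * (#{t ∈ range L.length | p.ε * p.noise <
      net.farTail p {w ∈ act o | net.label w ∈ L.getD t ∅} z} : ℝ) ≤ k * m := by
  have hεn : 0 < p.ε * p.noise := mul_pos p.ε_pos p.noise_pos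
  set R := {t ∈ range L.length | p.ε * p.noise <
      net.farTail p {w ∈ act o | net.label w ∈ L.getD t ∅} z} with hR
  have h1 : (#R : ℝ) * (p.ε * p.noise) ≤
      ∑ t ∈ range L.length, net.farTail p {w ∈ act o | net.label w ∈ L.getD t ∅} z := by
    calc (#R : ℝ) * (p.ε * p.noise) = ∑ _t ∈ R, p.ε * p.noise := by simp
      _ ≤ ∑ t ∈ R, net.farTail p {w ∈ act o | net.label w ∈ L.getD t ∅} z :=
          sum_le_sum fun t ht => (mem_filter.1 ht).2.le
      _ ≤ _ := sum_le_sum_of_subset_of_nonneg (filter_subset _ _)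
          fun t _ _ => sum_nonneg fun w _ => p.tail_nonneg _
  have h2 : ∑ t ∈ range L.length, net.farTail p {w ∈ act o | net.label w ∈ L.getD t ∅} z ≤
      k * net.farTail p (act o) z := by
    simp only [farTail, filter_filter]
    have : ∀ t, ∑ w ∈ act o with net.label w ∈ L.getD t ∅ ∧ net.box p w - z ∉ p.offsets,
        p.tail (net.box p w - z) = ∑ w ∈ act o with net.box p w - z ∉ p.offsets,
          if net.label w ∈ L.getD t ∅ then p.tail (net.box p w - z) else 0 := by
      intro t
      rw [← sum_filter, filter_filter]
      simp only [and_comm]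
    simp only [this]
    rw [sum_comm, mul_sum]
    refine sum_le_sum fun w _ => ?_
    rw [← sum_filter, sum_const, nsmul_eq_mul]
    exact mul_le_mul_of_nonneg_right (by exact_mod_cast hL.count _) (p.tail_nonneg _)
  have h3 := net.farTail_le p hdens z
  have h4 : (75 * (#R : ℝ)) * (p.ε * p.noise) ≤ (k * m) * (p.ε * p.noise) := by
    have := mul_le_mul_of_nonneg_left h3 (Nat.cast_nonneg k : (0 : ℝ) ≤ k)
    linarith
  exact le_of_mul_le_mul_right h4 hεn

/-- A phase of the first stage reduces the density of active stations. -/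
theorem IsElection.card_box_le (h : net.IsElection p E act) {o : ℕ} {x G k : ℕ}
    {L : List (Finset ℕ)} (hk : 0 < k) (hG : G = 10 * #p.offsets) (hL : IsBalanced N x G k L)
    (ho : o + L.length ≤ E.length)
    (hEL : ∀ t < L.length, E.getD (o + t) ∅ = L.getD t ∅)
    {m : ℝ} (hm : 3 ≤ m) (hmx : #p.offsets * m ≤ x) (hxm : x ≤ #p.offsets * m + 1)
    (hdens : ∀ z, (#{w ∈ act o | net.box p w = z} : ℝ) ≤ m) (z : Fin 2 → ℤ) :
    (#{w ∈ act (o + L.length) | net.box p w = z} : ℝ) ≤ 2 / 3 * m := by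
  set R := {t ∈ range L.length | p.ε * p.noise <
      net.farTail p {w ∈ act o | net.label w ∈ L.getD t ∅} z} with hR
  have hRc := IsElection.card_loud_le o hL hdens z
  rw [← hR] at hRc
  set Z := {w ∈ act o | net.box p w - z ∈ p.offsets} with hZ
  -- There are #`offsets` nearby boxes, with at most m active stations in each.
  have hZx : #Z ≤ x := by
    have h1 : (#Z : ℝ) ≤ #p.offsets * m := by
      rw [card_eq_sum_card_fiberwise (s := Z) (f := fun w => net.box p w - z) (t := p.offsets)
        (fun w hw => (mem_filter.1 hw).2)]
      push_cast
      rw [← nsmul_eq_mul]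
      refine sum_le_card_nsmul _ _ _ fun y _ => le_trans ?_ (hdens (y + z))
      gcongr
      intro w hw
      simp only [mem_filter, hZ] at hw ⊢
      exact ⟨hw.1.1, by rw [← hw.2]; abel⟩
    exact_mod_cast h1.trans hmx
  set A := Z.image net.label with hA
  have hiso := hL.isolates A
    (fun a ha => by obtain ⟨w, -, rfl⟩ := mem_image.1 ha; exact net.label_mem w)
    (card_image_le.trans hZx) R
  set Fl := {a ∈ A | ∀ t < L.length, L.getD t ∅ ∩ A = {a} → t ∈ R} with hFl
  set S := {w ∈ act (o + L.length) | net.box p w = z} with hS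
  have hact : act (o + L.length) ⊆ act o := h.anti (by omega) ho
  have hSA : ∀ w ∈ S, net.label w ∈ A := by
    intro w hw
    obtain ⟨hw1, hw2⟩ := mem_filter.1 hw
    refine mem_image_of_mem _ (mem_filter.2 ⟨hact hw1, ?_⟩)
    rw [hw2]
    exact p.mem_offsets (by simp)
  -- The station `a` is isolated in some quiet round and is then heard by its whole box. The set `A`
  -- is fixed at the start of the phase, but active sets only shrink, so the isolation persists
  -- until that round.
  have hgood : ∀ a ∈ S, net.label a ∉ Fl → ∀ b ∈ S, ¬ net.label a < net.label b := by
    intro a ha haF b hb hab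
    have : ∃ t < L.length, L.getD t ∅ ∩ A = {net.label a} ∧ t ∉ R := by
      by_contra! hcon
      exact haF (mem_filter.2 ⟨hSA a ha, hcon⟩)
    obtain ⟨t, ht, htA, htR⟩ := this
    obtain ⟨haact, haz⟩ := mem_filter.1 ha
    obtain ⟨hbact, hbz⟩ := mem_filter.1 hb
    have hat : a ∈ act (o + t) := h.anti (by omega) ho haact
    have hbt : b ∈ act (o + t + 1) := h.anti (by omega) ho hbact
    have hts : act (o + t) ⊆ act o := h.anti (by omega) (by omega)
    refine ((h (o + t) (by omega) b).1 hbt).2 a ?_ hab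
    have hiso : ∀ w ∈ act (o + t), net.box p w - z ∈ p.offsets → net.label w ∈ L.getD t ∅ →
        w = a := by
      intro w hw hwz hwL
      have : net.label w ∈ L.getD t ∅ ∩ A :=
        mem_inter.2 ⟨hwL, mem_image_of_mem _ (mem_filter.2 ⟨hts hw, hwz⟩)⟩
      rw [htA, mem_singleton] at this
      exact net.label_injective this
    have haL : net.label a ∈ L.getD t ∅ := by
      have : net.label a ∈ L.getD t ∅ ∩ A := by rw [htA]; exact mem_singleton_self _
      exact (mem_inter.1 this).1
    have hne : a ≠ b := by rintro rfl; exact lt_irrefl _ hab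
    rw [hEL t ht]
    refine net.receives_of_farTail_le p (net.adj_of_box_eq p hne (haz.trans hbz.symm))
      (mem_filter.2 ⟨hat, haL⟩) ?_ ?_ ?_
    · intro hbT
      obtain ⟨hb1, hb2⟩ := mem_filter.1 hbT
      refine hne (hiso b hb1 ?_ hb2).symm
      rw [hbz]
      exact p.mem_offsets (by simp)
    · intro w hw hwb
      obtain ⟨hw1, hw2⟩ := mem_filter.1 hw
      rw [hbz] at hwb
      exact hiso w hw1 hwb hw2
    · rw [hbz]
      refine (net.farTail_mono p (filter_subset_filter _ hts) z).trans ?_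
      by_contra hcon
      exact htR (mem_filter.2 ⟨mem_range.2 ht, not_le.1 hcon⟩)
  have hSc : #S ≤ #Fl + 1 := by
    rw [← card_image_of_injective S net.label_injective]
    calc #(S.image net.label) ≤ #(Fl ∪ S.image net.label \ Fl) :=
          card_le_card (by rw [union_sdiff_self_eq_union]; exact subset_union_right)
      _ ≤ #Fl + #(S.image net.label \ Fl) := card_union_le _ _
      _ ≤ #Fl + 1 := by
          gcongr
          rw [card_le_one]
          intro a ha b hb
          obtain ⟨ha1, ha2⟩ := mem_sdiff.1 ha
          obtain ⟨hb1, hb2⟩ := mem_sdiff.1 hb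
          obtain ⟨a, haS, rfl⟩ := mem_image.1 ha1
          obtain ⟨b, hbS, rfl⟩ := mem_image.1 hb1
          exact le_antisymm (not_lt.1 (hgood b hbS hb2 a haS)) (not_lt.1 (hgood a haS ha2 b hbS))
  have hs : (1 : ℝ) ≤ #p.offsets := by exact_mod_cast p.card_offsets_pos
  have hk' : (0 : ℝ) < k := by exact_mod_cast hk
  have hiso' : (G : ℝ) * (k * #Fl) ≤ k * x + G * #R := by exact_mod_cast hiso
  have hSc' : (#S : ℝ) ≤ #Fl + 1 := by exact_mod_cast hSc
  have hGr : (G : ℝ) = 10 * #p.offsets := by rw [hG]; push_cast; ring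
  -- With G = 10·#`offsets`, this reads #Fl ≤ (m + 1)/10 + m/75. One more survivor is possible, and
  -- the total is at most 2m/3 because m ≥ 3.
  have h5 : (#p.offsets * k : ℝ) * (750 * #Fl) ≤ (#p.offsets * k : ℝ) * (75 * m + 75 + 10 * m) := by
    rw [hGr] at hiso'
    have e1 : (k : ℝ) * x ≤ k * (#p.offsets * m + 1) := by gcongr
    have e2 : (#p.offsets : ℝ) * (75 * #R) ≤ #p.offsets * (k * m) := by gcongr
    have e3 : (k : ℝ) * 1 ≤ #p.offsets * k := by nlinarith
    nlinarith
  have h6 := le_of_mul_le_mul_left h5 (by positivity)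
  linarith

/-- The density of the active stations after several phases of the first stage. -/
theorem IsElection.density_le (h : net.IsElection p E act) (S : ℕ → List (Finset ℕ)) {k : ℕ}
    (hk : 0 < k) (j : ℕ)
    (hS : ∀ i ∈ Icc 1 j, ∃ x : ℕ, IsBalanced N x (10 * #p.offsets) k (S i) ∧
      #p.offsets * ((2 / 3 : ℝ) ^ (i - 1) * n) ≤ x ∧
      x ≤ #p.offsets * ((2 / 3 : ℝ) ^ (i - 1) * n) + 1)
    (hE : (List.range' 1 j).flatMap S <+: E) (z : Fin 2 → ℤ) :
    (#{w ∈ act ((List.range' 1 j).flatMap S).length | net.box p w = z} : ℝ) ≤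
      max 3 ((2 / 3 : ℝ) ^ j * n) := by
  induction j generalizing z with
  | zero =>
    refine le_max_of_le_right ?_
    simp only [pow_zero, one_mul]
    exact_mod_cast (card_le_univ _).trans (by simp)
  | succ j ih =>
    have hsplit : (List.range' 1 (j + 1)).flatMap S = (List.range' 1 j).flatMap S ++ S (j + 1) := by
      rw [List.range'_concat, List.flatMap_append]
      simp [add_comm]
    have hE' : (List.range' 1 j).flatMap S <+: E :=
      (List.prefix_append _ _).trans (hsplit ▸ hE)
    have ih := ih (fun i hi => hS i (by simp only [mem_Icc] at hi ⊢; omega)) hE'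
    set o := ((List.range' 1 j).flatMap S).length with ho
    rw [hsplit] at hE ⊢
    have hlen : o + (S (j + 1)).length ≤ E.length := by
      simpa [ho] using hE.length_le
    rw [List.length_append, ← ho]
    obtain ⟨x, hbal, hx1, hx2⟩ := hS (j + 1) (by simp)
    rw [Nat.add_sub_cancel] at hx1 hx2
    by_cases hm : 3 ≤ (2 / 3 : ℝ) ^ j * n
    · rw [max_eq_right hm] at ih
      refine le_max_of_le_right ?_
      refine (h.card_box_le hk rfl hbal hlen ?_ hm hx1 hx2 ih z).trans_eq (by ring)
      intro t ht
      obtain ⟨l, rfl⟩ := hE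
      rw [List.append_assoc, List.getD_append_right _ _ _ _ (by omega),
        List.getD_append _ _ _ _ (by omega)]
      congr 1
      omega
    · rw [max_eq_left (not_le.1 hm).le] at ih
      refine le_max_of_le_left (le_trans ?_ (ih z))
      gcongr
      exact h.anti (by omega) hlen

/-! ### The protocol performs an election during its first stage -/

variable (net p E) in
/-- The stations that are active before round `t`. -/
noncomputable def activeSet (F : List (Finset ℕ)) (K : Finset (Fin n)) (t : ℕ) : Finset (Fin n) :=
  {v | (net.run p (BTD.traversals E F) K t v).active = true}

variable {F : List (Finset ℕ)} {K : Finset (Fin n)}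

/-- During the first stage only the activity flag of a station changes, so the whole state is
determined by the active set. -/
theorem run_eq_of_le_length {t : ℕ} (ht : t ≤ E.length) (v : Fin n) :
    net.run p (BTD.traversals E F) K t v =
        (BTD.start (net.info p K v)).setActive (decide (v ∈ net.activeSet p E F K t)) ∧
      (t < E.length → (BTD.traversals E F).send t (net.run p (BTD.traversals E F) K t v) =
        if v ∈ net.activeSet p E F K t ∧ net.label v ∈ E.getD t ∅
          then some (.elect (net.label v)) else none) := by
  have hsend : ∀ {t : ℕ} {v : Fin n}, net.run p (BTD.traversals E F) K t v =
        (BTD.start (net.info p K v)).setActive (decide (v ∈ net.activeSet p E F K t)) →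
      (t < E.length → (BTD.traversals E F).send t (net.run p (BTD.traversals E F) K t v) =
        if v ∈ net.activeSet p E F K t ∧ net.label v ∈ E.getD t ∅
          then some (.elect (net.label v)) else none) := by
    intro t v h ht
    rw [h]
    simp [BTD.traversals, BTD.start, BTD.State.setActive, ht, info]
  refine ⟨?_, hsend ?_⟩ <;>
  · induction t generalizing v with
    | zero =>
      simp [activeSet, run, BTD.traversals, BTD.State.setActive]
    | succ t ih =>
      have ht' : t < E.length := by omega
      have e1 := ih (by omega) v
      have e2 : net.run p (BTD.traversals E F) K (t + 1) v =
          (BTD.traversals E F).next t (net.run p (BTD.traversals E F) K t v)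
            (net.heard p (fun w => (BTD.traversals E F).send t
              (net.run p (BTD.traversals E F) K t w)) v) := rfl
      have e3 : ∃ b, net.run p (BTD.traversals E F) K (t + 1) v =
          (BTD.start (net.info p K v)).setActive b := by
        rw [e2, e1]
        simp only [BTD.traversals, BTD.start, BTD.State.setActive, ht', if_true,
          Bool.false_eq_true, if_false]
        split
        · split
          · exact ⟨false, rfl⟩
          · exact ⟨_, rfl⟩
        · exact ⟨_, rfl⟩
      obtain ⟨b, hb⟩ := e3
      have : decide (v ∈ net.activeSet p E F K (t + 1)) = b := by
        simp [activeSet, hb, BTD.State.setActive]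
      rw [this, hb]

theorem isElection_activeSet : net.IsElection p E (net.activeSet p E F K) := by
  intro t ht u
  have hT : ({w | ((BTD.traversals E F).send t (net.run p (BTD.traversals E F) K t w)).isSome} :
      Finset (Fin n)) = {w ∈ net.activeSet p E F K t | net.label w ∈ E.getD t ∅} := by
    ext w
    rw [mem_filter, mem_filter, ((run_eq_of_le_length ht.le w).2 ht)]
    split_ifs with h <;> simp_all
  have hh := fun x => net.heard_eq_some_iff p (x := x) (u := u)
    (m := fun w => (BTD.traversals E F).send t (net.run p (BTD.traversals E F) K t w))
  rw [hT] at hh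
  have e2 : net.run p (BTD.traversals E F) K (t + 1) u =
      (BTD.traversals E F).next t (net.run p (BTD.traversals E F) K t u)
        (net.heard p (fun w => (BTD.traversals E F).send t
          (net.run p (BTD.traversals E F) K t w)) u) := rfl
  generalize net.heard p (fun w => (BTD.traversals E F).send t
          (net.run p (BTD.traversals E F) K t w)) u = r at hh e2
  have hmsg : ∀ {v}, net.Receives p {w ∈ net.activeSet p E F K t | net.label w ∈ E.getD t ∅} v u →
      r = some (.elect (net.label v)) := by
    intro v hv
    refine (hh _).2 ⟨v, hv, ?_⟩
    rw [(run_eq_of_le_length ht.le v).2 ht, if_pos (mem_filter.1 hv.1)]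
  have hex : ∀ {x}, r = some x → ∃ v, net.Receives p
      {w ∈ net.activeSet p E F K t | net.label w ∈ E.getD t ∅} v u ∧
        x = .elect (net.label v) := by
    intro x hx
    obtain ⟨v, hv, -⟩ := (hh x).1 hx
    exact ⟨v, hv, Option.some.inj (hx.symm.trans (hmsg hv))⟩
  have hmem : ∀ t, u ∈ net.activeSet p E F K t ↔
      (net.run p (BTD.traversals E F) K t u).active = true := by simp [activeSet]
  rw [hmem (t + 1), e2, (run_eq_of_le_length ht.le u).1]
  simp only [BTD.traversals, BTD.start, BTD.State.setActive, ht, if_true, info]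
  cases hr : r with
  | none =>
    simp only [Bool.false_eq_true, if_false, decide_eq_true_eq]
    refine ⟨fun h => ⟨h, fun v hv => ?_⟩, fun h => h.1⟩
    simp [hmsg hv] at hr
  | some x =>
    obtain ⟨v, hv, rfl⟩ := hex hr
    by_cases hlt : net.label v < net.label u
    · simp only [hlt, Bool.false_eq_true, if_false, if_true, false_iff, not_and]
      exact fun _ h => h v hv hlt
    · simp only [hlt, Bool.false_eq_true, if_false, decide_eq_true_eq]
      refine ⟨fun h => ⟨h, fun w hw => ?_⟩, fun h => h.1⟩
      rwa [hw.unique hv]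

theorem activeSet_zero : net.activeSet p E F K 0 = K := by
  ext v
  simp [activeSet, run, BTD.traversals, BTD.start, info]

end Network

/-! ### Breadth-then-depth searches -/

section Search

variable {V : Type*} {G : SimpleGraph V} {root : V}

/-- The initial configuration of a breadth-then-depth search. -/
def BTDSearch.init (root : V) : BTDSearch V := ⟨[root], {root}, fun _ => none⟩

/-- Properties shared by all stages of a breadth-then-depth search. -/
structure BTDSearch.Valid (G : SimpleGraph V) (root : V) (S : BTDSearch V) : Prop where
  nodup : S.stack.Nodup
  stack_sub : ∀ z ∈ S.stack, z ∈ S.tree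
  root_mem : root ∈ S.tree
  root_parent : S.parent root = none
  parent_mem : ∀ z u, S.parent z = some u → z ∈ S.tree ∧ u ∈ S.tree ∧ u ∉ S.stack ∧ G.Adj u z
  closed : ∀ u ∈ S.tree, u ∉ S.stack → ∀ z, G.Adj u z → z ∈ S.tree
  asymm : ∀ z u, S.parent z = some u → S.parent u ≠ some z
  induct : ∀ P : V → Prop, P root → (∀ z u, S.parent z = some u → P u → P z) → ∀ z ∈ S.tree, P z

theorem BTDSearch.valid_init : (BTDSearch.init root).Valid G root where
  nodup := by simp [init]
  stack_sub := by simp [init]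
  root_mem := by simp [init]
  root_parent := rfl
  parent_mem := by simp [init]
  closed := by simp +contextual [init]
  asymm := by simp [init]
  induct := by
    intro P h _ z hz
    rw [show z = root from hz]
    exact h

/-- The new children lie outside of the old tree, so they cannot occur on the old stack nor as
values of the old parent map. Closedness needs a new argument only at `w`, the one node that leaves
the stack. -/
theorem BTDSearch.Valid.step [DecidableEq V] {S S' : BTDSearch V} (h : S.Valid G root)
    (hs : BTDStep G S S') :
    S'.Valid G root := by
  cases hs with
  | visit w rest l T par nodup mem_iff =>
  obtain ⟨h1, h2, h3, h4, h5, h6, h7, h8⟩ := h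
  simp only at *
  have hw : w ∈ T := h2 w (by simp)
  obtain ⟨hwr, hr⟩ := List.nodup_cons.1 h1
  have hlT : ∀ z ∈ l, z ∉ T := fun z hz => ((mem_iff z).1 hz).2
  have hparT : ∀ z ∈ l, ∀ u, par u ≠ some z := fun z hz u hu => hlT z hz (h5 u z hu).2.1
  refine ⟨?_, ?_, Or.inl h3, ?_, ?_, ?_, ?_, ?_⟩
  · refine List.nodup_append'.2 ⟨nodup, hr, fun z hz hz' => hlT z hz (h2 z (by simp [hz']))⟩
  · intro z hz
    rcases List.mem_append.1 hz with hz | hz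
    · exact Or.inr hz
    · exact Or.inl (h2 z (by simp [hz]))
  · simp only
    rw [if_neg fun hl => hlT root hl h3, h4]
  · intro z u hzu
    simp only at hzu
    split_ifs at hzu with hz
    · obtain rfl := Option.some.inj hzu
      exact ⟨Or.inr hz, Or.inl hw, by simp [hwr, show w ∉ l from fun hl => hlT w hl hw],
        ((mem_iff z).1 hz).1⟩
    · obtain ⟨a, b, c, d⟩ := h5 z u hzu
      refine ⟨Or.inl a, Or.inl b, ?_, d⟩
      simp only [List.mem_append, not_or]
      exact ⟨fun hl => hlT u hl b, fun hl => c (by simp [hl])⟩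
  · intro u hu hus z huz
    simp only [List.mem_append, not_or] at hus
    by_cases hz : z ∈ T
    · exact Or.inl hz
    · refine Or.inr ?_
      have huT : u ∈ T := hu.resolve_right hus.1
      by_cases huw : u = w
      · subst huw
        exact (mem_iff z).2 ⟨huz, hz⟩
      · exact absurd (h6 u huT (by simp [huw, hus.2]) z huz) hz
  · intro z u hzu huz
    simp only at hzu huz
    split_ifs at hzu huz with hz hu hu
    · obtain rfl := Option.some.inj hzu
      exact hlT _ hu hw
    · exact hparT z hz u huz
    · exact hparT u hu z hzu
    · exact h7 z u hzu huz
  · intro P hP hstep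
    have hT : ∀ z ∈ T, P z := by
      refine h8 P hP fun z u hzu => hstep z u ?_
      simp only
      rw [if_neg fun hl => hlT z hl (h5 z u hzu).1, hzu]
    rintro z (hz | hz)
    · exact hT z hz
    · exact hstep z w (if_pos hz) (hT w hw)

theorem BTDSearch.valid_of_reflTransGen [DecidableEq V] {S : BTDSearch V}
    (h : Relation.ReflTransGen (BTDStep G) (BTDSearch.init root) S) : S.Valid G root := by
  induction h with
  | refl => exact valid_init
  | tail _ h ih => exact ih.step h

theorem BTDSearch.Valid.tree_eq_univ {S : BTDSearch V} (h : S.Valid G root) (hG : G.Connected)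
    (hS : S.stack = []) : S.tree = Set.univ := by
  refine Set.eq_univ_of_forall fun z => ?_
  obtain ⟨q⟩ := hG.preconnected root z
  have : ∀ u v (_ : G.Walk u v), u ∈ S.tree → v ∈ S.tree := by
    intro u v q
    induction q with
    | nil => exact id
    | cons hadj _ ih => exact fun hu => ih (h.closed _ hu (by simp [hS]) _ hadj)
  exact this _ _ q h.root_mem

theorem isBTDTree_of_reflTransGen [DecidableEq V] [Fintype V] {par : V → Option V}
    (h : Relation.ReflTransGen (BTDStep G) (BTDSearch.init root) ⟨[], Set.univ, par⟩) :
    IsBTDTree G root par := by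
  have hv := BTDSearch.valid_of_reflTransGen h
  have hadj : ∀ z u, par z = some u → (parentGraph par).Adj z u := by
    intro z u hzu
    refine (SimpleGraph.fromRel_adj _ _ _).2 ⟨?_, Or.inl hzu⟩
    exact (hv.parent_mem z u hzu).2.2.2.ne.symm
  have hreach : ∀ z, (parentGraph par).Reachable z root := fun z =>
    hv.induct (fun z => (parentGraph par).Reachable z root) (SimpleGraph.Reachable.refl _)
      (fun z u hzu hu => (hadj z u hzu).reachable.trans hu)
      z (Set.mem_univ z)
  have hconn : (parentGraph par).Connected :=
    { preconnected := fun u v => (hreach u).trans (hreach v).symm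
      nonempty := ⟨root⟩ }
  refine ⟨hv.root_parent, ?_, ?_, h⟩
  · intro u v huv
    rcases ((SimpleGraph.fromRel_adj _ _ _).1 huv).2 with huv | huv
    · exact (hv.parent_mem _ _ huv).2.2.2.symm
    · exact (hv.parent_mem _ _ huv).2.2.2
  · rw [SimpleGraph.isTree_iff_connected_and_card]
    refine ⟨hconn, le_antisymm ?_ hconn.card_vert_le_card_edgeSet_add_one⟩
    -- Each edge joins a non-root node to its parent, so there are at most |V| - 1 edges; a
    -- connected graph with so few edges is a tree.
    have hsub : (parentGraph par).edgeSet ⊆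
        (fun z => s(z, (par z).getD root)) '' ({root}ᶜ : Set V) := by
      intro e
      induction e using Sym2.ind with
      | _ u v =>
      intro huv
      have hne : ∀ z u, par z = some u → z ≠ root := by
        rintro z u hz rfl
        exact absurd (hz.symm.trans hv.root_parent) (by simp)
      rcases ((SimpleGraph.fromRel_adj _ _ _).1 ((SimpleGraph.mem_edgeSet _).1 huv)).2 with huv | huv
      · exact ⟨u, hne _ _ huv, by simp [huv]⟩
      · exact ⟨v, hne _ _ huv, by simp [huv, Sym2.eq_swap]⟩
    have h1 : Nat.card (parentGraph par).edgeSet ≤ Nat.card ({root}ᶜ : Set V) := by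
      rw [Nat.card_coe_set_eq, Nat.card_coe_set_eq]
      exact (Set.ncard_le_ncard hsub (Set.toFinite _)).trans (Set.ncard_image_le (Set.toFinite _))
    have h2 : Nat.card ({root}ᶜ : Set V) + 1 = Nat.card V := by
      rw [Nat.card_coe_set_eq, ← Set.ncard_add_ncard_compl ({root} : Set V), Set.ncard_singleton]
      ring
    omega

end Search

/-! ### BTD_Construct without interference of other tokens -/

namespace BTD

/-- The part of the local state that belongs to the current execution of BTD_Construct. -/
structure Core (V : Type*) where
  visited : Bool
  parent : Option V
  todo : List V
  pending : List V
  children : List V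

namespace Core

variable {V : Type*} {z : V}

/-- The decision of a token holder, and the kind and the destination of the message it sends. -/
def proceed (c : Core V) : Core V × Option (Kind × V) :=
  match c.todo, c.pending, c.parent with
  | z :: rest, _, _ => ({ c with todo := rest }, some (.check, z))
  | [], z :: rest, _ => ({ c with pending := rest }, some (.token, z))
  | [], [], some q => (c, some (.token, q))
  | [], [], none => (c, none)

/-- The reaction of the node `u` to a message from `v` to `z`. -/
def handle [DecidableEq V] (k : Kind) (v z u : V) (c : Core V) : Core V × Option (Kind × V) :=
  match k with
  | .token =>
      if z = u then
        if c.visited then c.proceed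
        else proceed { c with visited := true, parent := some v }
      else (c, none)
  | .check =>
      if z = u then (c, some (.reply, v))
      else if c.visited then (c, none)
      else ({ c with todo := c.todo.erase z }, none)
  | .reply =>
      if z = u then
        proceed { c with children := c.children ++ [v], pending := c.pending ++ [v] }
      else ({ c with todo := c.todo.erase v }, none)

theorem proceed_eq_check {c c' : Core V} (h : c.proceed = (c', some (.check, z))) :
    ∃ rest, c.todo = z :: rest ∧ c' = { c with todo := rest } := by
  unfold proceed at h
  split at h
  all_goals simp only [Prod.mk.injEq, Option.some.injEq, reduceCtorEq, false_and, and_false,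
    true_and] at h
  rename_i heq
  obtain ⟨rfl, rfl⟩ := h
  exact ⟨_, heq, rfl⟩

theorem proceed_eq_token {c c' : Core V} (h : c.proceed = (c', some (.token, z))) :
    c.todo = [] ∧ ((∃ rest, c.pending = z :: rest ∧ c' = { c with pending := rest }) ∨
      (c.pending = [] ∧ c.parent = some z ∧ c' = c)) := by
  unfold proceed at h
  split at h
  all_goals simp only [Prod.mk.injEq, Option.some.injEq, reduceCtorEq, false_and, and_false,
    true_and] at h
  · rename_i h1 h2
    obtain ⟨rfl, rfl⟩ := h
    exact ⟨h1, Or.inl ⟨_, h2, rfl⟩⟩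
  · rename_i h1 h2 h3
    obtain ⟨rfl, rfl⟩ := h
    exact ⟨h1, Or.inr ⟨h2, h3, rfl⟩⟩

theorem proceed_eq_none {c c' : Core V} (h : c.proceed = (c', none)) :
    c.todo = [] ∧ c.pending = [] ∧ c.parent = none ∧ c' = c := by
  unfold proceed at h
  split at h
  all_goals simp only [Prod.mk.injEq, reduceCtorEq, and_false, and_true] at h
  rename_i h1 h2 h3
  exact ⟨h1, h2, h3, h.symm⟩

theorem proceed_ne_reply {c c' : Core V} : c.proceed ≠ (c', some (.reply, z)) := by
  unfold proceed
  split <;> simp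

end Core

section Construct

variable {V : Type*} [DecidableEq V] [Fintype V]

/-- `path` is the list of ancestors of `w`, starting with its parent. -/
def IsAncestorList (par : V → Option V) : V → List V → Prop
  | w, [] => par w = none
  | w, q :: path => par w = some q ∧ IsAncestorList par q path

/-- The node `w`, whose list of ancestors is `path`, has the token after `j` rounds, and is about to
decide what to do next. In the search `S` the node `w` is already visited. -/
structure Holding (G : SimpleGraph V) (root : V) (g : V → Core V) (w : V) (path : List V)
    (S : BTDSearch V) (j : ℕ) : Prop where
  search : Relation.ReflTransGen (BTDStep G) (BTDSearch.init root) S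
  stack : S.stack = (g w).pending ++ (g w).todo ++ path.flatMap fun u => (g u).pending
  visited : ∀ u, (g u).visited = true ↔ u ∈ S.tree ∧ u ∉ S.stack
  parent : ∀ u, (g u).visited = true → (g u).parent = S.parent u
  todo_visited : ∀ u, (g u).visited = true → u ≠ w → (g u).todo = []
  -- The actual tree is the tree of `S` without the unchecked nodes of `w`. When `w` has checked
  -- everything, the list of an unvisited node is thus exactly the set of neighbours that an
  -- abstract step would assign to it.
  unvisited : ∀ u, (g u).visited = false → (g u).children = [] ∧ (g u).pending = [] ∧
    (g u).todo.Nodup ∧ ∀ x, x ∈ (g u).todo ↔ G.Adj u x ∧ (x ∉ S.tree ∨ x ∈ (g w).todo)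
  children : ∀ u, (g u).visited = true → ((g u).children ++ (g u).todo).Nodup ∧
    ∀ z, S.parent z = some u ↔ z ∈ (g u).children ++ (g u).todo
  pending_sub : ∀ u, ∀ z ∈ (g u).pending, z ∈ (g u).children
  ancestors : IsAncestorList S.parent w path
  nodup : (w :: path).Nodup
  path_visited : ∀ u ∈ w :: path, (g u).visited = true
  count : j + path.length + 2 * (g w).todo.length ≤
    2 * S.tree.ncard + 2 * #{u | (g u).visited = true}

/-- The message of kind `k` from `v` to `z`, where `k` is `token` or `check`, was sent after `j`
rounds. -/
def Sent (G : SimpleGraph V) (root : V) (g : V → Core V) (k : Kind) (v z : V) (j : ℕ) : Prop :=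
  ∃ g₀ path S, Holding G root g₀ v path S j ∧ (g₀ v).proceed = (g v, some (k, z)) ∧
    ∀ u, u ≠ v → g u = g₀ u

open scoped Classical in
/-- The effect of the message of kind `k` from `v` to `z`. -/
noncomputable def deliver (G : SimpleGraph V) (k : Kind) (v z : V) (g : V → Core V) (u : V) :
    Core V :=
  if G.Adj v u then (Core.handle k v z u (g u)).1 else g u

/-- The message of kind `k` from `v` to `z` was sent after `j` rounds. -/
def InFlight (G : SimpleGraph V) (root : V) (g : V → Core V) (k : Kind) (v z : V) (j : ℕ) : Prop :=
  match k with
  | .reply => ∃ g₁ j', j = j' + 1 ∧ Sent G root g₁ .check z v j' ∧ g = deliver G .check z v g₁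
  | k => Sent G root g k v z j

/-- The search is completed. -/
def Complete (G : SimpleGraph V) (root : V) (g : V → Core V) : Prop :=
  ∃ par, Relation.ReflTransGen (BTDStep G) (BTDSearch.init root) ⟨[], Set.univ, par⟩ ∧
    ∀ u, (g u).visited = true ∧ (g u).parent = par u ∧ (g u).children.Nodup ∧
      ∀ z, z ∈ (g u).children ↔ par z = some u

variable {G : SimpleGraph V} {root : V} {g : V → Core V} {k : Kind} {v z w : V}
  {path : List V} {S : BTDSearch V} {j : ℕ}

theorem Holding.valid (h : Holding G root g w path S j) : S.Valid G root :=
  BTDSearch.valid_of_reflTransGen h.search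

theorem Holding.le (h : Holding G root g w path S j) : j ≤ 4 * Fintype.card V := by
  have h1 := h.count
  have h2 : S.tree.ncard ≤ Fintype.card V := by
    rw [← Nat.card_eq_fintype_card]; exact Set.ncard_le_card _
  have h3 : #{u | (g u).visited = true} ≤ Fintype.card V := card_le_univ _
  omega

theorem Holding.holder_visited (h : Holding G root g w path S j) : (g w).visited = true :=
  h.path_visited w (by simp)

theorem Sent.adj (h : Sent G root g k v z j) : G.Adj v z := by
  obtain ⟨g₀, path, S, h, hp, -⟩ := h
  have hv := h.holder_visited
  cases k with
  | reply => exact absurd hp Core.proceed_ne_reply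
  | check =>
    obtain ⟨rest, h1, -⟩ := Core.proceed_eq_check hp
    exact (h.valid.parent_mem z v (((h.children v hv).2 z).2 (by simp [h1]))).2.2.2
  | token =>
    obtain ⟨h1, ⟨rest, h2, -⟩ | ⟨-, h2, -⟩⟩ := Core.proceed_eq_token hp
    · exact (h.valid.parent_mem z v (((h.children v hv).2 z).2
        (List.mem_append_left _ (h.pending_sub v z (by simp [h2]))))).2.2.2
    · rw [h.parent v hv] at h2
      exact (h.valid.parent_mem v z h2).2.2.2.symm

theorem InFlight.adj (h : InFlight G root g k v z j) : G.Adj v z := by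
  cases k with
  | reply =>
    obtain ⟨g₁, j', -, h, -⟩ := h
    exact h.adj.symm
  | check => exact Sent.adj h
  | token => exact Sent.adj h

theorem InFlight.le (h : InFlight G root g k v z j) : j ≤ 4 * Fintype.card V + 1 := by
  cases k with
  | reply =>
    obtain ⟨g₁, j', rfl, ⟨g₀, path, S, h, -⟩, -⟩ := h
    have := h.le
    omega
  | check =>
    obtain ⟨g₀, path, S, h, -⟩ := h
    have := h.le
    omega
  | token =>
    obtain ⟨g₀, path, S, h, -⟩ := h
    have := h.le
    omega

/-- The sender has nothing left to check. If the token goes to a child, then that child is on top of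
the stack and its list is exactly its set of neighbours outside of the tree, so one `BTDStep` takes
place. If it goes to the parent, the abstract search stands still. -/
theorem Sent.holding_token (h : Sent G root g .token v z j) :
    ∃ g₁ path S, Holding G root g₁ z path S (j + 1) ∧
      Core.handle .token v z z (g z) = (g₁ z).proceed ∧
        ∀ u, u ≠ z → deliver G .token v z g u = g₁ u := by
  have hdel : ∀ u, u ≠ z → deliver G .token v z g u = g u := by
    intro u hu
    simp [deliver, Core.handle, hu.symm]
  have hvz := h.adj.ne
  obtain ⟨g₀, path, S, h, hp, hg⟩ := h
  have hv := h.holder_visited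
  obtain ⟨h1, ⟨rest, h2, h3⟩ | ⟨h2, h3, h4⟩⟩ := Core.proceed_eq_token hp
  · have hgz := hg z hvz.symm
    have hst := h.stack
    rw [h1, h2] at hst
    obtain ⟨st, T, par⟩ := S
    simp only [List.append_nil, List.cons_append] at hst
    subst hst
    set R := rest ++ path.flatMap fun u => (g₀ u).pending with hR
    have hvalid := h.valid
    have hzT : z ∈ T := hvalid.stack_sub z (by simp)
    obtain ⟨hzR, hRn⟩ := List.nodup_cons.1 hvalid.nodup
    have hznv : (g₀ z).visited = false := by
      rw [← Bool.not_eq_true, h.visited]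
      simp
    obtain ⟨hc1, hc2, hc3, hc4⟩ := h.unvisited z hznv
    simp only [h1, List.not_mem_nil, or_false] at hc4
    set l := (g₀ z).todo with hl
    have hlT : ∀ x ∈ l, x ∉ T := fun x hx => ((hc4 x).1 hx).2
    -- The order in which the abstract search appends the children is the order of the local list of
    -- `z`.
    have hstep := BTDStep.visit (G := G) z R l T par hc3 hc4
    set g₁ := Function.update g z { g z with visited := true, parent := some v } with hg₁
    have e0 : g₁ z = { g₀ z with visited := true, parent := some v } := by simp [hg₁, hgz]
    have ev : g₁ v = { g₀ v with pending := rest } := by simp [hg₁, hvz, h3]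
    have eo : ∀ u, u ≠ z → u ≠ v → g₁ u = g₀ u := by
      intro u hu hu'; simp [hg₁, hu, hg u hu']
    have evis : ∀ u, (g₁ u).visited = true ↔ u = z ∨ (g₀ u).visited = true := by
      intro u
      by_cases hu : u = z
      · subst hu; simp [e0]
      · by_cases hu' : u = v
        · subst hu'; simp [ev, hv]
        · simp [eo u hu hu', hu]
    have eother : ∀ u, u ≠ z → (g₁ u).visited = (g₀ u).visited ∧ (g₁ u).parent = (g₀ u).parent ∧
        (g₁ u).todo = (g₀ u).todo ∧ (g₁ u).children = (g₀ u).children ∧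
        ∀ x ∈ (g₁ u).pending, x ∈ (g₀ u).pending := by
      intro u hu
      by_cases hu' : u = v
      · subst hu'
        rw [ev]
        exact ⟨rfl, rfl, rfl, rfl, fun x hx => by rw [h2]; exact List.mem_cons_of_mem _ hx⟩
      · rw [eo u hu hu']
        exact ⟨rfl, rfl, rfl, rfl, fun _ => id⟩
    refine ⟨g₁, v :: path, _, ⟨h.search.tail hstep, ?_, ?_, ?_, ?_, ?_, ?_, ?_, ?_, ?_, ?_, ?_⟩,
      ?_, fun u hu => ?_⟩
    · rw [e0, List.flatMap_cons, ev]
      simp only [hc2, List.nil_append, ← hl]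
      congr 1
      rw [hR]
      congr 1
      refine List.flatMap_congr fun u hu => ?_
      have huz : u ≠ z := by
        rintro rfl
        rw [h.path_visited u (by simp [hu])] at hznv
        cases hznv
      have huv : u ≠ v := by
        rintro rfl
        exact (List.nodup_cons.1 h.nodup).1 hu
      rw [eo u huz huv]
    · intro u
      rw [evis, h.visited]
      simp only [Set.mem_union, List.mem_append, List.mem_cons, not_or]
      by_cases hu : u = z
      · subst hu
        simp [hzT, hzR, show u ∉ l from fun hl => hlT u hl hzT]
      · have := hlT u
        simp only [hu, false_or, not_false_eq_true, true_and, Set.mem_ofPred_eq]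
        tauto
    · intro u hu
      simp only
      by_cases hu' : u = z
      · subst hu'
        rw [if_neg fun hl => hlT u hl hzT, e0]
        exact (((h.children v hv).2 u).2
          (List.mem_append_left _ (h.pending_sub v u (by simp [h2])))).symm
      · rw [evis, or_iff_right hu'] at hu
        rw [(eother u hu').2.1, h.parent u hu, if_neg fun hl => hlT u hl ((h.visited u).1 hu).1]
    · intro u hu hu'
      rw [evis, or_iff_right hu'] at hu
      rw [(eother u hu').2.2.1]
      by_cases huv : u = v
      · rw [huv, h1]
      · exact h.todo_visited u hu huv
    · intro u hu
      have hu' : u ≠ z := by rintro rfl; simp [e0] at hu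
      obtain ⟨e1, e2, e3, e4, e5⟩ := eother u hu'
      rw [e1] at hu
      have huv : u ≠ v := by rintro rfl; rw [hv] at hu; cases hu
      rw [eo u hu' huv, e0]
      obtain ⟨a, b, c, d⟩ := h.unvisited u hu
      refine ⟨a, b, c, fun x => ?_⟩
      rw [d]
      simp only [h1, ← hl, Set.mem_union, List.not_mem_nil, or_false, not_or, Set.mem_ofPred_eq]
      have := hlT x
      tauto
    · intro u hu
      by_cases hu' : u = z
      · subst hu'
        rw [e0]
        simp only [hc1, ← hl, List.nil_append]
        refine ⟨hc3, fun x => ?_⟩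
        split_ifs with hx
        · simp [hx]
        · simp only [hx, iff_false]
          intro hxu
          exact (hvalid.parent_mem x u hxu).2.2.1 (by simp)
      · obtain ⟨e1, e2, e3, e4, e5⟩ := eother u hu'
        rw [e1] at hu
        rw [e3, e4]
        obtain ⟨a, b⟩ := h.children u hu
        refine ⟨a, fun x => ?_⟩
        rw [← b]
        simp only
        split_ifs with hx
        · simp only [Option.some.injEq, Ne.symm hu', false_iff]
          intro hxu
          exact hlT x hx (hvalid.parent_mem x u hxu).1
        · rfl
    · intro u x hx
      by_cases hu' : u = z
      · subst hu'
        rw [e0] at hx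
        simp [hc2] at hx
      · obtain ⟨e1, e2, e3, e4, e5⟩ := eother u hu'
        rw [e4]
        exact h.pending_sub u x (e5 x hx)
    · have hpar : par z = some v := ((h.children v hv).2 z).2
          (List.mem_append_left _ (h.pending_sub v z (by simp [h2])))
      refine ⟨?_, ?_⟩
      · simp only
        rw [if_neg fun hl => hlT z hl hzT, hpar]
      · have : ∀ (path : List V) (w : V), (∀ u ∈ w :: path, u ∈ T) → IsAncestorList par w path →
            IsAncestorList (fun x => if x ∈ l then some z else par x) w path := by
          intro path
          induction path with
          | nil =>
            intro w hw h
            simp only [IsAncestorList] at h ⊢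
            rw [if_neg fun hl => hlT w hl (hw w (by simp)), h]
          | cons q path ih =>
            intro w hw h
            refine ⟨?_, ih q (fun u hu => hw u (by simp_all)) h.2⟩
            simp only
            rw [if_neg fun hl => hlT w hl (hw w (by simp)), h.1]
        exact this path v (fun u hu => ((h.visited u).1 (h.path_visited u hu)).1) h.ancestors
    · refine List.nodup_cons.2 ⟨fun hz => ?_, h.nodup⟩
      rw [h.path_visited z hz] at hznv
      cases hznv
    · intro u hu
      rw [evis]
      rcases List.mem_cons.1 hu with hu | hu
      · exact Or.inl hu
      · exact Or.inr (h.path_visited u hu)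
    · have hc := h.count
      simp only [h1, List.length_nil] at hc
      have hn : (T ∪ {x | x ∈ l}).ncard = T.ncard + l.length := by
        have hd : Disjoint T {x | x ∈ l} := Set.disjoint_left.2 fun x hx hx' => hlT x hx' hx
        rw [Set.ncard_union_eq hd (Set.toFinite _) (Set.toFinite _), ← List.toFinset_card_of_nodup hc3,
          ← Set.ncard_coe_finset, List.coe_toFinset]
      have hvis : #{u | (g₁ u).visited = true} = #{u | (g₀ u).visited = true} + 1 := by
        rw [← card_insert_of_notMem (a := z) (by simp [hznv])]
        congr 1
        ext u
        simp [evis]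
      rw [e0]
      simp only [← hl, List.length_cons]
      rw [hn, hvis]
      omega
    · rw [e0]
      simp [Core.handle, hgz, hznv]
    · rw [hdel u hu, hg₁, Function.update_of_ne hu]
  · have hgg : g = g₀ := by
      funext u
      by_cases hu : u = v
      · rw [hu, h4]
      · exact hg u hu
    subst hgg
    rw [h.parent v hv] at h3
    cases path with
    | nil =>
      have := h.ancestors
      simp only [IsAncestorList, h3, reduceCtorEq] at this
    | cons q path =>
      obtain ⟨hq, hanc⟩ := h.ancestors
      obtain rfl : z = q := Option.some.inj (h3.symm.trans hq)
      have hz := h.path_visited z (by simp)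
      have hzt := h.todo_visited z hz hvz.symm
      refine ⟨g, path, S, ⟨h.search, ?_, h.visited, h.parent, ?_, ?_, h.children, h.pending_sub, hanc,
        (List.nodup_cons.1 h.nodup).2, fun u hu => h.path_visited u (by simp_all), ?_⟩, ?_, hdel⟩
      · rw [h.stack, h1, h2, hzt]
        simp
      · intro u hu hu'
        by_cases huv : u = v
        · rw [huv, h1]
        · exact h.todo_visited u hu huv
      · intro u hu
        obtain ⟨a, b, c, d⟩ := h.unvisited u hu
        refine ⟨a, b, c, fun x => ?_⟩
        rw [d, h1, hzt]
      · have := h.count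
        rw [hzt]
        simp only [h1, List.length_cons, List.length_nil] at this ⊢
        omega
      · simp [Core.handle, hz]

open scoped Classical in
theorem InFlight.holding_reply (h : InFlight G root g .reply v z j) :
    ∃ g₁ path S, Holding G root g₁ z path S (j + 1) ∧
      Core.handle .reply v z z (g z) = (g₁ z).proceed ∧
        ∀ u, u ≠ z → deliver G .reply v z g u = g₁ u := by
  obtain ⟨gc, j', rfl, hs, rfl⟩ := h
  have hzv := hs.adj
  obtain ⟨g₀, path, S, h, hp, hg⟩ := hs
  obtain ⟨rest, h1, h2⟩ := Core.proceed_eq_check hp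
  have hz := h.holder_visited
  have hvalid := h.valid
  have hvst : v ∈ S.stack := by rw [h.stack]; simp [h1]
  have hvT : v ∈ S.tree := hvalid.stack_sub v hvst
  have hvnv : (g₀ v).visited = false := by
    rw [← Bool.not_eq_true, h.visited]
    simp [hvst]
  have hvrest : v ∉ rest := by
    have := (h.children z hz).1
    rw [h1] at this
    exact (List.nodup_cons.1 (List.nodup_append'.1 this).2.1).1
  set gd := deliver G .check z v gc with hgd
  have hgdz : gd z = { g₀ z with todo := rest } := by
    simp [hgd, deliver, ← h2]
  have hgdo : ∀ u, u ≠ z → (g₀ u).visited = true → gd u = g₀ u := by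
    intro u hu hu'
    simp only [hgd, deliver, Core.handle, hg u hu, hu', if_true]
    split_ifs <;> rfl
  set g₁ := fun u => if u = z then
    { gd z with children := (gd z).children ++ [v], pending := (gd z).pending ++ [v] }
    else deliver G .reply v z gd u with hg₁
  have e0 : g₁ z = { g₀ z with
      todo := rest, children := (g₀ z).children ++ [v], pending := (g₀ z).pending ++ [v] } := by
    simp only [hg₁, if_true, hgdz]
  have evis : ∀ u, u ≠ z → (g₀ u).visited = true → g₁ u = g₀ u := by
    intro u hu hu'
    simp only [hg₁, hu, if_false, deliver, hgdo u hu hu', Core.handle, Ne.symm hu,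
      h.todo_visited u hu' hu, List.erase_nil]
    split_ifs
    · have := h.todo_visited u hu' hu
      cases hgu : g₀ u
      simp_all
    · rfl
  have enot : ∀ u, (g₀ u).visited = false → (g₁ u).visited = false ∧
      (g₁ u).children = (g₀ u).children ∧ (g₁ u).pending = (g₀ u).pending ∧
      (g₁ u).todo.Nodup ∧ ∀ x, x ∈ (g₁ u).todo ↔ x ∈ (g₀ u).todo ∧ x ≠ v := by
    intro u hu
    have huz : u ≠ z := by rintro rfl; rw [hz] at hu; cases hu
    obtain ⟨-, -, hn, hmem⟩ := h.unvisited u hu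
    have hgd : gd u = if G.Adj z u ∧ v ≠ u then { g₀ u with todo := (g₀ u).todo.erase v }
        else g₀ u := by
      simp only [hgd, deliver, Core.handle, hg u huz, hu]
      by_cases h1 : G.Adj z u <;> by_cases h2 : v = u <;> simp [h1, h2]
    have hg₁u : g₁ u = if G.Adj v u then { gd u with todo := (gd u).todo.erase v } else gd u := by
      simp only [hg₁, huz, if_false, deliver, Core.handle, Ne.symm huz]
    -- A node that cannot hear the reply of `v` never listed it, since lists contain neighbours
    -- only.
    have hnv : ¬ G.Adj v u → ∀ x ∈ (g₀ u).todo, x ≠ v := by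
      rintro hadj x hx rfl
      exact hadj ((hmem x).1 hx).1.symm
    rw [hg₁u, hgd]
    split_ifs with c1 c2 c2
    · refine ⟨hu, rfl, rfl, (hn.erase _).erase _, fun x => ?_⟩
      simp only [(hn.erase _).mem_erase_iff, hn.mem_erase_iff]
      tauto
    · refine ⟨hu, rfl, rfl, hn.erase _, fun x => ?_⟩
      simp only [hn.mem_erase_iff]
      tauto
    · refine ⟨hu, rfl, rfl, hn.erase _, fun x => ?_⟩
      simp only [hn.mem_erase_iff]
      tauto
    · exact ⟨hu, rfl, rfl, hn, fun x => ⟨fun hx => ⟨hx, hnv c1 x hx⟩, fun hx => hx.1⟩⟩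
  have evisited : ∀ u, (g₁ u).visited = (g₀ u).visited := by
    intro u
    by_cases hu : u = z
    · rw [hu, e0]
    · cases hv : (g₀ u).visited
      · exact (enot u hv).1
      · rw [evis u hu hv, hv]
  refine ⟨g₁, path, S, ⟨h.search, ?_, ?_, ?_, ?_, ?_, ?_, ?_, h.ancestors, h.nodup, ?_, ?_⟩, ?_, ?_⟩
  · rw [h.stack, e0, h1]
    simp only [List.append_assoc, List.cons_append, List.nil_append]
    congr 3
    refine List.flatMap_congr fun u hu => ?_
    have huz : u ≠ z := by
      rintro rfl
      exact (List.nodup_cons.1 h.nodup).1 hu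
    rw [evis u huz (h.path_visited u (by simp [hu]))]
  · intro u
    rw [evisited, h.visited]
  · intro u hu
    rw [evisited] at hu
    rw [← h.parent u hu]
    by_cases hu' : u = z
    · rw [hu', e0]
    · rw [evis u hu' hu]
  · intro u hu hu'
    rw [evisited] at hu
    rw [evis u hu' hu, h.todo_visited u hu hu']
  · intro u hu
    rw [evisited] at hu
    obtain ⟨-, e1, e2, e3, e4⟩ := enot u hu
    obtain ⟨a, b, -, d⟩ := h.unvisited u hu
    refine ⟨e1.trans a, e2.trans b, e3, fun x => ?_⟩
    rw [e4, d, e0, h1]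
    simp only [List.mem_cons]
    by_cases hxv : x = v
    · subst hxv
      simp [hvT, hvrest]
    · simp [hxv]
  · intro u hu
    rw [evisited] at hu
    by_cases hu' : u = z
    · subst hu'
      have := h.children u hu
      rw [h1] at this
      rw [e0]
      simpa only [List.append_assoc, List.cons_append, List.nil_append] using this
    · rw [evis u hu' hu]
      exact h.children u hu
  · intro u x hx
    by_cases hu' : u = z
    · subst hu'
      rw [e0] at hx ⊢
      simp only [List.mem_append] at hx ⊢
      exact hx.imp_left (h.pending_sub u x)
    · cases hu : (g₀ u).visited
      · obtain ⟨-, e1, e2, -⟩ := enot u hu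
        rw [e2] at hx
        rw [e1]
        exact h.pending_sub u x hx
      · rw [evis u hu' hu] at hx ⊢
        exact h.pending_sub u x hx
  · intro u hu
    rw [evisited]
    exact h.path_visited u hu
  · have := h.count
    simp only [evisited]
    rw [e0]
    simp only [h1, List.length_cons] at this ⊢
    omega
  · simp only [Core.handle, if_true, hg₁]
  · intro u hu
    simp only [hg₁, hu, if_false]

/-- A holder without anything to send has no parent, so it has no ancestors and the abstract stack
is empty. By connectivity the search then covers the whole graph. -/
theorem Holding.result (hG : G.Connected) (h : Holding G root g w path S j) {g' : V → Core V}
    (hg' : ∀ u, u ≠ w → g' u = g u) (hw : g' w = (g w).proceed.1) :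
    (∀ k z, (g w).proceed.2 = some (k, z) → InFlight G root g' k w z j) ∧
      ((g w).proceed.2 = none → Complete G root g') := by
  constructor
  · intro k z hp
    have hs : Sent G root g' k w z j := ⟨g, path, S, h, by rw [hw, ← hp], hg'⟩
    cases k with
    | reply =>
      have : (g w).proceed = ((g w).proceed.1, some (.reply, z)) := Prod.ext rfl hp
      exact absurd this Core.proceed_ne_reply
    | check => exact hs
    | token => exact hs
  · intro hp
    obtain ⟨h1, h2, h3, h4⟩ := Core.proceed_eq_none (Prod.ext rfl hp : (g w).proceed = (_, none))
    have hw' := h.holder_visited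
    have hg : g' = g := by
      funext u
      by_cases hu : u = w
      · rw [hu, hw]
        exact h4
      · exact hg' u hu
    have hpath : path = [] := by
      cases path with
      | nil => rfl
      | cons q path =>
        have := h.ancestors.1
        rw [← h.parent w hw', h3] at this
        cases this
    have hstack : S.stack = [] := by rw [h.stack, h1, h2, hpath]; rfl
    have htree := h.valid.tree_eq_univ hG hstack
    have hvis : ∀ u, (g u).visited = true := fun u => by rw [h.visited, htree, hstack]; simp
    have htodo : ∀ u, (g u).todo = [] := by
      intro u
      by_cases hu : u = w
      · rw [hu, h1]
      · exact h.todo_visited u (hvis u) hu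
    rw [hg]
    obtain ⟨st, T, par⟩ := S
    simp only at hstack htree
    subst hstack htree
    refine ⟨par, h.search, fun u => ⟨hvis u, h.parent u (hvis u), ?_⟩⟩
    have := h.children u (hvis u)
    rw [htodo, List.append_nil] at this
    exact ⟨this.1, fun z => (this.2 z).symm⟩

/-- One round of BTD_Construct. -/
theorem InFlight.next (hG : G.Connected) (h : InFlight G root g k v z j) :
    (∀ k' z', (Core.handle k v z z (g z)).2 = some (k', z') →
      InFlight G root (deliver G k v z g) k' z z' (j + 1)) ∧
    ((Core.handle k v z z (g z)).2 = none → Complete G root (deliver G k v z g)) := by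
  have hadj := h.adj
  have hz : deliver G k v z g z = (Core.handle k v z z (g z)).1 := by simp [deliver, hadj]
  cases k with
  | check =>
    simp only [Core.handle, if_true, Option.some.injEq, Prod.mk.injEq, reduceCtorEq, false_imp_iff,
      and_true]
    rintro k' z' ⟨rfl, rfl⟩
    exact ⟨g, j, rfl, h, rfl⟩
  | token =>
    obtain ⟨g₁, path, S, h₁, h2, h3⟩ := Sent.holding_token h
    rw [h2] at hz ⊢
    exact h₁.result hG h3 hz
  | reply =>
    obtain ⟨g₁, path, S, h₁, h2, h3⟩ := InFlight.holding_reply h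
    rw [h2] at hz ⊢
    exact h₁.result hG h3 hz

/-- The situation after the root has been visited. -/
theorem holding_init (hroot : (g root).visited = true ∧ (g root).parent = none ∧
      (g root).todo.Nodup ∧ (g root).pending = [] ∧ (g root).children = [] ∧
      ∀ x, x ∈ (g root).todo ↔ G.Adj root x)
    (hg : ∀ u, u ≠ root → (g u).visited = false ∧ (g u).children = [] ∧ (g u).pending = [] ∧
      (g u).todo.Nodup ∧ ∀ x, x ∈ (g u).todo ↔ G.Adj u x ∧ x ≠ root) :
    ∃ S, Holding G root g root [] S 0 := by
  obtain ⟨h1, h2, h3, h4, h5, h6⟩ := hroot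
  set l := (g root).todo with hl
  have hrl : root ∉ l := fun h => ((h6 root).1 h).ne rfl
  have hstep := BTDStep.visit (G := G) root [] l {root} (fun _ => none) h3 (fun z => by
    rw [h6, Set.mem_singleton_iff]
    exact ⟨fun h => ⟨h, h.ne.symm⟩, fun h => h.1⟩)
  have hvis : ∀ u, (g u).visited = true ↔ u = root := by
    intro u
    by_cases hu : u = root
    · simp [hu, h1]
    · simp [hu, (hg u hu).1]
  refine ⟨_, ⟨Relation.ReflTransGen.single hstep, ?_, ?_, ?_, ?_, ?_, ?_, ?_, ?_, ?_, ?_, ?_⟩⟩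
  · simp [h4, hl]
  · intro u
    rw [hvis]
    simp only [List.append_nil, Set.singleton_union, Set.mem_insert_iff]
    constructor
    · rintro rfl
      exact ⟨Or.inl rfl, hrl⟩
    · rintro ⟨h | h, h'⟩
      · exact h
      · exact absurd h h'
  · intro u hu
    obtain rfl := (hvis u).1 hu
    simp only [if_neg hrl, h2]
  · intro u hu hu'
    exact absurd ((hvis u).1 hu) hu'
  · intro u hu
    have hu' : u ≠ root := by rintro rfl; rw [h1] at hu; cases hu
    obtain ⟨-, a, b, c, d⟩ := hg u hu'
    refine ⟨a, b, c, fun x => ?_⟩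
    rw [d, ← hl]
    simp only [Set.singleton_union, Set.mem_insert_iff, not_or, Set.mem_ofPred_eq]
    by_cases hx : x = root
    · simp [hx, hrl]
    · by_cases hxl : x ∈ l <;> simp [hx, hxl]
  · intro u hu
    obtain rfl := (hvis u).1 hu
    rw [h5, ← hl]
    refine ⟨h3, fun z => ?_⟩
    simp
  · intro u x hx
    by_cases hu : u = root
    · rw [hu, h4] at hx
      cases hx
    · rw [(hg u hu).2.2.1] at hx
      cases hx
  · simp [IsAncestorList, hrl]
  · simp
  · intro u hu
    rw [hvis]
    simpa using hu
  · simp only [← hl, List.length_nil]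
    have hn : (({root} : Set V) ∪ {x | x ∈ l}).ncard = 1 + l.length := by
      have hd : Disjoint ({root} : Set V) {x | x ∈ l} :=
        Set.disjoint_singleton_left.2 hrl
      rw [Set.ncard_union_eq hd (Set.toFinite _) (Set.toFinite _), Set.ncard_singleton,
        ← List.toFinset_card_of_nodup h3, ← Set.ncard_coe_finset, List.coe_toFinset]
    rw [hn]
    omega

end Construct

end BTD

/-! ### The execution of Smallest_Token -/

namespace BTD

/-- The state with new contents of the two mailboxes. -/
def State.withBoxes (s : State) (I : List Ctl) (A : List ℕ) : State :=
  { s with inbox := I, acks := A }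

/-- The station is in the second stage. -/
structure State.Searching (s : State) : Prop where
  inbox : s.inbox = []
  acks : s.acks = []
  wout : s.wout = none
  deadline : s.deadline = none
  halted : s.halted = false

/-- The control message, if this is one. -/
def Msg.toCtl : Msg → Option Ctl
  | .ctl c => some c
  | _ => none

/-- The announced token, if there is one. -/
def Msg.toAck : Msg → Option ℕ
  | .ack τ => some τ
  | _ => none

theorem addressed_eq_some_iff {s : State} {τ : ℕ} : addressed s = some τ ↔
    (∃ c ∈ s.inbox, c.dst = s.label ∧ c.tok = τ) ∧
      ∀ c ∈ s.inbox, c.dst = s.label → τ ≤ c.tok := by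
  rw [addressed, List.min?_eq_some_iff]
  simp only [List.mem_map, List.mem_filter, decide_eq_true_eq, and_assoc]
  refine and_congr_right fun _ => ⟨fun h c hc hd => h _ ⟨c, hc, hd, rfl⟩, ?_⟩
  rintro h _ ⟨c, hc, hd, rfl⟩
  exact h c hc hd

end BTD

namespace Network

open BTD

variable {n N : ℕ} {net : Network n N} {p : SINRParams} {E F : List (Finset ℕ)}
  {K : Finset (Fin n)}

theorem run_succ (t : ℕ) (v : Fin n) : net.run p (traversals E F) K (t + 1) v =
    (traversals E F).next t (net.run p (traversals E F) K t v)
      (net.heard p (fun w => (traversals E F).send t (net.run p (traversals E F) K t w)) v) := rfl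

theorem sub_mod_eq (i : ℕ) {q : ℕ} (hq : q < 2 * F.length) :
    (E.length + 1 + i * (2 * F.length) + q - (E.length + 1)) % (2 * F.length) = q := by
  rw [Nat.add_assoc, Nat.add_sub_cancel_left, Nat.add_comm, Nat.add_mul_mod_self_right,
    Nat.mod_eq_of_lt hq]

variable (net p) in
/-- What the station `v` hears in the first `q` rounds of the second or the first part of
Smallest_Token, when the messages `m` are sent. -/
noncomputable def collected {M : Type} (F : List (Finset ℕ)) (m : Fin n → Option Msg)
    (f : Msg → Option M) (q : ℕ) (v : Fin n) : List M :=
  (List.range q).filterMap fun j =>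
    (net.heard p (fun w => if net.label w ∈ F.getD j ∅ then m w else none) v).bind f

theorem collected_succ {M : Type} (m : Fin n → Option Msg) (f : Msg → Option M) (q : ℕ)
    (v : Fin n) : net.collected p F m f (q + 1) v = net.collected p F m f q v ++
      ((net.heard p (fun w => if net.label w ∈ F.getD q ∅ then m w else none) v).bind f).toList := by
  simp only [collected, List.range_succ, List.filterMap_append]
  cases h : (net.heard p (fun w => if net.label w ∈ F.getD q ∅ then m w else none) v).bind f <;>
    simp [-List.getD_eq_getElem?_getD, h]

/-- Under the density bound one pass through `F` delivers each message to all neighbours of its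
sender. Only the set of collected messages matters; order and multiplicity do not. -/
theorem mem_collected {M : Type} {m : Fin n → Option Msg} {f : Msg → Option M}
    (hF : IsSSF N (75 * #p.offsets) F)
    (hm : ∀ z, #{w | (m w).isSome ∧ net.box p w = z} ≤ 75) {v : Fin n} {x : M} :
    x ∈ net.collected p F m f F.length v ↔
      ∃ w y, (net.commGraph p).Adj w v ∧ m w = some y ∧ f y = some x := by
  have hset : ∀ j, ({w | (if net.label w ∈ F.getD j ∅ then m w else none).isSome} :
      Finset (Fin n)) =
        ({w | (m w).isSome} : Finset (Fin n)).filter fun w => net.label w ∈ F.getD j ∅ := by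
    intro j
    ext w
    simp only [mem_filter, mem_univ, true_and]
    split_ifs with h <;> simp [-List.getD_eq_getElem?_getD, h]
  simp only [collected, List.mem_filterMap, List.mem_range, Option.bind_eq_some_iff,
    net.heard_eq_some_iff, hset]
  constructor
  · rintro ⟨j, -, y, ⟨w, hw, hy⟩, hx⟩
    refine ⟨w, y, hw.adj, ?_, hx⟩
    rwa [if_pos (mem_filter.1 hw.1).2] at hy
  · rintro ⟨w, y, hadj, hy, hx⟩
    obtain ⟨j, hj, hr⟩ := net.exists_receives_of_isSSF p (T := {w | (m w).isSome})
      (fun z => by rw [filter_filter]; exact hm z) hF (v := w) (u := v) (by simp [hy]) hadj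
    exact ⟨j, hj, y, ⟨w, hr, by rw [if_pos (mem_filter.1 hr.1).2, hy]⟩, hx⟩

section Round

variable (i : ℕ) {X : Fin n → State}

theorem send_searching {s : State} (hs : s.Searching) (I : List Ctl) (A : List ℕ) {q : ℕ}
    (hq : q < 2 * F.length) :
    (traversals E F).send (E.length + 1 + i * (2 * F.length) + q) (s.withBoxes I A) =
      if q < F.length then if s.label ∈ F.getD q ∅ then s.out.map .ctl else none
      else if s.label ∈ F.getD (q - F.length) ∅ then (addressed (s.withBoxes I [])).map .ack
      else none := by
  have h1 : ¬ E.length + 1 + i * (2 * F.length) + q < E.length := by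
    have := Nat.zero_le (i * (2 * F.length)); omega
  have h2 : E.length + 1 + i * (2 * F.length) + q ≠ E.length := by
    have := Nat.zero_le (i * (2 * F.length)); omega
  simp only [traversals, State.withBoxes, hs.halted, hs.wout, h1, h2, if_false, sub_mod_eq i hq,
    Bool.false_eq_true]
  rfl

theorem next_searching {s : State} (hs : s.Searching) (I : List Ctl) (A : List ℕ) {q : ℕ}
    (hq : q < 2 * F.length) (r : Option Msg) :
    (traversals E F).next (E.length + 1 + i * (2 * F.length) + q) (s.withBoxes I A) r =
      terminate (E.length + 1 + i * (2 * F.length) + q)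
        (if q = 2 * F.length - 1 then finish (E.length + 1 + i * (2 * F.length) + q)
          (receive (E.length + 1 + i * (2 * F.length) + q) r (s.withBoxes I A))
        else receive (E.length + 1 + i * (2 * F.length) + q) r (s.withBoxes I A)) := by
  have h1 : ¬ E.length + 1 + i * (2 * F.length) + q < E.length := by
    have := Nat.zero_le (i * (2 * F.length)); omega
  have h2 : E.length + 1 + i * (2 * F.length) + q ≠ E.length := by
    have := Nat.zero_le (i * (2 * F.length)); omega
  have h3 : ({ s.withBoxes I A with wout := none } : State) = s.withBoxes I A := by
    simp only [State.withBoxes, hs.wout]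
  simp only [traversals, h1, h2, if_false, sub_mod_eq i hq, h3]
  simp only [State.withBoxes, hs.halted, Bool.false_eq_true, if_false]

theorem terminate_searching {s : State} (hs : s.Searching) (t : ℕ) (I : List Ctl) (A : List ℕ) :
    terminate t (s.withBoxes I A) = s.withBoxes I A := by
  simp [terminate, State.withBoxes, hs.deadline]

theorem run_part_one (hX : ∀ v, (X v).Searching) (hl : ∀ v, (X v).label = net.label v)
    (hrun : net.run p (traversals E F) K (E.length + 1 + i * (2 * F.length)) = X) {q : ℕ}
    (hq : q ≤ F.length) (v : Fin n) :
    net.run p (traversals E F) K (E.length + 1 + i * (2 * F.length) + q) v =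
      (X v).withBoxes
        (net.collected p F (fun w => (X w).out.map .ctl) Msg.toCtl q v) [] := by
  induction q generalizing v with
  | zero =>
    rw [Nat.add_zero, hrun]
    simp only [collected, List.range_zero, List.filterMap_nil, State.withBoxes]
    rw [← (hX v).inbox, ← (hX v).acks]
  | succ q ih =>
    have hq' : q < 2 * F.length := by omega
    rw [← Nat.add_assoc, run_succ, ih (by omega) v, next_searching i (hX v) _ _ hq',
      if_neg (by omega)]
    have hsend : (fun w => (traversals E F).send (E.length + 1 + i * (2 * F.length) + q)
        (net.run p (traversals E F) K (E.length + 1 + i * (2 * F.length) + q) w)) =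
        fun w => if net.label w ∈ F.getD q ∅ then (X w).out.map .ctl else none := by
      funext w
      rw [ih (by omega) w, send_searching i (hX w) _ _ hq', if_pos (by omega), hl]
    rw [hsend, collected_succ]
    cases hr : net.heard p
      (fun w => if net.label w ∈ F.getD q ∅ then (X w).out.map Msg.ctl else none) v with
    | none =>
      rw [Option.bind_none, Option.toList_none, List.append_nil]
      exact terminate_searching (hX v) _ _ _
    | some x =>
      obtain ⟨w, -, hw⟩ := (net.heard_eq_some_iff p).1 hr
      split_ifs at hw
      obtain ⟨c, -, rfl⟩ := Option.map_eq_some_iff.1 hw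
      exact terminate_searching (hX v) _ _ _

theorem run_part_two (hX : ∀ v, (X v).Searching) (hl : ∀ v, (X v).label = net.label v)
    (hrun : net.run p (traversals E F) K (E.length + 1 + i * (2 * F.length)) = X)
    {I : Fin n → List Ctl}
    (hI : I = net.collected p F (fun w => (X w).out.map .ctl) Msg.toCtl F.length) {q : ℕ}
    (hq : q ≤ F.length) (v : Fin n) :
    (q < F.length → net.run p (traversals E F) K
        (E.length + 1 + i * (2 * F.length) + (F.length + q)) v = (X v).withBoxes (I v)
        (net.collected p F (fun w => (addressed ((X w).withBoxes (I w) [])).map .ack)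
          Msg.toAck q v)) ∧
    (q = F.length → 0 < F.length → net.run p (traversals E F) K
        (E.length + 1 + i * (2 * F.length) + (F.length + q)) v =
        terminate (E.length + 1 + i * (2 * F.length) + (F.length + q) - 1)
          (finish (E.length + 1 + i * (2 * F.length) + (F.length + q) - 1)
            ((X v).withBoxes (I v)
        (net.collected p F (fun w => (addressed ((X w).withBoxes (I w) [])).map .ack)
          Msg.toAck q v)))) := by
  induction q generalizing v with
  | zero =>
    refine ⟨fun _ => ?_, by omega⟩
    rw [Nat.add_zero F.length, run_part_one i hX hl hrun le_rfl, hI]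
    simp [collected]
  | succ q ih =>
    have hq' : F.length + q < 2 * F.length := by omega
    have ih := fun v => (ih (by omega) v).1 (by omega)
    have hsend : (fun w => (traversals E F).send (E.length + 1 + i * (2 * F.length) + (F.length + q))
        (net.run p (traversals E F) K (E.length + 1 + i * (2 * F.length) + (F.length + q)) w)) =
        fun w => if net.label w ∈ F.getD q ∅ then
          (addressed ((X w).withBoxes (I w) [])).map .ack else none := by
      funext w
      rw [ih w, send_searching i (hX w) _ _ hq', if_neg (by omega), hl,
        Nat.add_sub_cancel_left]
    have hrec : receive (E.length + 1 + i * (2 * F.length) + (F.length + q)) (net.heard p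
        (fun w => if net.label w ∈ F.getD q ∅ then
          (addressed ((X w).withBoxes (I w) [])).map .ack else none) v)
        ((X v).withBoxes (I v) (net.collected p F
          (fun w => (addressed ((X w).withBoxes (I w) [])).map .ack) Msg.toAck q v)) =
        (X v).withBoxes (I v) (net.collected p F
          (fun w => (addressed ((X w).withBoxes (I w) [])).map .ack) Msg.toAck (q + 1) v) := by
      rw [collected_succ]
      cases hr : net.heard p (fun w => if net.label w ∈ F.getD q ∅ then
          (addressed ((X w).withBoxes (I w) [])).map Msg.ack else none) v with
      | none =>
        rw [Option.bind_none, Option.toList_none, List.append_nil]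
        rfl
      | some x =>
        obtain ⟨w, -, hw⟩ := (net.heard_eq_some_iff p).1 hr
        split_ifs at hw
        obtain ⟨c, -, rfl⟩ := Option.map_eq_some_iff.1 hw
        rfl
    have hstep := run_succ (net := net) (p := p) (E := E) (F := F) (K := K)
      (E.length + 1 + i * (2 * F.length) + (F.length + q)) v
    rw [ih v, next_searching i (hX v) _ _ hq', hsend, hrec] at hstep
    constructor
    · intro h
      refine hstep.trans ?_
      rw [if_neg (by omega), terminate_searching (hX v)]
    · intro h h0
      refine hstep.trans ?_
      rw [if_pos (by omega)]
      rfl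

/-- The effect of one execution of Smallest_Token: the stations hear the messages of all their
neighbours in the first part, and all of the tokens announced by them in the second part. -/
theorem run_smallestToken (hF : IsSSF N (75 * #p.offsets) F) (hF0 : 0 < F.length)
    (hX : ∀ v, (X v).Searching)
    (hl : ∀ v, (X v).label = net.label v)
    (hrun : net.run p (traversals E F) K (E.length + 1 + i * (2 * F.length)) = X)
    (hdens : ∀ z, #{v | (X v).out.isSome ∧ net.box p v = z} ≤ 3) :
    ∃ (I : Fin n → List Ctl) (A : Fin n → List ℕ),
      (∀ v c, c ∈ I v ↔ ∃ w, (net.commGraph p).Adj w v ∧ (X w).out = some c) ∧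
      (∀ v τ, τ ∈ A v ↔ ∃ w, (net.commGraph p).Adj w v ∧
        addressed ((X w).withBoxes (I w) []) = some τ) ∧
      ∀ v, (net.run p (traversals E F) K (E.length + (i + 1) * (2 * F.length)) v).halted = false ∧
        net.run p (traversals E F) K (E.length + 1 + (i + 1) * (2 * F.length)) v =
        terminate (E.length + (i + 1) * (2 * F.length))
          (finish (E.length + (i + 1) * (2 * F.length)) ((X v).withBoxes (I v) (A v))) := by
  set I := net.collected p F (fun w => (X w).out.map .ctl) Msg.toCtl F.length with hI
  set A := net.collected p F (fun w => (addressed ((X w).withBoxes (I w) [])).map .ack)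
    Msg.toAck F.length with hA
  have hmemI : ∀ v c, c ∈ I v ↔ ∃ w, (net.commGraph p).Adj w v ∧ (X w).out = some c := by
    intro v c
    rw [hI, mem_collected hF]
    · simp only [Option.map_eq_some_iff]
      constructor
      · rintro ⟨w, y, hadj, ⟨c', hc', rfl⟩, hc⟩
        obtain rfl : c' = c := Option.some.inj hc
        exact ⟨w, hadj, hc'⟩
      · rintro ⟨w, hadj, hc⟩
        exact ⟨w, _, hadj, ⟨c, hc, rfl⟩, rfl⟩
    · intro z
      simp only [Option.isSome_map]
      exact (hdens z).trans (by norm_num)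
  have hsrc : ∀ w, (addressed ((X w).withBoxes (I w) [])).isSome → ∃ v c,
      (net.commGraph p).Adj v w ∧ (X v).out = some c ∧ c.dst = net.label w := by
    intro w hw
    obtain ⟨τ, hτ⟩ := Option.isSome_iff_exists.1 hw
    obtain ⟨⟨c, hc, hd, -⟩, -⟩ := addressed_eq_some_iff.1 hτ
    obtain ⟨v, hv, hout⟩ := (hmemI w c).1 hc
    exact ⟨v, c, hv, hout, hd.trans (hl w)⟩
  refine ⟨I, A, hmemI, ?_, fun v => ?_⟩
  · intro v τ
    rw [hA, mem_collected hF]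
    · simp only [Option.map_eq_some_iff]
      constructor
      · rintro ⟨w, y, hadj, ⟨c', hc', rfl⟩, hc⟩
        obtain rfl : c' = τ := Option.some.inj hc
        exact ⟨w, hadj, hc'⟩
      · rintro ⟨w, hadj, hc⟩
        exact ⟨w, _, hadj, ⟨τ, hc, rfl⟩, rfl⟩
    · intro z
      simp only [Option.isSome_map]
      choose! src c hadj hout hdst using hsrc
      set T : Finset (Fin n) :=
        {w | (addressed ((X w).withBoxes (I w) [])).isSome ∧ net.box p w = z} with hT
      -- A message has a single destination, so the announcing stations inject into the senders.
      -- Those who announce from one box have their senders in the 25 surrounding boxes, with at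
      -- most 3 senders in each.
      have hinj : Set.InjOn src T := by
        intro w hw w' hw' he
        simp only [hT, coe_filter, mem_univ, true_and, Set.mem_ofPred_eq] at hw hw'
        have h1 := hout w hw.1
        rw [he, hout w' hw'.1] at h1
        refine net.label_injective ?_
        rw [← hdst w hw.1, ← hdst w' hw'.1, Option.some.inj h1]
      rw [← card_image_of_injOn hinj]
      have hcard : #(Icc (fun _ => -2) (fun _ => 2) : Finset (Fin 2 → ℤ)) = 25 := by
        simp [Pi.card_Icc]
      calc #(T.image src) ≤ 3 * #(Icc (fun _ => -2) (fun _ => 2) : Finset (Fin 2 → ℤ)) := ?_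
        _ = 75 := by rw [hcard]
      refine card_le_mul_card_image_of_maps_to (f := fun v => net.box p v - z) ?_ 3 fun y _ => ?_
      · intro v hv
        obtain ⟨w, hw, rfl⟩ := mem_image.1 hv
        simp only [hT, mem_filter, mem_univ, true_and] at hw
        have := fun i => abs_le.1 (net.abs_box_sub_le p (hadj w hw.1) i)
        rw [hw.2] at this
        exact mem_Icc.2 ⟨fun i => (this i).1, fun i => (this i).2⟩
      · refine le_trans (card_le_card ?_) (hdens (y + z))
        intro v hv
        obtain ⟨hv1, hv2⟩ := mem_filter.1 hv
        obtain ⟨w, hw, rfl⟩ := mem_image.1 hv1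
        simp only [hT, mem_filter, mem_univ, true_and] at hw ⊢
        exact ⟨by rw [hout w hw.1]; rfl, by rw [← hv2]; abel⟩
  · have := (run_part_two i hX hl hrun hI le_rfl v).2 rfl hF0
    rw [show E.length + 1 + i * (2 * F.length) + (F.length + F.length) =
      E.length + 1 + (i + 1) * (2 * F.length) by ring,
      show E.length + 1 + (i + 1) * (2 * F.length) - 1 = E.length + (i + 1) * (2 * F.length) by
        omega] at this
    refine ⟨?_, this⟩
    -- The state before the last round of the execution is that of a searching station. This serves
    -- to show that no station halts before the common final round.
    rw [show E.length + (i + 1) * (2 * F.length) =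
      E.length + 1 + i * (2 * F.length) + (F.length + (F.length - 1)) by
        rw [add_mul]
        omega, (run_part_two i hX hl hrun hI (q := F.length - 1) (by omega) v).1 (by omega)]
    exact (hX v).halted

end Round

end Network

/-! ### Local states and their idealized counterparts -/

namespace BTD

/-- The state of a station that has dropped its message and emptied its mailboxes. -/
def State.silent (s : State) : State := { s with out := none, inbox := [], acks := [] }

/-- The state of a station in the execution of BTD_Construct for the token `τ`, where a station
that has not taken part so far is considered as having just joined. -/
def State.view (τ : ℕ) (s : State) : State := if s.tok = some τ then s else join τ s

/-- The variables that are changed neither by BTD_Construct nor at the start of the walks. -/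
structure State.SameFrame (s s' : State) : Prop where
  label : s'.label = s.label
  nbrs : s'.nbrs = s.nbrs
  tok : s'.tok = s.tok
  inbox : s'.inbox = s.inbox
  acks : s'.acks = s.acks
  wout : s'.wout = s.wout
  deadline : s'.deadline = s.deadline
  halted : s'.halted = s.halted

theorem State.SameFrame.refl (s : State) : s.SameFrame s :=
  ⟨rfl, rfl, rfl, rfl, rfl, rfl, rfl, rfl⟩

theorem State.SameFrame.trans {s s' s'' : State} (h : s.SameFrame s') (h' : s'.SameFrame s'') :
    s.SameFrame s'' :=
  ⟨h'.label.trans h.label, h'.nbrs.trans h.nbrs, h'.tok.trans h.tok, h'.inbox.trans h.inbox,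
    h'.acks.trans h.acks, h'.wout.trans h.wout, h'.deadline.trans h.deadline,
    h'.halted.trans h.halted⟩

section Matches

variable {V : Type*} [DecidableEq V] {lab : V → ℕ}

/-- The local state agrees with the state in the ideal execution. -/
structure Core.Matches (lab : V → ℕ) (c : Core V) (s : State) : Prop where
  visited : s.visited = c.visited
  parent : s.parent = c.parent.map lab
  todo : s.todo = c.todo.map lab
  pending : s.pending = c.pending.map lab
  children : s.children = c.children.map lab

omit [DecidableEq V] in
theorem Core.Matches.proceed {c : Core V} {s : State} (h : c.Matches lab s) (t τ : ℕ) :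
    (∀ k z, c.proceed.2 = some (k, z) → c.proceed.1.Matches lab (BTD.proceed t τ s) ∧
      (BTD.proceed t τ s).out = some ⟨k, τ, s.label, lab z⟩ ∧ s.SameFrame (BTD.proceed t τ s)) ∧
    (c.proceed.2 = none → c.proceed.1.Matches lab s ∧ BTD.proceed t τ s = startCount t s) := by
  obtain ⟨h1, h2, h3, h4, h5⟩ := h
  rcases htodo : c.todo with _ | ⟨x, todo⟩
  · rcases hpend : c.pending with _ | ⟨x, pending⟩
    · rcases hpar : c.parent with _ | q
      · simp only [htodo, hpend, hpar, List.map_nil, Option.map_none] at h2 h3 h4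
        simp only [Core.proceed, htodo, hpend, hpar, BTD.proceed, h2, h3, h4]
        refine ⟨by simp, fun _ => ⟨⟨h1, by simp [hpar, h2], by simp [htodo, h3],
          by simp [hpend, h4], h5⟩, trivial⟩⟩
      · simp only [htodo, hpend, hpar, List.map_nil, Option.map_some] at h2 h3 h4
        simp only [Core.proceed, htodo, hpend, hpar, BTD.proceed, h2, h3, h4]
        refine ⟨?_, by simp⟩
        rintro k z h
        simp only [Option.some.injEq, Prod.mk.injEq] at h
        obtain ⟨rfl, rfl⟩ := h
        exact ⟨⟨h1, by simp [hpar], by simp [htodo], by simp [hpend], h5⟩, rfl,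
          ⟨rfl, rfl, rfl, rfl, rfl, rfl, rfl, rfl⟩⟩
    · simp only [htodo, hpend, List.map_nil, List.map_cons] at h3 h4
      simp only [Core.proceed, htodo, hpend, BTD.proceed, h3, h4]
      refine ⟨?_, by simp⟩
      rintro k z h
      simp only [Option.some.injEq, Prod.mk.injEq] at h
      obtain ⟨rfl, rfl⟩ := h
      exact ⟨⟨h1, h2, by simp, rfl, h5⟩, rfl,
        ⟨rfl, rfl, rfl, rfl, rfl, rfl, rfl, rfl⟩⟩
  · simp only [htodo, List.map_cons] at h3
    simp only [Core.proceed, htodo, BTD.proceed, h3]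
    refine ⟨?_, by simp⟩
    rintro k z h
    simp only [Option.some.injEq, Prod.mk.injEq] at h
    obtain ⟨rfl, rfl⟩ := h
    exact ⟨⟨h1, h2, rfl, h4, h5⟩, rfl, ⟨rfl, rfl, rfl, rfl, rfl, rfl, rfl, rfl⟩⟩

theorem Core.handle_visited {k : Kind} {v z u : V} (hu : z ≠ u) (c : Core V) :
    (Core.handle k v z u c).1.visited = c.visited ∧ (Core.handle k v z u c).2 = none := by
  cases k <;> simp only [Core.handle, hu, if_false]
  · simp
  · split_ifs <;> simp
  · simp

/-- A station overhears a message. -/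
theorem Core.Matches.overhear (hlab : lab.Injective) {c : Core V} {s : State}
    (h : c.Matches lab s) (t : ℕ) {u v z : V} {m : Ctl} (hs : s.label = lab u) (hsrc : m.src = lab v)
    (hdst : m.dst = lab z) (hu : z ≠ u) :
    (Core.handle m.kind v z u c).1.Matches lab (BTD.handle t m s) ∧
      (BTD.handle t m s).out = s.out ∧ s.SameFrame (BTD.handle t m s) := by
  obtain ⟨h1, h2, h3, h4, h5⟩ := h
  have hne : lab z ≠ lab u := fun h => hu (hlab h)
  obtain ⟨k, τ, src, dst⟩ := m
  simp only at hsrc hdst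
  subst hsrc hdst
  cases k
  · simp only [Core.handle, hu, if_false, BTD.handle, hs, hne]
    exact ⟨⟨h1, h2, h3, h4, h5⟩, trivial, State.SameFrame.refl s⟩
  · simp only [Core.handle, hu, if_false, BTD.handle, hs, hne, h1]
    split_ifs
    · exact ⟨⟨h1, h2, h3, h4, h5⟩, rfl, State.SameFrame.refl s⟩
    · exact ⟨⟨by simp, h2, by simp [h3, List.map_erase hlab], h4, h5⟩, rfl,
        ⟨hs.symm, rfl, rfl, rfl, rfl, rfl, rfl, rfl⟩⟩
  · simp only [Core.handle, hu, if_false, BTD.handle, hs, hne]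
    exact ⟨⟨h1, h2, by simp [h3, List.map_erase hlab], h4, h5⟩, trivial,
      ⟨hs.symm, rfl, rfl, rfl, rfl, rfl, rfl, rfl⟩⟩

/-- A station receives a message that is addressed to it. -/
theorem Core.Matches.receive {c : Core V} {s : State}
    (h : c.Matches lab s) (t : ℕ) {u v : V} {m : Ctl} (hs : s.label = lab u) (hsrc : m.src = lab v)
    (hdst : m.dst = lab u) :
    (∀ k z, (Core.handle m.kind v u u c).2 = some (k, z) →
      (Core.handle m.kind v u u c).1.Matches lab (BTD.handle t m s) ∧
      (BTD.handle t m s).out = some ⟨k, m.tok, s.label, lab z⟩ ∧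
      s.SameFrame (BTD.handle t m s)) ∧
    ((Core.handle m.kind v u u c).2 = none → ∃ s', s.SameFrame s' ∧ s'.out = s.out ∧
      (Core.handle m.kind v u u c).1.Matches lab s' ∧ BTD.handle t m s = startCount t s') := by
  obtain ⟨k, τ, src, dst⟩ := m
  simp only at hsrc hdst
  subst hsrc hdst
  have key : ∀ (c' : Core V) (s' : State), c'.Matches lab s' → s.SameFrame s' → s'.out = s.out →
      (∀ k z, c'.proceed.2 = some (k, z) → c'.proceed.1.Matches lab (BTD.proceed t τ s') ∧
        (BTD.proceed t τ s').out = some ⟨k, τ, s.label, lab z⟩ ∧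
          s.SameFrame (BTD.proceed t τ s')) ∧
      (c'.proceed.2 = none → ∃ s'', s.SameFrame s'' ∧ s''.out = s.out ∧
        c'.proceed.1.Matches lab s'' ∧ BTD.proceed t τ s' = startCount t s'') := by
    intro c' s' hm hf ho
    obtain ⟨a, b⟩ := hm.proceed t τ
    refine ⟨fun k z h => ?_, fun h => ⟨s', hf, ho, b h⟩⟩
    obtain ⟨a1, a2, a3⟩ := a k z h
    exact ⟨a1, by rw [a2, hf.label], hf.trans a3⟩
  obtain ⟨h1, h2, h3, h4, h5⟩ := h
  cases k
  · simp only [Core.handle, if_true, BTD.handle, hs, h1]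
    split_ifs
    · have := key c s ⟨h1, h2, h3, h4, h5⟩ (State.SameFrame.refl s) rfl
      rwa [hs] at this
    · have := key { c with visited := true, parent := some v }
        { s with visited := true, parent := some (lab v) } ⟨rfl, rfl, h3, h4, h5⟩
        ⟨rfl, rfl, rfl, rfl, rfl, rfl, rfl, rfl⟩ rfl
      rw [hs] at this
      exact this
  · simp only [Core.handle, if_true, BTD.handle, hs]
    refine ⟨?_, by simp⟩
    rintro k z h
    simp only [Option.some.injEq, Prod.mk.injEq] at h
    obtain ⟨rfl, rfl⟩ := h
    exact ⟨⟨h1, h2, h3, h4, h5⟩, rfl, ⟨hs.symm, rfl, rfl, rfl, rfl, rfl, rfl, rfl⟩⟩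
  · simp only [Core.handle, if_true, BTD.handle, hs]
    have := key { c with children := c.children ++ [v], pending := c.pending ++ [v] }
        { s with children := s.children ++ [lab v], pending := s.pending ++ [lab v] }
        ⟨h1, h2, h3, by simp [h4], by simp [h5]⟩
        ⟨rfl, rfl, rfl, rfl, rfl, rfl, rfl, rfl⟩ rfl
    rw [hs] at this
    exact this

end Matches

/-- All tokens known to a station. -/
def State.toks (s : State) (I : List Ctl) (A : List ℕ) : List ℕ :=
  s.tok.toList ++ I.map Ctl.tok ++ A

theorem State.mem_toks {s : State} {I : List Ctl} {A : List ℕ} {τ : ℕ} :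
    τ ∈ s.toks I A ↔ s.tok = some τ ∨ (∃ c ∈ I, c.tok = τ) ∨ τ ∈ A := by
  simp [State.toks]

theorem finish_withBoxes (t : ℕ) (s : State) (I : List Ctl) (A : List ℕ) :
    finish t (s.withBoxes I A) = match (s.toks I A).min? with
      | none => s.silent
      | some τ => match I.find? fun c => c.tok = τ with
        | none => s.silent.view τ
        | some c => handle t c (s.silent.view τ) := rfl

/-- It lets invariants stated for the view of a state be used in `finish`, which empties the
mailboxes before it decides about joining. -/
theorem State.view_silent (τ : ℕ) (s : State) : s.silent.view τ = (s.view τ).silent := by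
  unfold State.view State.silent join
  split_ifs <;> rfl

/-- The frame of the station after it has dropped its message. -/
structure State.Renewed (s : State) (τ : Option ℕ) (s' : State) : Prop where
  label : s'.label = s.label
  nbrs : s'.nbrs = s.nbrs
  tok : s'.tok = τ
  searching : s'.Searching

theorem State.Searching.renewed_silent {s : State} (h : s.Searching) :
    s.Renewed s.tok s.silent :=
  ⟨rfl, rfl, rfl, ⟨rfl, rfl, h.wout, h.deadline, h.halted⟩⟩

theorem State.Searching.renewed_view {s : State} (h : s.Searching) (τ : ℕ) :
    s.Renewed (some τ) (s.silent.view τ) := by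
  unfold State.view
  split_ifs with ht
  · exact ⟨rfl, rfl, ht, ⟨rfl, rfl, h.wout, h.deadline, h.halted⟩⟩
  · exact ⟨rfl, rfl, rfl, ⟨rfl, rfl, h.wout, h.deadline, h.halted⟩⟩

theorem State.Renewed.trans {s s' s'' : State} {τ : Option ℕ} (h : s.Renewed τ s')
    (h' : s'.SameFrame s'') : s.Renewed τ s'' :=
  ⟨h'.label.trans h.label, h'.nbrs.trans h.nbrs, h'.tok.trans h.tok,
    ⟨h'.inbox.trans h.searching.inbox, h'.acks.trans h.searching.acks,
      h'.wout.trans h.searching.wout, h'.deadline.trans h.searching.deadline,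
      h'.halted.trans h.searching.halted⟩⟩

theorem State.view_out_silent (τ : ℕ) (s : State) : (s.silent.view τ).out = none := by
  unfold State.view
  split_ifs <;> rfl

theorem Core.Matches.of_fields {V : Type*} {lab : V → ℕ} {c : Core V} {s s' : State}
    (h : c.Matches lab s) (h1 : s'.visited = s.visited) (h2 : s'.parent = s.parent)
    (h3 : s'.todo = s.todo) (h4 : s'.pending = s.pending) (h5 : s'.children = s.children) :
    c.Matches lab s' :=
  ⟨h1.trans h.visited, h2.trans h.parent, h3.trans h.todo, h4.trans h.pending,
    h5.trans h.children⟩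

end BTD

/-! ### The second stage -/

namespace Network

open BTD

variable {n N : ℕ}

/-- The token with message `c` behaves as if it was alone in the network: the stations that do not
know a smaller token agree with the ideal execution `g` of BTD_Construct. If the token is not that
of `r`, then `r` has not been visited. -/
structure Ghost (net : Network n N) (p : SINRParams) (r : Fin n) (i : ℕ) (X : Fin n → State)
    (v : Fin n) (c : Ctl) (root : Fin n) (g : Fin n → Core (Fin n)) (z : Fin n) : Prop where
  tok : c.tok = net.label root
  src : c.src = net.label v
  dst : c.dst = net.label z
  inFlight : InFlight (net.commGraph p) root g c.kind v z i
  agree : ∀ u, (∀ τ, (X u).tok = some τ → c.tok ≤ τ) →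
    (g u).Matches net.label ((X u).view c.tok)
  unvisited : c.tok ≠ net.label r → (g r).visited = false

/-- The situation before the execution number `i` of Smallest_Token. -/
structure SearchInv (net : Network n N) (p : SINRParams) (K : Finset (Fin n)) (r : Fin n) (i : ℕ)
    (X : Fin n → State) : Prop where
  searching : ∀ v, (X v).Searching
  label : ∀ v, (X v).label = net.label v
  nbrs : ∀ v, (X v).nbrs = (net.info p K v).nbrs
  dens : ∀ z, #{v | (X v).out.isSome ∧ net.box p v = z} ≤ 3
  tok : ∀ v c, (X v).out = some c → (X v).tok = some c.tok
  unique : ∀ v w c d, (X v).out = some c → (X w).out = some d → c.tok = d.tok → v = w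
  min : ∀ v τ, (X v).tok = some τ → net.label r ≤ τ
  root_tok : (X r).tok = some (net.label r)
  ghost : ∀ v c, (X v).out = some c → ∃ root g z, net.Ghost p r i X v c root g z
  alive : ∃ v c, (X v).out = some c ∧ c.tok = net.label r

/-- The search for the token of `r` is completed, and no other token has survived. -/
structure Completed (net : Network n N) (p : SINRParams) (r : Fin n) (t : ℕ)
    (par : Fin n → Option (Fin n)) (ch : Fin n → List (Fin n)) (Y X : Fin n → State) : Prop where
  search : Relation.ReflTransGen (BTDStep (net.commGraph p)) (BTDSearch.init r)
    ⟨[], Set.univ, par⟩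
  searching : ∀ v, (Y v).Searching
  out : ∀ v, (Y v).out = none
  label : ∀ v, (Y v).label = net.label v
  tok : ∀ v, (Y v).tok = some (net.label r)
  parent : ∀ v, (Y v).parent = (par v).map net.label
  children : ∀ v, (Y v).children = (ch v).map net.label
  nodup : ∀ v, (ch v).Nodup
  mem_children : ∀ v z, z ∈ ch v ↔ par z = some v
  root : X r = startCount t (Y r)
  other : ∀ v, v ≠ r → X v = Y v

section Step

variable {net : Network n N} {p : SINRParams} {K : Finset (Fin n)} {r : Fin n} {i : ℕ}
  {X : Fin n → State} {I : Fin n → List Ctl} {A : Fin n → List ℕ}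

/-- The station `v` gets the message `c` from `w`, and completes its search. -/
def Completes (net : Network n N) (p : SINRParams) (r : Fin n) (i : ℕ) (X : Fin n → State)
    (I : Fin n → List Ctl) (A : Fin n → List ℕ) (t : ℕ) (v : Fin n) : Prop :=
  ∃ w c root g s, (X w).out = some c ∧ (net.commGraph p).Adj w v ∧ net.Ghost p r i X w c root g v ∧
    ((X v).toks (I v) (A v)).min? = some c.tok ∧
    (Core.handle c.kind w v v (g v)).2 = none ∧
    (X v).Renewed (some c.tok) s ∧ s.out = none ∧
    (Core.handle c.kind w v v (g v)).1.Matches net.label s ∧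
    finish t ((X v).withBoxes (I v) (A v)) = startCount t s

/-- The result of an execution of Smallest_Token at a station that does not complete its search. -/
structure Ordinary (net : Network n N) (p : SINRParams) (r : Fin n) (i : ℕ) (X : Fin n → State)
    (I : Fin n → List Ctl) (A : Fin n → List ℕ) (v : Fin n) (s : State) : Prop where
  renewed : (X v).Renewed ((X v).toks (I v) (A v)).min? s
  out : ∀ c', s.out = some c' → ∃ w c root g z', (X w).out = some c ∧ (net.commGraph p).Adj w v ∧
    net.Ghost p r i X w c root g v ∧ ((X v).toks (I v) (A v)).min? = some c.tok ∧
    (Core.handle c.kind w v v (g v)).2 = some (c'.kind, z') ∧ c'.tok = c.tok ∧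
    c'.src = net.label v ∧ c'.dst = net.label z'
  handled : ∀ τ, ((X v).toks (I v) (A v)).min? = some τ → ∀ w c, (X w).out = some c →
    (net.commGraph p).Adj w v → c.tok = τ → ∀ root g z, net.Ghost p r i X w c root g z →
    (Core.handle c.kind w z v (g v)).1.Matches net.label s ∧ (v = z → s.out.isSome)
  quiet : ∀ τ, ((X v).toks (I v) (A v)).min? = some τ → (∀ w c, (X w).out = some c →
    (net.commGraph p).Adj w v → c.tok ≠ τ) → s = (X v).silent.view τ

theorem min?_le {l : List ℕ} {τ σ : ℕ} (h : l.min? = some τ) (hσ : σ ∈ l) : τ ≤ σ :=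
  (List.min?_eq_some_iff.1 h).2 σ hσ

theorem SearchInv.message_unique (h : net.SearchInv p K r i X) {w w' : Fin n} {c c' : Ctl}
    (hw : (X w).out = some c) (hw' : (X w').out = some c') (ht : c.tok = c'.tok) :
    w = w' ∧ c = c' := by
  have := h.unique w w' c c' hw hw' ht
  subst this
  exact ⟨rfl, Option.some.inj (hw.symm.trans hw')⟩

theorem Ghost.dst_unique {w w' : Fin n} {c : Ctl} {root g z root' g' z'}
    (h : net.Ghost p r i X w c root g z) (h' : net.Ghost p r i X w' c root' g' z') : z = z' :=
  net.label_injective (h.dst.symm.trans h'.dst)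

/-- What happens at a single station. -/
theorem SearchInv.local_step (h : net.SearchInv p K r i X)
    (hI : ∀ v c, c ∈ I v ↔ ∃ w, (net.commGraph p).Adj w v ∧ (X w).out = some c)
    (t : ℕ) (v : Fin n) : net.Completes p r i X I A t v ∨
      net.Ordinary p r i X I A v (finish t ((X v).withBoxes (I v) (A v))) := by
  by_cases hc : net.Completes p r i X I A t v
  · exact Or.inl hc
  refine Or.inr ?_
  rw [finish_withBoxes]
  rcases hmin : ((X v).toks (I v) (A v)).min? with _ | τ
  · have hnil : (X v).toks (I v) (A v) = [] := List.min?_eq_none_iff.1 hmin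
    have htok : (X v).tok = none := by
      rw [Option.eq_none_iff_forall_ne_some]
      intro τ hτ
      have := State.mem_toks (A := A v) (I := I v) |>.2 (Or.inl hτ)
      rw [hnil] at this
      cases this
    simp only
    refine ⟨?_, by simp [State.silent], by simp [hmin], by simp [hmin]⟩
    rw [hmin, ← htok]
    exact (h.searching v).renewed_silent
  · have hren := (h.searching v).renewed_view τ
    have hlab : ((X v).silent.view τ).label = net.label v := hren.label.trans (h.label v)
    -- The token τ is the smallest one known to `v` after the execution, so `v` knew no smaller one
    -- before, and the agreement of the ideal execution applies.
    have hmatch : ∀ w c, (X w).out = some c → c.tok = τ → ∀ root g z,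
        net.Ghost p r i X w c root g z → (g v).Matches net.label ((X v).silent.view τ) := by
      intro w c _ hcτ root g z hg
      have := hg.agree v fun τ' hτ' => by
        rw [hcτ]
        exact min?_le hmin (State.mem_toks.2 (Or.inl hτ'))
      rw [hcτ] at this
      rw [State.view_silent]
      exact this.of_fields rfl rfl rfl rfl rfl
    simp only
    split
    on_goal 1 => rename_i hfind
    on_goal 2 => rename_i c hfind
    · simp only [List.find?_eq_none, decide_eq_true_eq] at hfind
      refine ⟨hmin ▸ hren, ?_, ?_, ?_⟩
      · intro c' hc'
        rw [State.view_out_silent] at hc'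
        cases hc'
      · intro τ' hτ' w c hw hadj hc
        obtain rfl : τ = τ' := Option.some.inj (hmin.symm.trans hτ')
        exact absurd hc (hfind c ((hI v c).2 ⟨w, hadj, hw⟩))
      · intro τ' hτ' _
        obtain rfl : τ = τ' := Option.some.inj (hmin.symm.trans hτ')
        rfl
    · have hcτ : c.tok = τ := by simpa using List.find?_some hfind
      obtain ⟨w, hadj, hw⟩ := (hI v c).1 (List.mem_of_find?_eq_some hfind)
      have huniq : ∀ w' c', (X w').out = some c' → c'.tok = τ → w' = w ∧ c' = c :=
        fun w' c' hw' hc' => h.message_unique hw' hw (hc'.trans hcτ.symm)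
      have hquiet : ∀ τ', ((X v).toks (I v) (A v)).min? = some τ' → (∀ w c, (X w).out = some c →
          (net.commGraph p).Adj w v → c.tok ≠ τ') →
          handle t c ((X v).silent.view τ) = (X v).silent.view τ' := by
        intro τ' hτ' hno
        obtain rfl : τ = τ' := Option.some.inj (hmin.symm.trans hτ')
        exact absurd hcτ (hno w c hw hadj)
      obtain ⟨root, g, z, hg⟩ := h.ghost w c hw
      by_cases hzv : z = v
      · subst hzv
        obtain ⟨hrec1, hrec2⟩ := (hmatch w c hw hcτ root g z hg).receive t hlab hg.src hg.dst
        rcases hres : (Core.handle c.kind w z z (g z)).2 with _ | ⟨k', z'⟩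
        · exfalso
          obtain ⟨s', hs1, hs2, hs3, hs4⟩ := hrec2 hres
          refine hc ⟨w, c, root, g, s', hw, hadj, hg, hcτ ▸ hmin, hres, hcτ ▸ hren.trans hs1,
            hs2.trans (State.view_out_silent _ _), hs3, ?_⟩
          rw [finish_withBoxes, hmin]
          simp only
          rw [hfind]
          exact hs4
        · obtain ⟨-, hr2, hr3⟩ := hrec1 k' z' hres
          refine ⟨hmin ▸ hren.trans hr3, ?_, ?_, hquiet⟩
          · intro c' hc'
            obtain rfl := Option.some.inj (hr2.symm.trans hc')
            exact ⟨w, c, root, g, z', hw, hadj, hg, hcτ ▸ hmin, hres, rfl, hlab, rfl⟩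
          -- The accompanying ideal execution need not be unique, and the claim is needed for an
          -- arbitrary one.
          · intro τ' hτ' w' c' hw' _ hc' root' g' z'' hg'
            obtain rfl : τ = τ' := Option.some.inj (hmin.symm.trans hτ')
            obtain ⟨rfl, rfl⟩ := huniq w' c' hw' hc'
            obtain rfl := hg.dst_unique hg'
            obtain ⟨hrec1', hrec2'⟩ :=
              (hmatch _ _ hw hcτ root' g' z hg').receive t hlab hg'.src hg'.dst
            rcases hres' : (Core.handle c'.kind w' z z (g' z)).2 with _ | ⟨k'', z'''⟩
            · exfalso
              obtain ⟨s', hs1, hs2, hs3, hs4⟩ := hrec2' hres'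
              refine hc ⟨w', c', root', g', s', hw, hadj, hg', hcτ ▸ hmin, hres',
                hcτ ▸ hren.trans hs1, hs2.trans (State.view_out_silent _ _), hs3, ?_⟩
              rw [finish_withBoxes, hmin]
              simp only
              rw [hfind]
              exact hs4
            · exact ⟨(hrec1' _ _ hres').1, fun _ => by rw [hr2]; rfl⟩
      · obtain ⟨-, ho2, ho3⟩ :=
          (hmatch w c hw hcτ root g z hg).overhear net.label_injective t hlab hg.src hg.dst hzv
        refine ⟨hmin ▸ hren.trans ho3, ?_, ?_, hquiet⟩
        · intro c' hc'
          rw [ho2, State.view_out_silent] at hc'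
          cases hc'
        · intro τ' hτ' w' c' hw' _ hc' root' g' z'' hg'
          obtain rfl : τ = τ' := Option.some.inj (hmin.symm.trans hτ')
          obtain ⟨rfl, rfl⟩ := huniq w' c' hw' hc'
          obtain rfl := hg.dst_unique hg'
          exact ⟨((hmatch _ _ hw hcτ root' g' z hg').overhear net.label_injective t hlab hg'.src
            hg'.dst hzv).1, fun h => absurd h.symm hzv⟩

theorem SearchInv.le_of_mem_toks (h : net.SearchInv p K r i X)
    (hI : ∀ v c, c ∈ I v ↔ ∃ w, (net.commGraph p).Adj w v ∧ (X w).out = some c)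
    (hA : ∀ v τ, τ ∈ A v ↔ ∃ w, (net.commGraph p).Adj w v ∧
        addressed ((X w).withBoxes (I w) []) = some τ) {v : Fin n} {τ : ℕ}
    (hτ : τ ∈ (X v).toks (I v) (A v)) : net.label r ≤ τ := by
  have hIr : ∀ v, ∀ c ∈ I v, net.label r ≤ c.tok := by
    intro v c hc
    obtain ⟨w, -, hw⟩ := (hI v c).1 hc
    exact h.min w _ (h.tok w c hw)
  rcases State.mem_toks.1 hτ with hτ | ⟨c, hc, rfl⟩ | hτ
  · exact h.min v τ hτ
  · exact hIr v c hc
  · obtain ⟨w, -, hw⟩ := (hA v τ).1 hτ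
    obtain ⟨⟨c, hc, -, rfl⟩, -⟩ := addressed_eq_some_iff.1 hw
    exact hIr w c hc

theorem SearchInv.min_root (h : net.SearchInv p K r i X)
    (hI : ∀ v c, c ∈ I v ↔ ∃ w, (net.commGraph p).Adj w v ∧ (X w).out = some c)
    (hA : ∀ v τ, τ ∈ A v ↔ ∃ w, (net.commGraph p).Adj w v ∧
        addressed ((X w).withBoxes (I w) []) = some τ) :
    ((X r).toks (I r) (A r)).min? = some (net.label r) :=
  List.min?_eq_some_iff.2 ⟨State.mem_toks.2 (Or.inl h.root_tok),
    fun _ hτ => h.le_of_mem_toks hI hA hτ⟩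

/-- Only the token of `r` completes its search. -/
theorem SearchInv.complete_tok (hG : (net.commGraph p).Connected) (h : net.SearchInv p K r i X)
    (hI : ∀ v c, c ∈ I v ↔ ∃ w, (net.commGraph p).Adj w v ∧ (X w).out = some c)
    (hA : ∀ v τ, τ ∈ A v ↔ ∃ w, (net.commGraph p).Adj w v ∧
        addressed ((X w).withBoxes (I w) []) = some τ)
    {v w root : Fin n} {c : Ctl} {g : Fin n → Core (Fin n)}
    (hg : net.Ghost p r i X w c root g v)
    (hmin : ((X v).toks (I v) (A v)).min? = some c.tok)
    (hnone : (Core.handle c.kind w v v (g v)).2 = none) : c.tok = net.label r := by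
  by_contra hne
  have hvr : v ≠ r := by
    rintro rfl
    exact hne (Option.some.inj (hmin.symm.trans (h.min_root hI hA)))
  -- A completed search has visited `r`, but `r` was unvisited before this message, and overhearing
  -- it does not make a node visited.
  obtain ⟨par, -, hall⟩ := (hg.inFlight.next hG).2 hnone
  have h1 := (hall r).1
  have h2 := hg.unvisited hne
  rw [deliver] at h1
  split_ifs at h1
  · rw [(Core.handle_visited hvr _).1, h2] at h1
    cases h1
  · rw [h2] at h1
    cases h1

/-- A station that knows no smaller token afterwards knew none before. If it is adjacent to the
sender, it has heard the message and handled it as in the ideal execution. Otherwise that execution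
does not change at this station, and the actual state either stays put or, if the token is still
unknown there, still counts as freshly joined. -/
theorem Ordinary.agree (h : net.SearchInv p K r i X) {v w u root : Fin n} {c : Ctl}
    {g : Fin n → Core (Fin n)} {s : State} (hs : net.Ordinary p r i X I A u s)
    (hI : ∀ v c, c ∈ I v ↔ ∃ w, (net.commGraph p).Adj w v ∧ (X w).out = some c)
    (hw : (X w).out = some c) (hg : net.Ghost p r i X w c root g v)
    (hle : ∀ τ, s.tok = some τ → c.tok ≤ τ) :
    (deliver (net.commGraph p) c.kind w v g u).Matches net.label (s.view c.tok) := by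
  have hren := hs.renewed
  have hmem : c.tok ∈ (X u).toks (I u) (A u) → ((X u).toks (I u) (A u)).min? = some c.tok := by
    intro hmem
    rcases hmin : ((X u).toks (I u) (A u)).min? with _ | τ
    · rw [List.min?_eq_none_iff.1 hmin] at hmem
      cases hmem
    · rw [le_antisymm (hle τ (hren.tok.trans hmin)) (min?_le hmin hmem)]
  have hold : (g u).Matches net.label ((X u).view c.tok) := by
    refine hg.agree u fun τ hτ => ?_
    have hτ' : τ ∈ (X u).toks (I u) (A u) := State.mem_toks.2 (Or.inl hτ)
    rcases hmin : ((X u).toks (I u) (A u)).min? with _ | σ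
    · rw [List.min?_eq_none_iff.1 hmin] at hτ'
      cases hτ'
    · exact (hle σ (hren.tok.trans hmin)).trans (min?_le hmin hτ')
  unfold deliver
  split_ifs with hadj
  · have hmin := hmem (State.mem_toks.2 (Or.inr (Or.inl ⟨c, (hI u c).2 ⟨w, hadj, hw⟩, rfl⟩)))
    rw [State.view, if_pos (hren.tok.trans hmin)]
    exact (hs.handled _ hmin w c hw hadj rfl root g v hg).1
  · by_cases hmin : ((X u).toks (I u) (A u)).min? = some c.tok
    · rw [State.view, if_pos (hren.tok.trans hmin), hs.quiet _ hmin ?_, State.view_silent]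
      · exact hold.of_fields rfl rfl rfl rfl rfl
      · intro w' c' hw' hadj' ht
        obtain ⟨rfl, -⟩ := h.message_unique hw' hw ht
        exact hadj hadj'
    · rw [State.view, if_neg fun he => hmin (hren.tok.symm.trans he)]
      rw [State.view, if_neg fun he => hmin (hmem (State.mem_toks.2 (Or.inl he)))] at hold
      refine hold.of_fields rfl rfl ?_ rfl rfl
      simp only [join, hren.nbrs]

/-- If no station completes its search, then the invariant is preserved. -/
theorem SearchInv.next (hG : (net.commGraph p).Connected) (h : net.SearchInv p K r i X)
    (hI : ∀ v c, c ∈ I v ↔ ∃ w, (net.commGraph p).Adj w v ∧ (X w).out = some c)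
    (hA : ∀ v τ, τ ∈ A v ↔ ∃ w, (net.commGraph p).Adj w v ∧
        addressed ((X w).withBoxes (I w) []) = some τ) {X' : Fin n → State}
    (hX' : ∀ v, net.Ordinary p r i X I A v (X' v)) : net.SearchInv p K r (i + 1) X' := by
  have hout := fun v => (hX' v).out
  have hren := fun v => (hX' v).renewed
  have huniq : ∀ v w c d, (X' v).out = some c → (X' w).out = some d → c.tok = d.tok → v = w := by
    intro v w c d hv hw ht
    obtain ⟨v₁, c₁, root₁, g₁, z₁, hv₁, -, hg₁, -, -, ht₁, -⟩ := hout v c hv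
    obtain ⟨v₂, c₂, root₂, g₂, z₂, hv₂, -, hg₂, -, -, ht₂, -⟩ := hout w d hw
    obtain ⟨rfl, rfl⟩ := h.message_unique hv₁ hv₂ (by rw [← ht₁, ← ht₂, ht])
    exact hg₁.dst_unique hg₂
  refine ⟨fun v => (hren v).searching, fun v => (hren v).label.trans (h.label v),
    fun v => (hren v).nbrs.trans (h.nbrs v), ?_, ?_, huniq, ?_, ?_, ?_, ?_⟩
  · intro z
    refine le_trans (card_le_one.2 ?_) (by norm_num : 1 ≤ 3)
    intro v hv w hw
    simp only [mem_filter, mem_univ, true_and] at hv hw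
    obtain ⟨hv, hvz⟩ := hv
    obtain ⟨hw, hwz⟩ := hw
    obtain ⟨cv, hcv⟩ := Option.isSome_iff_exists.1 hv
    obtain ⟨cw, hcw⟩ := Option.isSome_iff_exists.1 hw
    by_contra hne
    -- The new holder `w` announced its token in the second part, and `v`, in the same box and so
    -- adjacent, heard it. A new holder knows no token smaller than its own.
    have key : ∀ v w cv cw, v ≠ w → net.box p v = net.box p w → (X' v).out = some cv →
        (X' w).out = some cw → cv.tok ≤ cw.tok := by
      intro v w cv cw hne hbox hcv hcw
      obtain ⟨v₁, c₁, root₁, g₁, z₁, hv₁, hadj₁, hg₁, hm₁, -, ht₁, -⟩ := hout v cv hcv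
      obtain ⟨v₂, c₂, root₂, g₂, z₂, hv₂, hadj₂, hg₂, hm₂, -, ht₂, -⟩ := hout w cw hcw
      rw [ht₁, ht₂]
      refine min?_le hm₁ (State.mem_toks.2 (Or.inr (Or.inr ?_)))
      refine (hA v _).2 ⟨w, net.adj_of_box_eq p (Ne.symm hne) hbox.symm, ?_⟩
      rw [addressed_eq_some_iff]
      refine ⟨⟨c₂, (hI w c₂).2 ⟨v₂, hadj₂, hv₂⟩, hg₂.dst.trans (h.label w).symm, rfl⟩, ?_⟩
      intro c hc _
      exact min?_le hm₂ (State.mem_toks.2 (Or.inr (Or.inl ⟨c, hc, rfl⟩)))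
    refine hne (huniq v w cv cw hcv hcw (le_antisymm ?_ ?_))
    · exact key v w cv cw hne (hvz.trans hwz.symm) hcv hcw
    · exact key w v cw cv (Ne.symm hne) (hwz.trans hvz.symm) hcw hcv
  · intro v c hv
    obtain ⟨v₁, c₁, root₁, g₁, z₁, hv₁, -, hg₁, hm₁, -, ht₁, -⟩ := hout v c hv
    rw [(hren v).tok, hm₁, ht₁]
  · intro v τ hτ
    rw [(hren v).tok] at hτ
    exact h.le_of_mem_toks hI hA (List.min?_eq_some_iff.1 hτ).1
  · rw [(hren r).tok, h.min_root hI hA]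
  · intro v c' hv
    obtain ⟨w, c, root, g, z', hw, hadj, hg, hm, hres, ht, hsrc, hdst⟩ := hout v c' hv
    refine ⟨root, deliver (net.commGraph p) c.kind w v g, z', ht.trans hg.tok, hsrc, hdst,
      (hg.inFlight.next hG).1 _ _ hres, ?_, ?_⟩
    · intro u hu
      rw [ht] at hu ⊢
      exact (hX' u).agree h hI hw hg hu
    · intro hne
      rw [ht] at hne
      have hvr : v ≠ r := by
        rintro rfl
        exact hne (Option.some.inj (hm.symm.trans (h.min_root hI hA)))
      rw [← hg.unvisited hne, deliver]
      split_ifs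
      · exact (Core.handle_visited hvr _).1
      · rfl
  -- The destination of the smallest token cannot know a smaller one, so it handles the message; as
  -- no station completes its search, it sends a new one.
  · obtain ⟨w, c, hw, hc⟩ := h.alive
    obtain ⟨root, g, z, hg⟩ := h.ghost w c hw
    have hadj := hg.inFlight.adj
    have hmin : ((X z).toks (I z) (A z)).min? = some c.tok := by
      refine List.min?_eq_some_iff.2
        ⟨State.mem_toks.2 (Or.inr (Or.inl ⟨c, (hI z c).2 ⟨w, hadj, hw⟩, rfl⟩)), fun τ hτ => ?_⟩
      rw [hc]
      exact h.le_of_mem_toks hI hA hτ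
    obtain ⟨c', hc'⟩ := Option.isSome_iff_exists.1
      (((hX' z).handled _ hmin w c hw hadj rfl root g z hg).2 rfl)
    refine ⟨z, c', hc', ?_⟩
    obtain ⟨_, c₁, _, _, _, _, _, _, hm₁, _, ht₁, _⟩ := hout z c' hc'
    rw [ht₁, ← hc]
    exact Option.some.inj (hm₁.symm.trans hmin)

theorem eq_root_of_parent_eq_none {V : Type*} [DecidableEq V] {G : SimpleGraph V} {root z : V}
    {par : V → Option V}
    (h : Relation.ReflTransGen (BTDStep G) (BTDSearch.init root) ⟨[], Set.univ, par⟩)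
    (hz : par z = none) : z = root := by
  have := (BTDSearch.valid_of_reflTransGen h).induct (fun z => z = root ∨ ∃ u, par z = some u)
    (Or.inl rfl) (fun z u hzu _ => Or.inr ⟨u, hzu⟩) z (Set.mem_univ z)
  rcases this with h | ⟨u, hu⟩
  · exact h
  · rw [hz] at hu
    cases hu

/-- If a station completes its search, then the second stage is over. -/
theorem SearchInv.completed (hG : (net.commGraph p).Connected) (h : net.SearchInv p K r i X)
    (hI : ∀ v c, c ∈ I v ↔ ∃ w, (net.commGraph p).Adj w v ∧ (X w).out = some c)
    (hA : ∀ v τ, τ ∈ A v ↔ ∃ w, (net.commGraph p).Adj w v ∧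
        addressed ((X w).withBoxes (I w) []) = some τ) {t : ℕ} {v : Fin n}
    (hv : net.Completes p r i X I A t v) :
    ∃ par ch Y, net.Completed p r t par ch Y fun u =>
      finish t ((X u).withBoxes (I u) (A u)) := by
  obtain ⟨w, c, root, g, s, hw, hadj, hg, hmin, hnone, hren, hout, hmatch, hfin⟩ := hv
  have htok := h.complete_tok hG hI hA hg hmin hnone
  obtain rfl : root = r := net.label_injective (hg.tok.symm.trans htok)
  have hord : ∀ u, u ≠ v →
      net.Ordinary p root i X I A u (finish t ((X u).withBoxes (I u) (A u))) := by
    intro u hu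
    refine (h.local_step hI t u).resolve_left ?_
    rintro ⟨w', c', root', g', s', hw', hadj', hg', hmin', hnone', -⟩
    obtain ⟨rfl, rfl⟩ := h.message_unique hw' hw
      ((h.complete_tok hG hI hA hg' hmin' hnone').trans htok.symm)
    exact hu (hg'.dst_unique hg)
  obtain ⟨par, hsearch, hall⟩ := (hg.inFlight.next hG).2 hnone
  set g' := deliver (net.commGraph p) c.kind w v g with hg'
  have hgv : g' v = (Core.handle c.kind w v v (g v)).1 := by simp [hg', deliver, hadj]
  rw [← hgv] at hmatch
  set Y : Fin n → State := fun u =>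
    if u = v then s else finish t ((X u).withBoxes (I u) (A u)) with hY
  have hYo : ∀ u, u ≠ v → Y u = finish t ((X u).withBoxes (I u) (A u)) := fun u hu => if_neg hu
  have hYv : Y v = s := if_pos rfl
  have htokY : ∀ u, (Y u).tok = some (net.label root) ∧ (g' u).Matches net.label (Y u) := by
    intro u
    by_cases hu : u = v
    · subst hu
      rw [hYv, hren.tok, htok]
      exact ⟨rfl, hmatch⟩
    · have ho := hord u hu
      have hle : ∀ τ, (Y u).tok = some τ → c.tok ≤ τ := by
        intro τ hτ
        rw [hYo u hu, ho.renewed.tok] at hτ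
        rw [htok]
        exact h.le_of_mem_toks hI hA (List.min?_eq_some_iff.1 hτ).1
      rw [hYo u hu] at hle ⊢
      have hm := ho.agree h hI hw hg hle
      rw [← htok]
      by_cases he : (finish t ((X u).withBoxes (I u) (A u))).tok = some c.tok
      · rw [State.view, if_pos he] at hm
        exact ⟨he, hm⟩
      -- A station without the token would agree with a freshly joined one, which is unvisited,
      -- whereas the completed ideal execution has visited all nodes.
      · rw [State.view, if_neg he] at hm
        have := hm.visited
        rw [(hall u).1] at this
        cases this
  -- A search is completed only by a holder without a parent.
  have hroot : v = root := by
    refine eq_root_of_parent_eq_none hsearch ?_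
    rw [← (hall v).2.1]
    have hk := hnone
    rw [hgv]
    have key : ∀ c : Core (Fin n), c.proceed.2 = none → c.proceed.1.parent = none := by
      intro c hc
      obtain ⟨-, -, h3, h4⟩ := Core.proceed_eq_none
        (Prod.ext rfl hc : c.proceed = (c.proceed.1, none))
      rw [h4, h3]
    revert hk
    cases c.kind <;> simp only [Core.handle, if_true]
    · split_ifs <;> exact key _
    · simp
    · exact key _
  subst hroot
  refine ⟨par, fun u => (g' u).children, Y, hsearch, ?_, ?_, ?_, fun u => (htokY u).1, ?_, ?_,
    fun u => (hall u).2.2.1, fun u => (hall u).2.2.2, ?_, fun u hu => (hYo u hu).symm⟩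
  · intro u
    by_cases hu : u = v
    · rw [hu, hYv]
      exact hren.searching
    · rw [hYo u hu]
      exact (hord u hu).renewed.searching
  · intro u
    by_cases hu : u = v
    · rw [hu, hYv, hout]
    -- Any new message would belong to the smallest token, hence answer the one message of that
    -- token, whose only addressee is `v`.
    · rw [hYo u hu, Option.eq_none_iff_forall_ne_some]
      intro c' hc'
      obtain ⟨w', c₁, root₁, g₁, z₁, hw₁, -, hg₁, hm₁, -⟩ := (hord u hu).out c' hc'
      have h1 := (htokY u).1
      rw [hYo u hu, (hord u hu).renewed.tok, hm₁] at h1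
      obtain ⟨rfl, rfl⟩ := h.message_unique hw₁ hw ((Option.some.inj h1).trans htok.symm)
      exact hu (hg₁.dst_unique hg)
  · intro u
    by_cases hu : u = v
    · rw [hu, hYv, hren.label, h.label]
    · rw [hYo u hu, (hord u hu).renewed.label, h.label]
  · intro u
    rw [(htokY u).2.parent, (hall u).2.1]
  · intro u
    exact (htokY u).2.children
  · simp only [hYv, hfin]

end Step

end Network

/-! ### The beginning of the second stage -/

namespace Network

open BTD

variable {n N : ℕ} {net : Network n N} {p : SINRParams} {E F : List (Finset ℕ)}
  {K : Finset (Fin n)}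

variable (net p K) in
-- Stations store labels, whereas the ideal execution works with nodes; this lifts the neighbour
-- lists.
theorem exists_nbrs : ∃ nb : Fin n → List (Fin n), ∀ v,
    (net.info p K v).nbrs = (nb v).map net.label ∧ (nb v).Nodup ∧
      ∀ x, x ∈ nb v ↔ (net.commGraph p).Adj v x := by
  classical
  have : ∀ v, ∃ l : List (Fin n), (net.info p K v).nbrs = l.map net.label ∧ l.Nodup ∧
      ∀ x, x ∈ l ↔ (net.commGraph p).Adj v x := by
    intro v
    have hmem : ∀ a, a ∈ (net.info p K v).nbrs ↔
        ∃ u, (net.commGraph p).Adj v u ∧ net.label u = a := by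
      intro a
      simp [info]
    have hnd : (net.info p K v).nbrs.Nodup := by simp [info]
    have hr : (net.info p K v).nbrs ∈ Set.range (List.map net.label) := by
      rw [Set.range_list_map]
      intro a ha
      obtain ⟨u, -, hu⟩ := (hmem a).1 ha
      exact ⟨u, hu⟩
    obtain ⟨l, hl⟩ := hr
    rw [← hl] at hnd hmem
    refine ⟨l, hl.symm, hnd.of_map, fun x => ?_⟩
    rw [← List.mem_map_of_injective net.label_injective, hmem]
    constructor
    · rintro ⟨u, hu, he⟩
      rwa [← net.label_injective he]
    · exact fun h => ⟨x, h, rfl⟩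
  choose nb hnb using this
  exact ⟨nb, hnb⟩

/-- The state of a station when the second stage begins, before it checks whether it has to
terminate. -/
def firstState (t : ℕ) (s : State) : State := if s.active then issue t s else s

theorem run_length_succ (v : Fin n) :
    net.run p (traversals E F) K (E.length + 1) v =
      terminate E.length (firstState E.length (net.run p (traversals E F) K E.length v)) := by
  have h := (run_eq_of_le_length (net := net) (p := p) (E := E) (F := F) (K := K) le_rfl v).1
  rw [run_succ, h]
  simp [traversals, State.setActive, start, firstState]

/-- The surviving stations become the roots of their executions of BTD_Construct. -/
theorem searchInv_zero (hG : (net.commGraph p).Connected) {r : Fin n}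
    {act : Finset (Fin n)} (hr : r ∈ act) (hmin : ∀ v ∈ act, net.label r ≤ net.label v)
    (hdens : ∀ z, #{w ∈ act | net.box p w = z} ≤ 3) {S : Fin n → State}
    (hS : ∀ v, S v = (start (net.info p K v)).setActive (decide (v ∈ act))) (t : ℕ) :
    net.SearchInv p K r 0 (fun v => firstState t (S v)) ∨
      ∃ par ch Y, net.Completed p r t par ch Y (fun v => firstState t (S v)) := by
  obtain ⟨nb, hnb⟩ := net.exists_nbrs p K
  have hlabel : ∀ v, (S v).label = net.label v := fun v => by rw [hS]; rfl
  have hnbrs : ∀ v, (S v).nbrs = (nb v).map net.label := fun v => by rw [hS, ← (hnb v).1]; rfl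
  have hsearch : ∀ v, (S v).Searching := fun v => by rw [hS]; exact ⟨rfl, rfl, rfl, rfl, rfl⟩
  have hvv : ∀ v, v ∉ nb v := fun v h => (((hnb v).2.2 v).1 h).ne rfl
  set s₁ : Fin n → State := fun v => { join (S v).label (S v) with visited := true } with hs₁
  set core : Fin n → Fin n → Core (Fin n) := fun v u =>
    if u = v then ⟨true, none, nb v, [], []⟩ else ⟨false, none, (nb u).erase v, [], []⟩ with hcore
  have hcv : ∀ v, core v v = ⟨true, none, nb v, [], []⟩ := fun v => if_pos rfl
  have hcu : ∀ v u, u ≠ v → core v u = ⟨false, none, (nb u).erase v, [], []⟩ :=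
    fun v u hu => if_neg hu
  have hmatch : ∀ v, (core v v).Matches net.label (s₁ v) := by
    intro v
    rw [hcv]
    refine ⟨rfl, rfl, ?_, rfl, rfl⟩
    simp only [hs₁, join, hlabel, hnbrs]
    rw [← List.map_erase net.label_injective, List.erase_of_not_mem (hvv v)]
  have hhold : ∀ v, ∃ T, Holding (net.commGraph p) v (core v) v [] T 0 := by
    intro v
    refine holding_init ?_ ?_
    · rw [hcv]
      exact ⟨rfl, rfl, (hnb v).2.1, rfl, rfl, (hnb v).2.2⟩
    · intro u hu
      rw [hcu v u hu]
      refine ⟨rfl, rfl, rfl, (hnb u).2.1.erase _, fun x => ?_⟩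
      rw [(hnb u).2.1.mem_erase_iff, (hnb u).2.2, and_comm]
  have hact : ∀ v ∈ act, firstState t (S v) = proceed t (net.label v) (s₁ v) := by
    intro v hv
    have ha : (S v).active = true := by rw [hS]; simp [State.setActive, hv]
    simp only [firstState, ha, if_true, issue, hlabel, hs₁]
  have hinact : ∀ v, v ∉ act → firstState t (S v) = S v := by
    intro v hv
    have ha : (S v).active = false := by rw [hS]; simp [State.setActive, hv]
    simp [firstState, ha]
  -- A root that has nothing to send at once has no neighbours, so by connectivity it is the only
  -- station and the second stage is void.
  by_cases hlone : ∃ v ∈ act, (core v v).proceed.2 = none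
  · obtain ⟨v, hv, hnone⟩ := hlone
    obtain ⟨T, hT⟩ := hhold v
    obtain ⟨-, -, -, hpr⟩ := Core.proceed_eq_none (Prod.ext rfl hnone :
      (core v v).proceed = ((core v v).proceed.1, none))
    obtain ⟨par, hpar, hall⟩ := (hT.result hG (g' := core v) (fun _ _ => rfl) hpr.symm).2 hnone
    have huv : ∀ u, u = v := by
      intro u
      by_contra hu
      have := (hall u).1
      rw [hcu v u hu] at this
      cases this
    obtain rfl := huv r
    refine Or.inr ⟨par, fun u => (core r u).children, s₁, hpar, ?_, ?_, ?_, ?_, ?_, ?_,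
      fun u => (hall u).2.2.1, fun u => (hall u).2.2.2, ?_, fun u hu => absurd (huv u) hu⟩
    · exact fun u => ⟨(hsearch u).inbox, (hsearch u).acks, (hsearch u).wout, (hsearch u).deadline,
        (hsearch u).halted⟩
    · exact fun u => by simp [hs₁, join, hS, start, State.setActive]
    · exact fun u => hlabel u
    · intro u
      rw [huv u]
      simp [hs₁, join, hlabel]
    · intro u
      rw [huv u, (hmatch r).parent, (hall r).2.1]
    · intro u
      rw [huv u, (hmatch r).children]
    · rw [hact r hr]
      exact ((hmatch r).proceed t _).2 hnone |>.2
  · push Not at hlone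
    left
    have hsome : ∀ v ∈ act, ∃ k z, (core v v).proceed.2 = some (k, z) := by
      intro v hv
      obtain ⟨⟨k, z⟩, h⟩ := Option.ne_none_iff_exists'.1 (hlone v hv)
      exact ⟨k, z, h⟩
    have : Nonempty Kind := ⟨.token⟩
    have : Nonempty (Fin n) := ⟨r⟩
    choose! k z hkz using hsome
    have hp := fun v hv => ((hmatch v).proceed t (net.label v)).1 (k v) (z v) (hkz v hv)
    have hframe : ∀ v ∈ act, (s₁ v).SameFrame (firstState t (S v)) := by
      intro v hv
      rw [hact v hv]
      exact (hp v hv).2.2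
    have hout : ∀ v c, (firstState t (S v)).out = some c → v ∈ act ∧
        c = ⟨k v, net.label v, net.label v, net.label (z v)⟩ := by
      intro v c hc
      by_cases hv : v ∈ act
      · refine ⟨hv, ?_⟩
        rw [hact v hv, (hp v hv).2.1] at hc
        rw [← Option.some.inj hc]
        simp [hs₁, join, hlabel]
      · rw [hinact v hv, hS] at hc
        cases hc
    have htok : ∀ v ∈ act, (firstState t (S v)).tok = some (net.label v) := by
      intro v hv
      rw [(hframe v hv).tok]
      simp [hs₁, join, hlabel]
    have htok' : ∀ v, v ∉ act → (firstState t (S v)).tok = none := by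
      intro v hv
      rw [hinact v hv, hS]
      rfl
    have hnb' : ∀ v, (firstState t (S v)).nbrs = (nb v).map net.label := by
      intro v
      by_cases hv : v ∈ act
      · rw [(hframe v hv).nbrs]
        exact hnbrs v
      · rw [hinact v hv, hnbrs]
    refine ⟨?_, ?_, fun v => (hnb' v).trans (hnb v).1.symm, ?_, ?_, ?_, ?_, htok r hr, ?_, ?_⟩
    · intro v
      by_cases hv : v ∈ act
      · have hf := hframe v hv
        exact ⟨hf.inbox.trans (hsearch v).inbox, hf.acks.trans (hsearch v).acks,
          hf.wout.trans (hsearch v).wout, hf.deadline.trans (hsearch v).deadline,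
          hf.halted.trans (hsearch v).halted⟩
      · rw [hinact v hv]
        exact hsearch v
    · intro v
      by_cases hv : v ∈ act
      · exact (hframe v hv).label.trans (hlabel v)
      · rw [hinact v hv, hlabel]
    · intro y
      refine le_trans (card_le_card ?_) (hdens y)
      intro v hv
      simp only [mem_filter, mem_univ, true_and] at hv ⊢
      obtain ⟨c, hc⟩ := Option.isSome_iff_exists.1 hv.1
      exact ⟨(hout v c hc).1, hv.2⟩
    · intro v c hc
      obtain ⟨hv, rfl⟩ := hout v c hc
      exact htok v hv
    · intro v w c d hc hd ht
      obtain ⟨-, rfl⟩ := hout v c hc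
      obtain ⟨-, rfl⟩ := hout w d hd
      exact net.label_injective ht
    · intro v τ hτ
      by_cases hv : v ∈ act
      · rw [htok v hv] at hτ
        rw [← Option.some.inj hτ]
        exact hmin v hv
      · rw [htok' v hv] at hτ
        cases hτ
    · intro v c hc
      obtain ⟨hv, rfl⟩ := hout v c hc
      obtain ⟨T, hT⟩ := hhold v
      set g' := Function.update (core v) v (core v v).proceed.1 with hg'
      have hg'u : ∀ u, u ≠ v → g' u = core v u := fun u hu => Function.update_of_ne hu _ _
      have hg'v : g' v = (core v v).proceed.1 := Function.update_self _ _ _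
      refine ⟨v, g', z v, rfl, rfl, rfl, (hT.result hG hg'u hg'v).1 _ _ (hkz v hv), ?_, ?_⟩
      · intro u _
        by_cases hu : u = v
        · subst hu
          rw [State.view, if_pos (htok u hv), hg'v, hact u hv]
          exact (hp u hv).1
        · have hne : (firstState t (S u)).tok ≠ some (net.label v) := by
            by_cases hua : u ∈ act
            · rw [htok u hua]
              exact fun h => hu (net.label_injective (Option.some.inj h))
            · rw [htok' u hua]
              simp
          rw [State.view, if_neg hne, hg'u u hu, hcu v u hu]
          refine ⟨rfl, rfl, ?_, rfl, rfl⟩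
          simp only [join, hnb']
          rw [List.map_erase net.label_injective]
      · intro hne
        have hrv : r ≠ v := fun h => hne (by rw [h])
        rw [hg'u r hrv, hcu v r hrv]
    · have hsm := (hp r hr).2.1
      rw [← hact r hr] at hsm
      exact ⟨r, _, hsm, rfl⟩

end Network

/-! ### Eulerian walks -/

namespace BTD

/-- The station takes part neither in the search nor in the election. -/
structure State.Idle (s : State) : Prop where
  inbox : s.inbox = []
  acks : s.acks = []
  out : s.out = none
  halted : s.halted = false
  tok : s.tok.isSome

/-- Executions of Smallest_Token formally go on during the walks, so it must be known that their
ends change nothing. -/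
theorem State.Idle.finish {s : State} (h : s.Idle) (t : ℕ) : BTD.finish t s = s := by
  obtain ⟨h1, h2, h3, h4, h5⟩ := h
  obtain ⟨τ, h6⟩ := Option.isSome_iff_exists.1 h5
  clear h5
  cases s
  simp only at h1 h2 h3 h4 h6
  subst h1 h2 h3 h4 h6
  simp [BTD.finish]

theorem State.Idle.continueSync {s : State} (h : s.Idle) (m k : ℕ) :
    (BTD.continueSync m k s).Idle := by
  obtain ⟨h1, h2, h3, h4, h5⟩ := h
  unfold BTD.continueSync
  split <;> exact ⟨h1, h2, h3, h4, h5⟩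

theorem State.Idle.continueCount {s : State} (h : s.Idle) (t c : ℕ) :
    (BTD.continueCount t c s).Idle := by
  unfold BTD.continueCount
  split
  · exact ⟨h.1, h.2, h.3, h.4, h.5⟩
  · exact ⟨h.1, h.2, h.3, h.4, h.5⟩
  · exact State.Idle.continueSync (s := { s with rem := s.children, deadline := _ })
      ⟨h.1, h.2, h.3, h.4, h.5⟩ _ _

theorem State.Idle.receiveWalk {s : State} (h : s.Idle) (t : ℕ) (μ : Msg) :
    (BTD.receiveWalk t μ s).Idle := by
  unfold BTD.receiveWalk
  split
  · split_ifs
    · exact State.Idle.continueCount (s := { s with rem := s.children })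
        ⟨h.1, h.2, h.3, h.4, h.5⟩ _ _
    · exact h.continueCount _ _
    · exact h
  · split_ifs
    · exact State.Idle.continueSync (s := { s with rem := s.children, deadline := _ })
        ⟨h.1, h.2, h.3, h.4, h.5⟩ _ _
    · exact h.continueSync _ _
    · exact h
  · exact h

/-- An Eulerian walk along a tree, that has discovered the nodes of `D` in `k` rounds, is at the
node `w` with the list `path` of ancestors; `rem u` consists of the children that `u` still has to
visit. -/
structure Walk {V : Type*} [DecidableEq V] (par : V → Option V) (r w : V) (path : List V)
    (rem : V → List V) (D : Finset V) (k : ℕ) : Prop where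
  ancestors : IsAncestorList par w path
  path_sub : ∀ u ∈ w :: path, u ∈ D
  rem_spec : ∀ u ∈ D, ∀ z ∈ rem u, par z = some u ∧ z ∉ D
  rem_nodup : ∀ u ∈ D, (rem u).Nodup
  closed : ∀ z u, par z = some u → u ∈ D → z ∈ D ∨ z ∈ rem u
  up : ∀ z u, par z = some u → z ∈ D → u ∈ D
  rem_eq_nil : ∀ u ∈ D, u ∉ w :: path → rem u = []
  root_mem : r ∈ D
  count : k + path.length + 2 = 2 * #D

section Walk

variable {V : Type*} [DecidableEq V] {par : V → Option V} {ch : V → List V} {r w : V}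
  {path : List V} {rem : V → List V} {D : Finset V} {k : ℕ}

theorem walk_init (hr : par r = none) (hch : ∀ v, (ch v).Nodup)
    (hmem : ∀ v z, z ∈ ch v ↔ par z = some v) : Walk par r r [] ch {r} 0 where
  ancestors := hr
  path_sub := by simp
  rem_spec := by
    intro u _ z hz
    refine ⟨(hmem u z).1 hz, ?_⟩
    rw [mem_singleton]
    rintro rfl
    rw [hmem, hr] at hz
    cases hz
  rem_nodup u _ := hch u
  closed z u hz _ := Or.inr ((hmem u z).2 hz)
  up z u hz hzD := by
    rw [mem_singleton] at hzD
    rw [hzD, hr] at hz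
    cases hz
  rem_eq_nil := by simp
  root_mem := by simp
  count := by simp

/-- Asymmetry of the parent map excludes that `z` is its own child. In the count, round number, path
length and number of discovered nodes all grow by one. -/
theorem Walk.down (h : Walk par r w path rem D k) (hch : ∀ v, (ch v).Nodup)
    (hmem : ∀ v z, z ∈ ch v ↔ par z = some v) (hasymm : ∀ z u, par z = some u → par u ≠ some z)
    {z : V} {rest : List V} (hz : rem w = z :: rest) :
    Walk par r z (w :: path) (Function.update (Function.update rem w rest) z (ch z))
      (insert z D) (k + 1) := by
  have hwD : w ∈ D := h.path_sub w (by simp)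
  obtain ⟨hzw, hzD⟩ := h.rem_spec w hwD z (by simp [hz])
  have hzne : z ≠ w := by rintro rfl; exact hzD hwD
  have hzrest : z ∉ rest ∧ rest.Nodup := by
    have := h.rem_nodup w hwD
    rw [hz] at this
    exact List.nodup_cons.1 this
  have e0 : Function.update (Function.update rem w rest) z (ch z) z = ch z := by simp
  have ew : Function.update (Function.update rem w rest) z (ch z) w = rest := by simp [hzne.symm]
  have eo : ∀ u, u ≠ z → u ≠ w →
      Function.update (Function.update rem w rest) z (ch z) u = rem u := by
    intro u hu hu'; simp [hu, hu']
  refine ⟨⟨hzw, h.ancestors⟩, ?_, ?_, ?_, ?_, ?_, ?_, mem_insert_of_mem h.root_mem, ?_⟩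
  · intro u hu
    rcases List.mem_cons.1 hu with rfl | hu
    · exact mem_insert_self _ _
    · exact mem_insert_of_mem (h.path_sub u hu)
  · intro u hu x hx
    by_cases huz : u = z
    · subst huz
      rw [e0, hmem] at hx
      refine ⟨hx, ?_⟩
      rw [mem_insert, not_or]
      refine ⟨?_, fun hxD => hzD (h.up x u hx hxD)⟩
      rintro rfl
      exact hasymm _ _ hx hx
    · have huD := mem_of_mem_insert_of_ne hu huz
      by_cases huw : u = w
      · subst huw
        rw [ew] at hx
        obtain ⟨h1, h2⟩ := h.rem_spec u huD x (by simp [hz, hx])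
        refine ⟨h1, ?_⟩
        rw [mem_insert, not_or]
        refine ⟨?_, h2⟩
        rintro rfl
        exact hzrest.1 hx
      · rw [eo u huz huw] at hx
        obtain ⟨h1, h2⟩ := h.rem_spec u huD x hx
        refine ⟨h1, ?_⟩
        rw [mem_insert, not_or]
        refine ⟨?_, h2⟩
        rintro rfl
        exact huw (Option.some.inj (h1.symm.trans hzw))
  · intro u hu
    by_cases huz : u = z
    · rw [huz, e0]
      exact hch z
    · by_cases huw : u = w
      · rw [huw, ew]
        exact hzrest.2
      · rw [eo u huz huw]
        exact h.rem_nodup u (mem_of_mem_insert_of_ne hu huz)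
  · intro x u hx hu
    by_cases huz : u = z
    · subst huz
      rw [e0]
      exact Or.inr ((hmem _ _).2 hx)
    · rcases h.closed x u hx (mem_of_mem_insert_of_ne hu huz) with h' | h'
      · exact Or.inl (mem_insert_of_mem h')
      · by_cases huw : u = w
        · subst huw
          rw [hz] at h'
          rcases List.mem_cons.1 h' with rfl | h'
          · exact Or.inl (mem_insert_self _ _)
          · rw [ew]
            exact Or.inr h'
        · rw [eo u huz huw]
          exact Or.inr h'
  · intro x u hx hxD
    rcases mem_insert.1 hxD with rfl | hxD
    · obtain rfl := Option.some.inj (hx.symm.trans hzw)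
      exact mem_insert_of_mem hwD
    · exact mem_insert_of_mem (h.up x u hx hxD)
  · intro u hu hup
    simp only [List.mem_cons, not_or] at hup
    rw [eo u hup.1 hup.2.1]
    exact h.rem_eq_nil u (mem_of_mem_insert_of_ne hu hup.1) (by simp [hup])
  · have := h.count
    rw [card_insert_of_notMem hzD, List.length_cons]
    omega

theorem Walk.back {q : V} (h : Walk par r w (q :: path) rem D k) (hw : rem w = []) :
    Walk par r q path rem D (k + 1) := by
  refine ⟨h.ancestors.2, fun u hu => h.path_sub u (List.mem_cons_of_mem _ hu), h.rem_spec,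
    h.rem_nodup, h.closed, h.up, ?_, h.root_mem, ?_⟩
  · intro u hu hup
    by_cases huw : u = w
    · rw [huw, hw]
    · exact h.rem_eq_nil u hu (by simp_all)
  · have := h.count
    rw [List.length_cons] at this
    omega

variable [Fintype V]

/-- The walk ends when all nodes have been discovered. -/
theorem Walk.finished (h : Walk par r w path rem D k)
    (hind : ∀ P : V → Prop, P r → (∀ z u, par z = some u → P u → P z) → ∀ z, P z)
    (hw : rem w = []) (hpath : path = []) : k = 2 * Fintype.card V - 2 := by
  subst hpath
  have hD : D = univ := by
    refine eq_univ_of_forall (hind (· ∈ D) h.root_mem fun z u hz hu => ?_)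
    rcases h.closed z u hz hu with h' | h'
    · exact h'
    · have : rem u = [] := by
        by_cases huw : u = w
        · rw [huw, hw]
        · exact h.rem_eq_nil u hu (by simpa using huw)
      rw [this] at h'
      cases h'
  have := h.count
  rw [hD, card_univ, List.length_nil] at this
  omega

/-- The count forces #D = |V| and an empty path at the same time. -/
theorem Walk.of_last (h : Walk par r w path rem D k) (hk : k = 2 * Fintype.card V - 2) :
    path = [] ∧ D = univ ∧ rem w = [] := by
  have h1 := h.count
  have h2 := card_le_univ D
  have h3 : 0 < #D := card_pos.2 ⟨_, h.root_mem⟩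
  have hpath : path = [] := List.length_eq_zero_iff.1 (by omega)
  have hD : D = univ := (card_eq_iff_eq_univ D).1 (by omega)
  refine ⟨hpath, hD, ?_⟩
  rw [List.eq_nil_iff_forall_not_mem]
  intro z hz
  exact (h.rem_spec w (h.path_sub w (by simp)) z hz).2 (by simp [hD])

end Walk

end BTD

namespace Network

open BTD

variable {n N : ℕ} {net : Network n N} {p : SINRParams} {E F : List (Finset ℕ)}
  {K : Finset (Fin n)}

/-- A round in which a single station `w` sends a message, of an Eulerian walk, to `x`. -/
theorem run_walk_round {T : ℕ} (hT : E.length < T) {Z : Fin n → State}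
    (hrun : net.run p (traversals E F) K T = Z) (hidle : ∀ u, (Z u).Idle)
    {w x : Fin n} {μ : Msg} (hw : (Z w).wout = some μ) (ho : ∀ u, u ≠ w → (Z u).wout = none)
    (hadj : (net.commGraph p).Adj w x) (hμ : ∀ s, receive T (some μ) s = receiveWalk T μ s)
    (hμ' : ∀ u, u ≠ x → ∀ o, receiveWalk T μ { Z u with wout := o } = { Z u with wout := o })
    (u : Fin n) : net.run p (traversals E F) K (T + 1) u =
      terminate T (if u = x then receiveWalk T μ (Z x) else { Z u with wout := none }) := by
  have h1 : ¬ T < E.length := by omega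
  have h2 : T ≠ E.length := by omega
  have hsend : (fun v => (traversals E F).send T (net.run p (traversals E F) K T v)) =
      fun v => if v = w then some μ else none := by
    funext v
    rw [hrun]
    have hi := hidle v
    by_cases hv : v = w
    · subst hv
      simp [traversals, hi.halted, h1, h2, hw]
    -- An idle station has neither a control message nor anything to announce, so `w` transmits
    -- alone and its neighbours hear it without interference.
    · simp [traversals, hi.halted, h1, h2, ho v hv, hv, hi.out, addressed, hi.inbox]
  have hheard : net.heard p (fun v => if v = w then some μ else none) u =
      if u = x then some μ else net.heard p (fun v => if v = w then some μ else none) u := by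
    split_ifs with hu
    · rw [net.heard_eq_some_iff]
      refine ⟨w, ?_, if_pos rfl⟩
      have hset : ({v | (if v = w then some μ else none).isSome} : Finset (Fin n)) = {w} := by
        ext v
        simp only [mem_filter, mem_univ, true_and, mem_singleton]
        split_ifs with hv <;> simp [hv]
      rw [hset, net.receives_singleton_iff]
      exact ⟨rfl, hu ▸ hadj⟩
    · rfl
  have hidle' : ({ Z u with wout := none } : State).Idle :=
    ⟨(hidle u).1, (hidle u).2, (hidle u).3, (hidle u).4, (hidle u).5⟩
  have hrec : receive T (net.heard p (fun v => if v = w then some μ else none) u)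
      { Z u with wout := none } =
        if u = x then receiveWalk T μ (Z x) else { Z u with wout := none } := by
    rw [hheard]
    split_ifs with hu
    · subst hu
      rw [hμ]
      congr 1
      have := ho u hadj.ne.symm
      cases hz : Z u
      simp_all
    · cases hr : net.heard p (fun v => if v = w then some μ else none) u with
      | none => rfl
      | some y =>
        obtain ⟨v, -, hv⟩ := (net.heard_eq_some_iff p).1 hr
        split_ifs at hv
        obtain rfl := Option.some.inj hv
        rw [hμ, hμ' u hu]
  have hfin : (if u = x then receiveWalk T μ (Z x) else { Z u with wout := none } : State).Idle := by
    split_ifs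
    · exact (hidle x).receiveWalk _ _
    · exact hidle'
  have hnext : ∀ y, (traversals E F).next T (Z u) y =
      terminate T (if (T - (E.length + 1)) % (2 * F.length) = 2 * F.length - 1 then
        finish T (receive T y { Z u with wout := none })
        else receive T y { Z u with wout := none }) := by
    intro y
    simp only [traversals, if_neg h1, if_neg h2]
    rw [if_neg (by simp [(hidle u).halted])]
  rw [run_succ, hsend, hrun, hnext, hrec, hfin.finish, ite_self]

end Network

/-! ### The third stage -/

namespace BTD

/-- The station passes the token of an Eulerian walk on, the message from `v` to `w` being
`μ v w`. -/
def State.pass (μ : ℕ → ℕ → Msg) (s : State) : State :=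
  match s.rem, s.parent with
  | z :: rest, _ => { s with rem := rest, wout := some (μ s.label z) }
  | [], some q => { s with wout := some (μ s.label q) }
  | [], none => s

/-- The station meets an Eulerian walk for the first time. -/
def State.enter (dl : Option ℕ) (s : State) : State :=
  { s with rem := s.children, deadline := dl }

theorem State.Idle.pass {s : State} (h : s.Idle) (μ : ℕ → ℕ → Msg) : (s.pass μ).Idle := by
  unfold State.pass
  split <;> exact ⟨h.1, h.2, h.3, h.4, h.5⟩

theorem State.Idle.enter {s : State} (h : s.Idle) (dl : Option ℕ) : (s.enter dl).Idle :=
  ⟨h.1, h.2, h.3, h.4, h.5⟩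

theorem State.pass_of_rem_eq_cons {s : State} {z : ℕ} {rest : List ℕ} (h : s.rem = z :: rest)
    (μ : ℕ → ℕ → Msg) : s.pass μ = { s with rem := rest, wout := some (μ s.label z) } := by
  cases s
  simp only at h
  subst h
  rfl

theorem State.pass_of_parent_eq_some {s : State} {q : ℕ} (h : s.rem = []) (hq : s.parent = some q)
    (μ : ℕ → ℕ → Msg) : s.pass μ = { s with wout := some (μ s.label q) } := by
  cases s
  simp only at h hq
  subst h hq
  rfl

theorem State.with_wout {s : State} (h : s.wout = none) : { s with wout := none } = s := by
  cases s
  simp only at h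
  subst h
  rfl

theorem terminate_eq_self {t : ℕ} {s : State} (h : ∀ d, s.deadline = some d → t < d) :
    terminate t s = s := by
  unfold terminate
  split
  · rename_i d hd
    rw [if_neg (h d hd).not_ge]
  · rfl

theorem continueSync_eq_pass (m k : ℕ) (s : State) :
    continueSync m k s = s.pass (.sync m (k + 1)) := rfl

theorem continueCount_eq_pass {t c : ℕ} {s : State} (h : s.rem ≠ [] ∨ s.parent ≠ none) :
    continueCount t c s = s.pass (.count c) := by
  cases hr : s.rem with
  | cons z rest =>
    rw [State.pass_of_rem_eq_cons hr]
    cases s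
    simp only at hr
    subst hr
    rfl
  | nil =>
    cases hp : s.parent with
    | some q =>
      rw [State.pass_of_parent_eq_some hr hp]
      cases s
      simp only at hr hp
      subst hr hp
      rfl
    | none => simp [hr, hp] at h

end BTD

namespace Network

open BTD

variable {n N : ℕ} {net : Network n N} {p : SINRParams} {E F : List (Finset ℕ)}
  {K : Finset (Fin n)}

/-- A spanning tree of the communication graph, in which `ch v` is the list of the children
of `v`. -/
structure IsSpanning (net : Network n N) (p : SINRParams) (r : Fin n)
    (par : Fin n → Option (Fin n)) (ch : Fin n → List (Fin n)) : Prop where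
  root : par r = none
  nodup : ∀ v, (ch v).Nodup
  mem : ∀ v z, z ∈ ch v ↔ par z = some v
  asymm : ∀ z u, par z = some u → par u ≠ some z
  adj : ∀ z u, par z = some u → (net.commGraph p).Adj u z
  induct : ∀ P : Fin n → Prop, P r → (∀ z u, par z = some u → P u → P z) → ∀ z, P z

/-- The local states during an Eulerian walk that is at the node `w`, where the stations that have
met the walk have the deadline `dl`. -/
structure WalkAt (net : Network n N) (par : Fin n → Option (Fin n)) (ch : Fin n → List (Fin n))
    (r w : Fin n) (path : List (Fin n)) (rem : Fin n → List (Fin n)) (D : Finset (Fin n)) (k : ℕ)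
    (dl : Option ℕ) (X : Fin n → State) : Prop where
  walk : Walk par r w path rem D k
  idle : ∀ u, (X u).Idle
  wout : ∀ u, (X u).wout = none
  label : ∀ u, (X u).label = net.label u
  parent : ∀ u, (X u).parent = (par u).map net.label
  children : ∀ u, (X u).children = (ch u).map net.label
  rem : ∀ u ∈ D, (X u).rem = (rem u).map net.label
  deadline : ∀ u, (X u).deadline = if u ∈ D then dl else none

variable {r : Fin n} {par : Fin n → Option (Fin n)} {ch : Fin n → List (Fin n)}

/-- A round of an Eulerian walk. -/
theorem WalkAt.step (hS : net.IsSpanning p r par ch) {w : Fin n} {path : List (Fin n)}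
    {rem : Fin n → List (Fin n)} {D : Finset (Fin n)} {k : ℕ} {dl : Option ℕ} {X : Fin n → State}
    (h : net.WalkAt par ch r w path rem D k dl X) (hk : k < 2 * n - 2) {T : ℕ}
    (hT : E.length < T) {μ : ℕ → ℕ → Msg} {f : ℕ → State → State}
    (hrun : net.run p (traversals E F) K T = fun u => if u = w then (X w).pass μ else X u)
    (hμ : ∀ v x s, receive T (some (μ v x)) s = receiveWalk T (μ v x) s)
    (hne : ∀ v x s, s.label ≠ x → receiveWalk T (μ v x) s = s)
    (hpar : ∀ v s, s.parent = some v → s.deadline = none →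
      receiveWalk T (μ v s.label) s = f (#D + 1) (s.enter dl))
    (hback : ∀ v s, s.parent ≠ some v → receiveWalk T (μ v s.label) s = f #D s) :
    ∃ w' path' rem' D' X', net.WalkAt par ch r w' path' rem' D' (k + 1) dl X' ∧
      ∀ u, net.run p (traversals E F) K (T + 1) u =
        terminate T (if u = w' then f #D' (X' w') else X' u) := by
  have hwD : w ∈ D := h.walk.path_sub w (by simp)
  have hround : ∀ x, (net.commGraph p).Adj w x →
      ((X w).pass μ).wout = some (μ (net.label w) (net.label x)) → ∀ u,
      net.run p (traversals E F) K (T + 1) u = terminate T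
        (if u = x then receiveWalk T (μ (net.label w) (net.label x)) (X x)
          else if u = w then { (X w).pass μ with wout := none } else X u) := by
    intro x hx hout u
    have hidle : ∀ u, (if u = w then (X w).pass μ else X u).Idle := by
      intro u
      split_ifs
      · exact (h.idle w).pass μ
      · exact h.idle u
    rw [run_walk_round hT hrun hidle (w := w) (x := x) (by simpa using hout)
      (fun u hu => by simp [hu, h.wout u]) hx (hμ _ _) ?_ u]
    · congr 1
      rw [if_neg hx.ne.symm]
      split_ifs with h1 h2
      · rfl
      · rfl
      · exact State.with_wout (h.wout u)
    · intro u hu o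
      refine hne _ _ _ ?_
      have hl : (if u = w then (X w).pass μ else X u).label = net.label u := by
        split_ifs with huw
        · rw [huw, ← h.label w]
          unfold State.pass
          split <;> rfl
        · exact h.label u
      show (if u = w then (X w).pass μ else X u).label ≠ _
      rw [hl]
      exact fun he => hu (net.label_injective he)
  cases hrem : rem w with
  | cons z rest =>
    obtain ⟨hzw, hzD⟩ := h.walk.rem_spec w hwD z (by simp [hrem])
    have hadj := hS.adj z w hzw
    have hXrem : (X w).rem = net.label z :: rest.map net.label := by rw [h.rem w hwD, hrem]; rfl
    have hpass := State.pass_of_rem_eq_cons hXrem μ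
    have hzdl : (X z).deadline = none := by rw [h.deadline, if_neg hzD]
    have hwalk := h.walk.down hS.nodup hS.mem hS.asymm hrem
    have hwz : w ≠ z := hadj.ne
    refine ⟨z, w :: path, _, insert z D,
      fun u => if u = z then (X z).enter dl
        else if u = w then { X w with rem := rest.map net.label } else X u,
      ⟨hwalk, ?_, ?_, ?_, ?_, ?_, ?_, ?_⟩, ?_⟩
    · intro u
      split_ifs
      · exact (h.idle z).enter dl
      · exact ⟨(h.idle w).1, (h.idle w).2, (h.idle w).3, (h.idle w).4, (h.idle w).5⟩
      · exact h.idle u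
    · intro u
      split_ifs
      · exact h.wout z
      · exact h.wout w
      · exact h.wout u
    · intro u
      split_ifs with h1 h2
      · exact h1 ▸ h.label z
      · exact h2 ▸ h.label w
      · exact h.label u
    · intro u
      split_ifs with h1 h2
      · exact h1 ▸ h.parent z
      · exact h2 ▸ h.parent w
      · exact h.parent u
    · intro u
      split_ifs with h1 h2
      · exact h1 ▸ h.children z
      · exact h2 ▸ h.children w
      · exact h.children u
    · intro u hu
      split_ifs with h1 h2
      · subst h1
        simp [State.enter, h.children]
      · subst h2
        simp [h1]
      · simp only [ne_eq, h1, not_false_eq_true, Function.update_of_ne, h2]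
        exact h.rem u (mem_of_mem_insert_of_ne hu h1)
    · intro u
      split_ifs with h1 h2 h3 h4
      · rfl
      · simp [h1] at h2
      · simp [h.deadline, hwD]
      · exact absurd (h3 ▸ mem_insert_of_mem hwD) h4
      · rw [h.deadline, if_pos (mem_of_mem_insert_of_ne ‹_› h1)]
      · rw [h.deadline, if_neg fun hu => ‹u ∉ insert z D› (mem_insert_of_mem hu)]
    · intro u
      rw [hround z hadj (by rw [hpass, h.label]) u, card_insert_of_notMem hzD]
      congr 1
      split_ifs with h1 h2
      · rw [← h.label z, hpar _ _ (by rw [h.parent, hzw]; rfl) hzdl]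
        simp
      · rw [hpass]
        have := h.wout w
        simp [this, h2, hwz]
      · simp [h1, h2]
  | nil =>
    -- At the root with no child left the walk would be over, against `hk`; so the token goes back
    -- to a parent.
    cases path with
    | nil =>
      have := h.walk.finished hS.induct hrem rfl
      rw [Fintype.card_fin] at this
      omega
    | cons q path =>
      have hq : par w = some q := h.walk.ancestors.1
      have hadj := (hS.adj w q hq).symm
      have hXrem : (X w).rem = [] := by rw [h.rem w hwD, hrem]; rfl
      have hpass := State.pass_of_parent_eq_some hXrem (by rw [h.parent, hq]; rfl) μ
      refine ⟨q, path, rem, D, X, ⟨h.walk.back hrem, h.idle, h.wout, h.label, h.parent, h.children,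
        h.rem, h.deadline⟩, ?_⟩
      intro u
      rw [hround q hadj (by rw [hpass, h.label]) u]
      congr 1
      split_ifs with h1 h2
      · rw [← h.label q, hback]
        rw [h.parent]
        intro he
        obtain ⟨x, hx, hxw⟩ := Option.map_eq_some_iff.1 he
        obtain rfl := net.label_injective hxw
        exact hS.asymm _ _ hq hx
      · rw [hpass, h2]
        have := h.wout w
        cases hXw : X w
        simp_all
      · rfl

/-- An Eulerian walk along a spanning tree, until it has returned to the root. -/
theorem exists_walkAt (hS : net.IsSpanning p r par ch) {dl : Option ℕ} {t₀ : ℕ}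
    -- Both walks are instances: `μ k c` is the message sent after k rounds with c discovered nodes,
    -- and `f k c` is the action of a station that has the token at that time.
    (ht₀ : E.length ≤ t₀) {μ : ℕ → ℕ → ℕ → ℕ → Msg} {f : ℕ → ℕ → State → State}
    (hpass : ∀ k c s, s.rem ≠ [] ∨ s.parent ≠ none → f k c s = s.pass (μ k c))
    (hμ : ∀ t k c v x s, receive t (some (μ k c v x)) s = receiveWalk t (μ k c v x) s)
    (hne : ∀ t k c v x s, s.label ≠ x → receiveWalk t (μ k c v x) s = s)
    (hpar : ∀ k c v s, k < 2 * n - 2 → s.parent = some v → s.deadline = none →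
      receiveWalk (t₀ + k + 1) (μ k c v s.label) s = f (k + 1) (c + 1) (s.enter dl))
    (hback : ∀ k c v s, s.parent ≠ some v →
      receiveWalk (t₀ + k + 1) (μ k c v s.label) s = f (k + 1) c s)
    (hdl : ∀ d, dl = some d → t₀ + (2 * n - 2) ≤ d) {X₀ : Fin n → State}
    (h₀ : net.WalkAt par ch r r [] ch {r} 0 dl X₀)
    (hhalt : ∀ u, (net.run p (traversals E F) K t₀ u).halted = false)
    (hrun : ∀ u, net.run p (traversals E F) K (t₀ + 1) u =
      terminate t₀ (if u = r then f 0 1 (X₀ r) else X₀ u)) {k : ℕ} (hk : k ≤ 2 * n - 2) :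
    (∀ u, (net.run p (traversals E F) K (t₀ + k) u).halted = false) ∧
      ∃ w path rem D X, net.WalkAt par ch r w path rem D k dl X ∧
        ∀ u, net.run p (traversals E F) K (t₀ + k + 1) u =
          terminate (t₀ + k) (if u = w then f k #D (X w) else X u) := by
  induction k with
  | zero => exact ⟨hhalt, r, [], ch, {r}, X₀, h₀, hrun⟩
  | succ k ih =>
    obtain ⟨-, w, path, rem, D, X, hX, hXrun⟩ := ih (by omega)
    have hwD : w ∈ D := hX.walk.path_sub w (by simp)
    -- Before round 2n - 2 the walk is not finished, so the station at which it is has a child left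
    -- or a parent.
    have hcont : f k #D (X w) = (X w).pass (μ k #D) := by
      refine hpass _ _ _ ?_
      by_contra! hcon
      have h1 : rem w = [] := by
        have := hX.rem w hwD
        rw [hcon.1] at this
        exact List.map_eq_nil_iff.1 this.symm
      have h2 : par w = none := by
        have := hX.parent w
        rw [hcon.2] at this
        exact Option.map_eq_none_iff.1 this.symm
      have h3 : path = [] := by
        cases path with
        | nil => rfl
        | cons q path => simp [hX.walk.ancestors.1] at h2
      have := hX.walk.finished hS.induct h1 h3
      rw [Fintype.card_fin] at this
      omega
    have hdead : ∀ u d, (X u).deadline = some d → t₀ + k < d := by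
      intro u d hd
      rw [hX.deadline] at hd
      split_ifs at hd
      have := hdl d hd
      omega
    have hrun' : net.run p (traversals E F) K (t₀ + k + 1) =
        fun u => if u = w then (X w).pass (μ k #D) else X u := by
      funext u
      rw [hXrun u, hcont]
      refine terminate_eq_self fun d hd => ?_
      split_ifs at hd
      · refine hdead w d ?_
        rw [← hd]
        unfold State.pass
        split <;> rfl
      · exact hdead u d hd
    refine ⟨fun u => ?_, hX.step hS (by omega) (by omega) hrun' (hμ _ _ _) (hne _ _ _) ?_ ?_⟩
    · rw [← add_assoc, hrun']
      show (if u = w then (X w).pass (μ k #D) else X u).halted = false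
      split_ifs
      · exact ((hX.idle w).pass _).halted
      · exact (hX.idle u).halted
    · exact fun v s hv hd => hpar k _ v s (by omega) hv hd
    · exact fun v s hv => hback k _ v s hv

/-- The third stage: the first walk counts the nodes, and the second one informs them about the
round in which it ends. All nodes terminate in this round. -/
theorem Completed.halted {t₀ : ℕ} (ht₀ : E.length ≤ t₀) {Y X : Fin n → State}
    (h : net.Completed p r t₀ par ch Y X)
    (hhalt : ∀ u, (net.run p (traversals E F) K t₀ u).halted = false)
    (hrun : ∀ u, net.run p (traversals E F) K (t₀ + 1) u = terminate t₀ (X u)) (u : Fin n) :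
    (net.run p (traversals E F) K (t₀ + 2 * (2 * n - 2)) u).halted = false ∧
      (net.run p (traversals E F) K (t₀ + 2 * (2 * n - 2) + 1) u).halted = true ∧
      (net.run p (traversals E F) K (t₀ + 2 * (2 * n - 2) + 1) u).parent =
        (par u).map net.label ∧
      (net.run p (traversals E F) K (t₀ + 2 * (2 * n - 2) + 1) u).children =
        (ch u).map net.label := by
  have hv := BTDSearch.valid_of_reflTransGen h.search
  have hS : net.IsSpanning p r par ch := ⟨hv.root_parent, h.nodup, h.mem_children, hv.asymm,
    fun z u hz => (hv.parent_mem z u hz).2.2.2, fun P h1 h2 z => hv.induct P h1 h2 z (Set.mem_univ z)⟩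
  have hYidle : ∀ u, (Y u).Idle := fun u => ⟨(h.searching u).inbox, (h.searching u).acks, h.out u,
    (h.searching u).halted, by rw [h.tok]; rfl⟩
  have hcard : Fintype.card (Fin n) = n := Fintype.card_fin n
  have hwalk₀ : Walk par r r [] ch {r} 0 := walk_init hS.root hS.nodup hS.mem
  obtain ⟨hhalt₁, w, path, rem, D, X₁, hX₁, hrun₁⟩ := exists_walkAt (E := E) (F := F) (K := K) hS
    (dl := none) ht₀ (μ := fun _ => .count) (f := fun k => continueCount (t₀ + k))
    (fun k c s hs => continueCount_eq_pass hs) (fun _ _ _ _ _ _ => rfl)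
    (fun t k c v x s hs => if_neg hs.symm)
    (fun k c v s _ h1 h2 => by
      simp only [receiveWalk, if_true, if_pos h1, State.enter, add_assoc]
      congr 1
      cases s
      simp_all)
    (fun k c v s h1 => by simp only [receiveWalk, if_true, if_neg h1, add_assoc])
    (by simp) (X₀ := fun u => if u = r then (Y r).enter none else Y u)
    ⟨hwalk₀, fun u => by split_ifs; exacts [(hYidle r).enter none, hYidle u],
      fun u => by split_ifs; exacts [(h.searching r).wout, (h.searching u).wout],
      fun u => by split_ifs with hu; exacts [hu ▸ h.label r, h.label u],
      fun u => by split_ifs with hu; exacts [hu ▸ h.parent r, h.parent u],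
      fun u => by split_ifs with hu; exacts [hu ▸ h.children r, h.children u],
      fun u hu => by
        rw [mem_singleton.1 hu, if_pos rfl]
        exact h.children r,
      fun u => by
        have := (h.searching u).deadline
        split_ifs <;> simp_all [State.enter]⟩ hhalt
    (fun u => by
      rw [hrun u]
      congr 1
      by_cases hu : u = r
      · subst hu
        have := (h.searching u).deadline
        rw [h.root]
        simp only [startCount, State.enter, if_true, add_zero]
        congr 1
        cases hYu : Y u
        simp_all
      · simp [hu, h.other u hu]) le_rfl
  obtain ⟨hpath, hD, hrem⟩ := hX₁.walk.of_last (by rw [hcard])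
  subst hpath hD
  have hroot : ∀ z, par z = none → z = r := fun z => eq_root_of_parent_eq_none h.search
  obtain rfl : w = r := hroot w hX₁.walk.ancestors
  have hparent : (X₁ w).parent = none := by rw [hX₁.parent, hS.root]; rfl
  -- Back at the root, the first walk has counted all n nodes and turns into the second one within
  -- the same state change.
  have hstart : continueCount (t₀ + (2 * n - 2)) #(univ : Finset (Fin n)) (X₁ w) =
      continueSync n 0 ((X₁ w).enter (some (t₀ + (2 * n - 2) + (2 * n - 2)))) := by
    have := hX₁.rem w (mem_univ w)
    rw [hrem, List.map_nil] at this
    rw [card_univ, hcard]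
    unfold continueCount
    split <;> simp_all [startSync, State.enter]
  set t₁ := t₀ + (2 * n - 2) with ht₁
  obtain ⟨hhalt₂, w', path, rem', D, X₂, hX₂, hrun₂⟩ := exists_walkAt (E := E) (F := F) (K := K) hS
    (dl := some (t₁ + (2 * n - 2))) (t₀ := t₁) (by omega) (μ := fun k _ => .sync n (k + 1))
    (f := fun k _ => continueSync n k)
    (fun k c s hs => continueSync_eq_pass n k s) (fun _ _ _ _ _ _ => rfl)
    (fun t k c v x s hs => if_neg hs.symm)
    (fun k c v s hk h1 h2 => by
      simp only [receiveWalk, if_true, if_pos h1, State.enter]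
      -- The message with counter k + 1 is received in round t₁ + k + 1, so every station computes
      -- the same deadline.
      rw [show t₁ + k + 1 + (2 * n - 2 - (k + 1)) = t₁ + (2 * n - 2) by omega])
    (fun k c v s h1 => by simp only [receiveWalk, if_true, if_neg h1])
    (by simp) (X₀ := fun u => if u = w then (X₁ w).enter (some (t₁ + (2 * n - 2))) else X₁ u)
    ⟨hwalk₀, fun u => by split_ifs; exacts [(hX₁.idle w).enter _, hX₁.idle u],
      fun u => by split_ifs; exacts [hX₁.wout w, hX₁.wout u],
      fun u => by split_ifs with hu; exacts [hu ▸ hX₁.label w, hX₁.label u],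
      fun u => by split_ifs with hu; exacts [hu ▸ hX₁.parent w, hX₁.parent u],
      fun u => by split_ifs with hu; exacts [hu ▸ hX₁.children w, hX₁.children u],
      fun u hu => by
        rw [mem_singleton.1 hu, if_pos rfl]
        exact hX₁.children w,
      fun u => by
        have := hX₁.deadline u
        split_ifs <;> simp_all [State.enter]⟩ hhalt₁
    (fun u => by
      rw [hrun₁ u, hstart]
      congr 1
      split_ifs <;> simp_all) le_rfl
  obtain ⟨hpath, hD, hrem'⟩ := hX₂.walk.of_last (by rw [hcard])
  subst hpath hD
  obtain rfl : w' = w := hroot w' hX₂.walk.ancestors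
  have hend : continueSync n (2 * n - 2) (X₂ w') = X₂ w' := by
    have h1 := hX₂.rem w' (mem_univ w')
    have h2 : (X₂ w').parent = none := by rw [hX₂.parent, hS.root]; rfl
    rw [hrem', List.map_nil] at h1
    unfold continueSync
    split <;> simp_all
  have hfinal : net.run p (traversals E F) K (t₁ + (2 * n - 2) + 1) u =
      { X₂ u with halted := true } := by
    have hd := hX₂.deadline u
    rw [if_pos (mem_univ u)] at hd
    rw [hrun₂ u, hend]
    have : (if u = w' then X₂ w' else X₂ u) = X₂ u := by
      split_ifs with hu
      · rw [hu]
      · rfl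
    rw [this]
    unfold terminate
    split <;> simp_all
  rw [show t₀ + 2 * (2 * n - 2) = t₁ + (2 * n - 2) by omega, hfinal]
  exact ⟨hhalt₂ u, rfl, hX₂.parent u, hX₂.children u⟩

end Network

/-! ### The whole algorithm -/

namespace Network

open BTD

variable {n N : ℕ} {net : Network n N} {p : SINRParams} {E F : List (Finset ℕ)}
  {K : Finset (Fin n)}

theorem run_add_of_halted {t : ℕ} {v : Fin n}
    (h : (net.run p (traversals E F) K t v).halted = true) (s : ℕ) :
    net.run p (traversals E F) K (t + s) v = net.run p (traversals E F) K t v := by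
  induction s with
  | zero => rfl
  | succ s ih =>
    rw [← add_assoc, run_succ, ih]
    exact if_pos h

/-- As long as no search is completed, the invariant persists and keeps the smallest token in
flight. An ideal execution has no message in flight after more than 4n + 1 rounds, so this cannot
last for 4n + 2 executions. -/
theorem exists_completed (hG : (net.commGraph p).Connected) (hF : IsSSF N (75 * #p.offsets) F)
    (hF0 : 0 < F.length) {r : Fin n}
    (h : net.SearchInv p K r 0 (net.run p (traversals E F) K (E.length + 1))) :
    ∃ t₀ par ch Y X, E.length ≤ t₀ ∧ t₀ ≤ E.length + (4 * n + 2) * (2 * F.length) ∧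
      net.Completed p r t₀ par ch Y X ∧
      (∀ u, (net.run p (traversals E F) K t₀ u).halted = false) ∧
      ∀ u, net.run p (traversals E F) K (t₀ + 1) u = terminate t₀ (X u) := by
  by_contra! hcon
  have key : ∀ i ≤ 4 * n + 2, net.SearchInv p K r i
      (net.run p (traversals E F) K (E.length + 1 + i * (2 * F.length))) := by
    intro i
    induction i with
    | zero =>
      intro _
      rw [zero_mul, add_zero]
      exact h
    | succ i ih =>
      intro hi
      have hX := ih (by omega)
      obtain ⟨I, A, hI, hA, hrun⟩ :=
        run_smallestToken i hF hF0 hX.searching hX.label rfl hX.dens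
      set X := net.run p (traversals E F) K (E.length + 1 + i * (2 * F.length))
      set t := E.length + (i + 1) * (2 * F.length) with ht
      by_cases hc : ∃ v, net.Completes p r i X I A t v
      · obtain ⟨v, hv⟩ := hc
        obtain ⟨par, ch, Y, hcomp⟩ := hX.completed hG hI hA hv
        obtain ⟨u, hu⟩ := hcon t par ch Y _ (by omega)
          (Nat.add_le_add_left (Nat.mul_le_mul_right _ hi) _) hcomp fun u => (hrun u).1
        refine absurd ?_ hu
        rw [← (hrun u).2, ht]
        congr 1
        omega
      · push Not at hc
        have hnext := hX.next hG hI hA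
          (X' := fun v => finish t ((X v).withBoxes (I v) (A v)))
          fun v => (hX.local_step hI t v).resolve_left (hc v)
        convert hnext using 1
        funext v
        rw [(hrun v).2]
        refine terminate_eq_self fun d hd => ?_
        rw [(hnext.searching v).deadline] at hd
        cases hd
  have hlast := key _ le_rfl
  obtain ⟨v, c, hc, -⟩ := hlast.alive
  obtain ⟨root, g, z, hg⟩ := hlast.ghost v c hc
  have := hg.inFlight.le
  rw [Fintype.card_fin] at this
  omega

/-- If few stations survive the first stage in every box, then the algorithm is correct. -/
theorem traversals_spec (hG : (net.commGraph p).Connected) (hF : IsSSF N (75 * #p.offsets) F)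
    (hK : K.Nonempty)
    (hdens : ∀ z, #{w ∈ net.activeSet p E F K E.length | net.box p w = z} ≤ 3) :
    ∃ T ≤ E.length + (4 * n + 2) * (2 * F.length) + 4 * n + 1,
      (∀ t v, (net.run p (traversals E F) K t v).halted = true ↔ T ≤ t) ∧
      ∃ root ∈ K, ∃ parent : Fin n → Option (Fin n), IsBTDTree (net.commGraph p) root parent ∧
        ∀ t v, T ≤ t →
          (net.run p (traversals E F) K t v).parent = (parent v).map net.label ∧
          (net.run p (traversals E F) K t v).children.Nodup ∧
          ∀ z : ℕ, z ∈ (net.run p (traversals E F) K t v).children ↔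
            ∃ u, parent u = some v ∧ net.label u = z := by
  obtain ⟨r, hrK, hrmin⟩ := exists_min_image K net.label hK
  have hF0 : 0 < F.length := by
    -- An empty family does not isolate the element of a singleton.
    rw [List.length_pos_iff]
    rintro rfl
    obtain ⟨s, hs, -⟩ := hF.2 {net.label r} (by simpa using mem_Icc.1 (net.label_mem r))
      (singleton_nonempty _) (by have := p.card_offsets_pos; rw [card_singleton]; omega)
      _ (mem_singleton_self _)
    cases hs
  have helec : net.IsElection p E (net.activeSet p E F K) := isElection_activeSet
  have h0 : net.activeSet p E F K 0 = K := activeSet_zero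
  have hr : r ∈ net.activeSet p E F K E.length :=
    helec.min_mem (by rwa [h0]) (by rwa [h0]) le_rfl
  have hmin : ∀ v ∈ net.activeSet p E F K E.length, net.label r ≤ net.label v := by
    intro v hv
    refine hrmin v ?_
    rw [← h0]
    exact helec.anti (Nat.zero_le _) le_rfl hv
  have hend := fun v =>
    (run_eq_of_le_length (net := net) (p := p) (E := E) (F := F) (K := K) le_rfl v).1
  have hcomp : ∃ t₀ par ch Y X, E.length ≤ t₀ ∧ t₀ ≤ E.length + (4 * n + 2) * (2 * F.length) ∧
      net.Completed p r t₀ par ch Y X ∧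
      (∀ u, (net.run p (traversals E F) K t₀ u).halted = false) ∧
      ∀ u, net.run p (traversals E F) K (t₀ + 1) u = terminate t₀ (X u) := by
    rcases searchInv_zero hG hr hmin hdens hend E.length with h | ⟨par, ch, Y, h⟩
    · refine exists_completed hG hF hF0 ?_
      convert h using 1
      funext v
      rw [run_length_succ]
      refine terminate_eq_self fun d hd => ?_
      rw [(h.searching v).deadline] at hd
      cases hd
    · exact ⟨E.length, par, ch, Y, _, le_rfl, Nat.le_add_right _ _, h,
        fun u => by rw [hend]; rfl, fun u => run_length_succ u⟩
  obtain ⟨t₀, par, ch, Y, X, ht₀, ht₀', h, hhalt, hrun⟩ := hcomp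
  have hfin := h.halted ht₀ hhalt hrun
  -- Two walks follow round t₀; the final 1 is there because `run t` is the state before round t.
  -- Halted states are frozen, so it suffices that nobody is halted one round earlier.
  refine ⟨t₀ + 2 * (2 * n - 2) + 1, by omega, fun t v => ⟨fun ht => ?_, fun ht => ?_⟩, r, hrK, par,
    isBTDTree_of_reflTransGen h.search, fun t v ht => ?_⟩
  · by_contra! hlt
    obtain ⟨s, hs⟩ := Nat.exists_eq_add_of_le (Nat.lt_succ_iff.1 hlt)
    have := (hfin v).1
    rw [hs, run_add_of_halted ht, ht] at this
    cases this
  · obtain ⟨s, rfl⟩ := Nat.exists_eq_add_of_le ht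
    rw [run_add_of_halted (hfin v).2.1]
    exact (hfin v).2.1
  · obtain ⟨s, rfl⟩ := Nat.exists_eq_add_of_le ht
    rw [run_add_of_halted (hfin v).2.1, (hfin v).2.2.2]
    refine ⟨(hfin v).2.2.1, (h.nodup v).map net.label_injective, fun z => ?_⟩
    simp only [List.mem_map, h.mem_children]

end Network

/-! ### The parameters -/

theorem one_le_logb_succ {n : ℕ} (hn : 1 ≤ n) : 1 ≤ Real.logb 2 (n + 1) := by
  have h : (1 : ℝ) ≤ n := by exact_mod_cast hn
  rw [Real.le_logb_iff_rpow_le (by norm_num) (by positivity), Real.rpow_one]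
  linarith

/-- From a + 1 ≤ 2^a one gets N + 1 ≤ 2^a (n + 1)^d; rounding up costs one more logarithm. -/
theorem clog_le {a d n N : ℕ} (hn : 1 ≤ n) (hN : N ≤ a * n ^ d) :
    (Nat.clog 2 (N + 1) : ℝ) ≤ (a + d + 1) * Real.logb 2 (n + 1) := by
  have h1 := one_le_logb_succ hn
  have h2 : (Nat.clog 2 (N + 1) : ℝ) < Real.logb 2 (N + 1) + 1 := by
    have := Nat.ceil_lt_add_one (a := Real.logb 2 ((N + 1 : ℕ) : ℝ))
      (Real.logb_nonneg (by norm_num) (by norm_cast; omega))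
    have h3 := Real.natCeil_logb_natCast 2 (N + 1)
    push_cast at this h3
    rwa [h3] at this
  have h3 : ((N : ℝ) + 1) ≤ 2 ^ a * ((n : ℝ) + 1) ^ d := by
    have : N + 1 ≤ 2 ^ a * (n + 1) ^ d := by
      have e1 : n ^ d ≤ (n + 1) ^ d := Nat.pow_le_pow_left (Nat.le_succ n) d
      have e2 : 1 ≤ (n + 1) ^ d := Nat.one_le_pow _ _ (Nat.succ_pos n)
      have e3 : a + 1 ≤ 2 ^ a := Nat.lt_two_pow_self
      calc N + 1 ≤ a * (n + 1) ^ d + (n + 1) ^ d :=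
            add_le_add (hN.trans (Nat.mul_le_mul_left a e1)) e2
        _ = (a + 1) * (n + 1) ^ d := by ring
        _ ≤ 2 ^ a * (n + 1) ^ d := Nat.mul_le_mul_right _ e3
    exact_mod_cast this
  have h4 : Real.logb 2 (N + 1) ≤ a + d * Real.logb 2 (n + 1) := by
    refine (Real.logb_le_logb_of_le (by norm_num) (by positivity) h3).trans ?_
    rw [Real.logb_mul (by positivity) (by positivity), Real.logb_pow, Real.logb_pow,
      Real.logb_self_eq_one (by norm_num), mul_one]
  nlinarith [show (0 : ℝ) ≤ a from Nat.cast_nonneg a]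

/-- There are strongly selective families of logarithmic length. -/
theorem exists_isSSF {c : ℕ} (hc : 0 < c) {a d n N : ℕ} (hn : 1 ≤ n) (hnN : n ≤ N)
    (hN : N ≤ a * n ^ d) : ∃ F : List (Finset ℕ), IsSSF N c F ∧
      (F.length : ℝ) ≤ (a + d + 1) * (2 ^ (6 * (c + 1)) * c) * Real.logb 2 (n + 1) := by
  have hk : 0 < Nat.clog 2 (N + 1) := Nat.clog_pos (by norm_num) (by omega)
  obtain ⟨L, hlen, hL⟩ := exists_isBalanced (N := N) (G := c + 1) hc hk
    (Nat.le_pow_clog (by norm_num) _)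
  refine ⟨L, hL.isSSF hk, ?_⟩
  rw [hlen]
  push_cast
  have := mul_le_mul_of_nonneg_right (clog_le hn hN)
    (show (0 : ℝ) ≤ 2 ^ (6 * (c + 1)) * c by positivity)
  linarith

namespace BTD

/-- As i - 1 is below log_{3/2} n, the density bound at the start of phase i is at least 1. This is
what absorbs the additive rounding errors in the choice of the selectors. -/
theorem one_le_of_mem {n i : ℕ} (hn : 1 ≤ n) (hi : i ∈ Icc 1 (numSelectors n)) :
    1 ≤ (2 / 3 : ℝ) ^ (i - 1) * n := by
  obtain ⟨h1, h2⟩ := mem_Icc.1 hi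
  have h3 : ((i - 1 : ℕ) : ℝ) < Real.logb (3 / 2) n := Nat.lt_ceil.1 (by
    rw [← numSelectors]
    omega)
  have hn' : (0 : ℝ) < n := by exact_mod_cast hn
  rw [Real.lt_logb_iff_rpow_lt (by norm_num) hn', Real.rpow_natCast] at h3
  have h4 : (2 / 3 : ℝ) ^ (i - 1) * (3 / 2) ^ (i - 1) = 1 := by
    rw [← mul_pow]
    norm_num
  rw [← h4]
  gcongr

theorem pow_numSelectors_mul_le {n : ℕ} (hn : 1 ≤ n) :
    (2 / 3 : ℝ) ^ numSelectors n * n ≤ 1 := by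
  have hn' : (0 : ℝ) < n := by exact_mod_cast hn
  have h := Nat.le_ceil (Real.logb (3 / 2) n)
  rw [← numSelectors, Real.logb_le_iff_le_rpow (by norm_num) hn', Real.rpow_natCast] at h
  have h4 : (2 / 3 : ℝ) ^ numSelectors n * (3 / 2) ^ numSelectors n = 1 := by
    rw [← mul_pow]
    norm_num
  rw [← h4]
  gcongr

/-- A balanced family that serves as the selector number `i` of the first stage. -/
theorem exists_selector {s : ℕ} (hs : 0 < s) {a d n N i : ℕ} (hn : 1 ≤ n) (hnN : n ≤ N)
    (hN : N ≤ a * n ^ d) (hi : i ∈ Icc 1 (numSelectors n)) :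
    ∃ L : List (Finset ℕ), IsSelector N ⌈(2 / 3 : ℝ) ^ i * n⌉₊ ⌈(2 / 3 : ℝ) ^ i * n / 2⌉₊ L ∧
      (L.length : ℝ) ≤ (a + d + 1) * (2 ^ (60 * s) * (3 * s)) * ((2 / 3 : ℝ) ^ i * n) *
        Real.logb 2 (n + 1) ∧
      ∃ x : ℕ, IsBalanced N x (10 * s) (Nat.clog 2 (N + 1)) L ∧
        s * ((2 / 3 : ℝ) ^ (i - 1) * n) ≤ x ∧ x ≤ s * ((2 / 3 : ℝ) ^ (i - 1) * n) + 1 := by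
  have hk : 0 < Nat.clog 2 (N + 1) := Nat.clog_pos (by norm_num) (by omega)
  have hz1 := one_le_of_mem hn hi
  have hzz : (2 / 3 : ℝ) ^ (i - 1) * n = 3 / 2 * ((2 / 3 : ℝ) ^ i * n) := by
    obtain ⟨j, rfl⟩ := Nat.exists_eq_add_of_le' (mem_Icc.1 hi).1
    rw [Nat.add_sub_cancel, pow_succ]
    ring
  rw [hzz] at hz1 ⊢
  set z := (2 / 3 : ℝ) ^ i * n
  have hs' : (1 : ℝ) ≤ s := by exact_mod_cast hs
  have hx0 : 0 < (s : ℝ) * (3 / 2 * z) := by positivity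
  -- Here 3z/2 is the density bound before phase i, and s is the number of nearby boxes, so x bounds
  -- the number of nearby active stations.
  set x := ⌈(s : ℝ) * (3 / 2 * z)⌉₊ with hx
  have hx1 : (s : ℝ) * (3 / 2 * z) ≤ x := Nat.le_ceil _
  have hx2 : (x : ℝ) < s * (3 / 2 * z) + 1 := Nat.ceil_lt_add_one hx0.le
  obtain ⟨L, hlen, hL⟩ := exists_isBalanced (N := N) (G := 10 * s) (Nat.ceil_pos.2 hx0) hk
    (Nat.le_pow_clog (by norm_num) _)
  have hsz : z ≤ s * z := le_mul_of_one_le_left (by linarith) hs'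
  refine ⟨L, hL.isSelector hk (Nat.ceil_mono (by nlinarith)) ?_, ?_, x, hL, hx1, hx2.le⟩
  · have hm : z ≤ ⌈z⌉₊ := Nat.le_ceil z
    have hy : (⌈z / 2⌉₊ : ℝ) < z / 2 + 1 := Nat.ceil_lt_add_one (by linarith)
    -- The left side is below 6.5sz + 10s + 1, and 3.5sz ≥ 1 because z ≥ 2/3.
    have : (x : ℝ) + 10 * s * ⌈z / 2⌉₊ < 10 * s * (⌈z⌉₊ + 1) := by
      have e1 : (s : ℝ) * ⌈z / 2⌉₊ ≤ s * (z / 2 + 1) := by gcongr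
      have e2 : (s : ℝ) * z ≤ s * ⌈z⌉₊ := by gcongr
      linarith
    exact_mod_cast this
  · rw [hlen]
    push_cast
    have h1 := clog_le hn hN
    have h0 : 0 ≤ Real.logb 2 ((n : ℝ) + 1) := zero_le_one.trans (one_le_logb_succ hn)
    have h2 : (x : ℝ) ≤ 3 * s * z := by linarith
    rw [show 6 * (10 * s) = 60 * s by ring]
    calc (Nat.clog 2 (N + 1) : ℝ) * (2 ^ (60 * s) * x)
        ≤ ((a + d + 1) * Real.logb 2 (n + 1)) * (2 ^ (60 * s) * (3 * s * z)) := by gcongr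
      _ = _ := by ring

/-- A geometric sum; the exact factor 1 - (2/3)^j is kept for the induction and discarded later. -/
theorem length_electionSchedule_le {n : ℕ} {S : ℕ → List (Finset ℕ)} {C : ℝ} {j : ℕ}
    (h : ∀ i ∈ Icc 1 j, ((S i).length : ℝ) ≤ C * ((2 / 3 : ℝ) ^ i * n)) :
    (((List.range' 1 j).flatMap S).length : ℝ) ≤ C * (2 * n) * (1 - (2 / 3) ^ j) := by
  induction j with
  | zero => simp
  | succ j ih =>
    rw [List.range'_concat, List.flatMap_append, List.length_append]
    have h1 := ih fun i hi => h i (Icc_subset_Icc_right (Nat.le_succ j) hi)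
    have h2 := h (1 + 1 * j) (mem_Icc.2 (by omega))
    have h3 : (2 / 3 : ℝ) ^ (1 + 1 * j) = 2 / 3 * (2 / 3) ^ j := by rw [pow_add, one_mul, pow_one]
    rw [h3] at h2
    have h4 : ([1 + 1 * j].flatMap S) = S (1 + 1 * j) := by simp
    rw [h4, pow_succ]
    push_cast
    nlinarith

end BTD

/-! ### Assembly of the constants -/

theorem lemmal (p : SINRParams) :
    ∃ c : ℕ, 0 < c ∧ ∀ a d : ℕ,
      -- there are strongly selective families of logarithmic length
      (∃ B : ℝ, ∀ n N : ℕ, 1 ≤ n → n ≤ N → N ≤ a * n ^ d →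
        ∃ F : List (Finset ℕ), IsSSF N c F ∧ (F.length : ℝ) ≤ B * Real.logb 2 (n + 1)) ∧
      ∀ B : ℝ, ∃ C : ℝ, ∀ n N : ℕ, 1 ≤ n → n ≤ N → N ≤ a * n ^ d →
        -- the selectors of the first stage
        ∃ S : ℕ → List (Finset ℕ),
          (∀ i ∈ Finset.Icc 1 (BTD.numSelectors n),
            IsSelector N ⌈(2 / 3 : ℝ) ^ i * n⌉₊ ⌈(2 / 3 : ℝ) ^ i * n / 2⌉₊ (S i) ∧
            ((S i).length : ℝ) ≤ C * ((2 / 3 : ℝ) ^ i * n) * Real.logb 2 (n + 1)) ∧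
          ∀ F : List (Finset ℕ), IsSSF N c F → (F.length : ℝ) ≤ B * Real.logb 2 (n + 1) →
          ∀ (net : Network n N), (net.commGraph p).Connected →
          ∀ K : Finset (Fin n), K.Nonempty →
            ∃ T : ℕ, (T : ℝ) ≤ C * n * Real.logb 2 (n + 1) ∧
              -- all nodes terminate at the same time
              (∀ (t : ℕ) (v : Fin n),
                (net.run p (BTD.traversals (BTD.electionSchedule n S) F) K t v).halted = true ↔
                  T ≤ t) ∧
              -- and then a BTD tree rooted at a rumour holder is stored locally
              ∃ root ∈ K, ∃ parent : Fin n → Option (Fin n),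
                IsBTDTree (net.commGraph p) root parent ∧
                ∀ (t : ℕ) (v : Fin n), T ≤ t →
                  (net.run p (BTD.traversals (BTD.electionSchedule n S) F) K t v).parent =
                    (parent v).map net.label ∧
                  (net.run p (BTD.traversals (BTD.electionSchedule n S) F) K t v).children.Nodup ∧
                  ∀ z : ℕ,
                    z ∈ (net.run p (BTD.traversals (BTD.electionSchedule n S) F) K t v).children ↔
                      ∃ u, parent u = some v ∧ net.label u = z := by
  have hs := p.card_offsets_pos
  refine ⟨75 * #p.offsets, by omega, fun a d => ⟨⟨_, fun n N hn hnN hN =>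
    exists_isSSF (by omega) hn hnN hN⟩, fun B => ?_⟩⟩
  set C₁ : ℝ := (a + d + 1) * (2 ^ (60 * #p.offsets) * (3 * #p.offsets)) with hC₁
  have hC₁0 : 0 ≤ C₁ := by positivity
  -- The three terms pay for the selectors, for at most 4n + 2 ≤ 6n executions of 2|F| rounds, and
  -- for the 4n + 1 ≤ 5n rounds that bound the walks. The absolute value covers a negative `B`.
  refine ⟨2 * C₁ + 12 * |B| + 5, fun n N hn hnN hN => ?_⟩
  have hLg := one_le_logb_succ hn
  have hn' : (1 : ℝ) ≤ n := by exact_mod_cast hn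
  set lg := Real.logb 2 (n + 1) with hlg
  have hex := fun i (hi : i ∈ Icc 1 (BTD.numSelectors n)) =>
    BTD.exists_selector hs hn hnN hN hi
  choose! S hsel hlen hbal using hex
  refine ⟨S, fun i hi => ⟨hsel i hi, (hlen i hi).trans ?_⟩, fun F hF hFlen net hG K hK => ?_⟩
  · rw [← hC₁]
    have hB := abs_nonneg B
    gcongr
    linarith
  have hdens : ∀ z, #{w ∈ net.activeSet p (BTD.electionSchedule n S) F K
      (BTD.electionSchedule n S).length | net.box p w = z} ≤ 3 := by
    intro z
    have h := (net.isElection_activeSet (p := p) (E := BTD.electionSchedule n S) (F := F)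
      (K := K)).density_le S (Nat.clog_pos (by norm_num) (by omega)) (BTD.numSelectors n) hbal
      (List.prefix_refl _) z
    -- After all phases the geometric bound is at most 1, so the density bound is the floor 3.
    rw [max_eq_left ((BTD.pow_numSelectors_mul_le hn).trans (by norm_num))] at h
    exact_mod_cast h
  obtain ⟨T, hT, hhalt, htree⟩ := Network.traversals_spec hG hF hK hdens
  refine ⟨T, ?_, hhalt, htree⟩
  have hE : ((BTD.electionSchedule n S).length : ℝ) ≤ C₁ * lg * (2 * n) := by
    refine (BTD.length_electionSchedule_le (n := n) (C := C₁ * lg) fun i hi =>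
      (hlen i hi).trans (le_of_eq (by rw [← hC₁]; ring))).trans ?_
    have : (0 : ℝ) ≤ (2 / 3) ^ BTD.numSelectors n := by positivity
    have h0 : 0 ≤ C₁ * lg * (2 * n) := by positivity
    nlinarith
  have hT' : (T : ℝ) ≤ (BTD.electionSchedule n S).length + (4 * n + 2) * (2 * F.length) +
      4 * n + 1 := by exact_mod_cast hT
  have hFB : (F.length : ℝ) ≤ |B| * lg := hFlen.trans (by gcongr; exact le_abs_self B)
  have h1 : (4 * (n : ℝ) + 2) * (2 * F.length) ≤ 6 * n * (2 * (|B| * lg)) := by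
    gcongr
    linarith
  have h2 : (n : ℝ) ≤ n * lg := le_mul_of_one_le_right (by linarith) hLg
  calc (T : ℝ) ≤ C₁ * lg * (2 * n) + 6 * n * (2 * (|B| * lg)) + 5 * (n * lg) := by linarith
    _ = _ := by ring
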